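/- Let $(\mathsf V,\mathsf E)$ be a finite directed graph without loops (parallel edges allowed). For each $\mathsf e\in\mathsf E$ let $\ell_{\mathsf e}>0$, identify $\mathsf e$ with $[0,\ell_{\mathsf e}]$ (initial endpoint $\leftrightarrow 0$, terminal endpoint $\leftrightarrow \ell_{\mathsf e}$), and let $k_{\mathsf e}\ge 1$ be an integer. For $\mathsf v\in\mathsf V$ let $\mathsf E_{\mathsf v}$ be the set of edges incident to $\mathsf v$, $k_{\mathsf v}=\sum_{\mathsf e\in\mathsf E_{\mathsf v}}k_{\mathsf e}$, $k=\sum_{\mathsf e\in\mathsf E}k_{\mathsf e}$. For each $\mathsf e$ let $M_{\mathsf e},N_{\mathsf e},Q_{\mathsf e}:[0,\ell_{\mathsf e}]\to M_{k_{\mathsf e}}(\mathbb C)$ be such that $M_{\mathsf e}$ is Lipschitz with $M_{\mathsf e}(x)$ invertible for all $x$; $N_{\mathsf e}\in L^\infty$; $Q_{\mathsf e}$ is Lipschitz, $Q_{\mathsf e}(x)$ and $Q_{\mathsf e}(x)M_{\mathsf e}(x)$ are Hermitian for all $x$, and $Q_{\mathsf e}(x)\xi\cdot\bar\xi\ge q_{\mathsf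 e}\|\xi\|^2$ for some $q_{\mathsf e}>0$ and all $x,\xi$. For each $\mathsf v$ let $Y^{(d)}_{\mathsf v}\subset Y_{\mathsf v}$ be subspaces of $\mathbb C^{k_{\mathsf v}}$, let $B_{\mathsf v}:Y_{\mathsf v}\to Y_{\mathsf v}^{(d)}$ and $C_{\mathsf v}:Y_{\mathsf v}^{(d)}\to Y_{\mathsf v}^{(d)}$ be linear, and let $Q_{\mathsf v}$ be a Hermitian positive definite operator on $Y^{(d)}_{\mathsf v}$. Orthogonality, adjoints and the orthogonal projector $P^{(d)}_{\mathsf v}$ of $\mathbb C^{k_{\mathsf v}}$ onto $Y^{(d)}_{\mathsf v}$ refer to the Euclidean inner product; in particular $B_{\mathsf v}^*:Y^{(d)}_{\mathsf v}\to Y_{\mathsf v}$. Let $\mathbf L^2_d(\mathcal G)=\bigoplus_{\mathsf e}L^2(0,\ell_{\mathsf e})^{k_{\mathsf e}}\oplus\bigoplus_{\mathsf v}Y^{(d)}_{\mathsf v}$ with the inner product $$\left((u,\mathsf x),(w,\mathsf y)\right)_d=\sum_{\mathsf e}\int_0^{\ell_{\mathsf e}}Q_{\mathsf e}u_{\mathsf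 e}\cdot\bar w_{\mathsf e}\,dx+\sum_{\mathsf v}Q_{\mathsf v}\mathsf x_{\mathsf v}\cdot\bar{\mathsf y}_{\mathsf v}.$$ For $u\in D_{\max}=\bigoplus_{\mathsf e}H^1(0,\ell_{\mathsf e})^{k_{\mathsf e}}$ put $\gamma_{\mathsf v}(u)=(u_{\mathsf e}(\mathsf v))_{\mathsf e\in\mathsf E_{\mathsf v}}\in\mathbb C^{k_{\mathsf v}}$. Let $\mathbb A$ be the operator on $\mathbf L^2_d(\mathcal G)$ given by $$\mathbb A(u,\mathsf x)=\left((M_{\mathsf e}u_{\mathsf e}'+N_{\mathsf e}u_{\mathsf e})_{\mathsf e},\ (B_{\mathsf v}\gamma_{\mathsf v}(u)+C_{\mathsf v}\mathsf x_{\mathsf v})_{\mathsf v}\right),$$ $$D(\mathbb A)=\{(u,\mathsf x): u\in D_{\max},\ \gamma_{\mathsf v}(u)\in Y_{\mathsf v},\ \mathsf x_{\mathsf v}=P^{(d)}_{\mathsf v}\gamma_{\mathsf v}(u)\ \text{for all }\mathsf v\in\mathsf V\}.$$ Let $T_{\mathsf v}=\operatorname{diag}(\iota_{\mathsf v\mathsf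 e}Q_{\mathsf e}(\mathsf v)M_{\mathsf e}(\mathsf v))_{\mathsf e\in\mathsf E_{\mathsf v}}$, where $\iota_{\mathsf v\mathsf e}=1$ (resp. $-1$) if $\mathsf v$ is the terminal (resp. initial) endpoint of $\mathsf e$. For each $\mathsf v$ fix bases $(\mathsf w^{(\mathsf v,i)})_i$ of $Y_{\mathsf v}^\perp$, $(\mathsf y^{(\mathsf v,j)})_j$ of $\operatorname{Ran}B_{\mathsf v}$ and $(\mathsf z^{(\mathsf v,l)})_l$ of $\operatorname{Ker}B_{\mathsf v}^*$. Assume: (1) the family consisting of all vectors $\mathsf w^{(\mathsf v,i)}$, $B_{\mathsf v}^*\mathsf y^{(\mathsf v,j)}$, $\mathsf z^{(\mathsf v,l)}$, over all $\mathsf v\in\mathsf V$ and all indices (counted with multiplicity), each extended by zero from $\mathbb C^{k_{\mathsf v}}$ to $\mathbb C^k=\bigoplus_{\mathsf e\in\mathsf E}\mathbb C^{k_{\mathsf e}}$, is a basis of $\mathbb C^k$; (2) for each $\mathsf v\in\mathsf V$, $Y_{\mathsf v}$ is contained in the null isotropic cone of the quadratic form associated with $T_{\mathsf v}+Q_{\mathsf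 v}B_{\mathsf v}+B_{\mathsf v}^*Q_{\mathsf v}$, i.e. $(T_{\mathsf v}+Q_{\mathsf v}B_{\mathsf v}+B_{\mathsf v}^*Q_{\mathsf v}P^{(d)}_{\mathsf v})\xi\cdot\bar\xi=0$ for all $\xi\in Y_{\mathsf v}$. Then $\mathbb A$ generates a strongly continuous group ($C_0$-group) on $\mathbf L^2_d(\mathcal G)$. -/

import Mathlib

namespace DynNet

open MeasureTheory Set Filter Topology
open scoped ContDiff InnerProductSpace

noncomputable section

/-- The space `L²(0,ℓ)` of `F`-valued functions. -/
abbrev L2I (ℓ : ℝ) (F : Type*) [NormedAddCommGroup F] : Type _ :=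
  Lp F 2 (volume.restrict (Ioo (0 : ℝ) ℓ))

/-- Test functions on the open interval `(0,ℓ)`. -/
def IsTest (ℓ : ℝ) (φ : ℝ → ℝ) : Prop :=
  ContDiff ℝ ∞ φ ∧ HasCompactSupport φ ∧ tsupport φ ⊆ Ioo 0 ℓ

section Sobolev

theorem L2I.integrable {F : Type*} [NormedAddCommGroup F] {ℓ : ℝ} (u : L2I ℓ F) :
    Integrable u (volume.restrict (Ioo (0 : ℝ) ℓ)) :=
  (Lp.memLp u).integrable (by norm_num)

variable {F : Type*} [NormedAddCommGroup F] [NormedSpace ℂ F]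

/-- `g` is the weak derivative of `u` on `(0,ℓ)`. -/
def IsWeakDeriv {ℓ : ℝ} (u g : L2I ℓ F) : Prop :=
  ∀ φ : ℝ → ℝ, IsTest ℓ φ →
    ∫ x in Ioo 0 ℓ, deriv φ x • u x = - ∫ x in Ioo 0 ℓ, φ x • g x

theorem L2I.integrable_smul {ℓ : ℝ} (u : L2I ℓ F) {φ : ℝ → ℝ} (hφ : Continuous φ)
    (hc : HasCompactSupport φ) :
    Integrable (fun x => φ x • u x) (volume.restrict (Ioo (0 : ℝ) ℓ)) := by
  obtain ⟨C, hC⟩ := hc.exists_bound_of_continuous hφ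
  exact Integrable.bdd_smul (𝕜 := ℝ) (L2I.integrable u) C hφ.aestronglyMeasurable
    (Eventually.of_forall hC)

theorem IsTest.continuous {ℓ : ℝ} {φ : ℝ → ℝ} (h : IsTest ℓ φ) : Continuous φ := h.1.continuous

theorem IsTest.continuous_deriv {ℓ : ℝ} {φ : ℝ → ℝ} (h : IsTest ℓ φ) : Continuous (deriv φ) :=
  h.1.continuous_deriv (by norm_num)

theorem IsWeakDeriv.add {ℓ : ℝ} {u g u' g' : L2I ℓ F} (h : IsWeakDeriv u g)
    (h' : IsWeakDeriv u' g') : IsWeakDeriv (u + u') (g + g') := by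
  intro φ hφ
  have e1 : ∫ x in Ioo 0 ℓ, deriv φ x • (u + u' : L2I ℓ F) x
      = ∫ x in Ioo 0 ℓ, (deriv φ x • u x + deriv φ x • u' x) :=
    integral_congr_ae (by filter_upwards [Lp.coeFn_add u u'] with x hx; rw [hx]; exact smul_add _ _ _)
  have e2 : ∫ x in Ioo 0 ℓ, φ x • (g + g' : L2I ℓ F) x
      = ∫ x in Ioo 0 ℓ, (φ x • g x + φ x • g' x) :=
    integral_congr_ae (by filter_upwards [Lp.coeFn_add g g'] with x hx; rw [hx]; exact smul_add _ _ _)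
  rw [e1, e2, integral_add, integral_add, h φ hφ, h' φ hφ, neg_add]
  · exact g.integrable_smul hφ.continuous hφ.2.1
  · exact g'.integrable_smul hφ.continuous hφ.2.1
  · exact u.integrable_smul hφ.continuous_deriv hφ.2.1.deriv
  · exact u'.integrable_smul hφ.continuous_deriv hφ.2.1.deriv

theorem IsWeakDeriv.smul {ℓ : ℝ} {u g : L2I ℓ F} (c : ℂ) (h : IsWeakDeriv u g) :
    IsWeakDeriv (c • u) (c • g) := by
  intro φ hφ
  have e1 : ∫ x in Ioo 0 ℓ, deriv φ x • (c • u : L2I ℓ F) x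
      = ∫ x in Ioo 0 ℓ, c • (deriv φ x • u x) :=
    integral_congr_ae (by
      filter_upwards [Lp.coeFn_smul c u] with x hx; rw [hx]; exact smul_comm _ _ _)
  have e2 : ∫ x in Ioo 0 ℓ, φ x • (c • g : L2I ℓ F) x
      = ∫ x in Ioo 0 ℓ, c • (φ x • g x) :=
    integral_congr_ae (by
      filter_upwards [Lp.coeFn_smul c g] with x hx; rw [hx]; exact smul_comm _ _ _)
  rw [e1, e2, integral_smul, integral_smul, h φ hφ, smul_neg]

theorem IsWeakDeriv.zero {ℓ : ℝ} : IsWeakDeriv (0 : L2I ℓ F) 0 := by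
  intro φ _
  have e (ψ : ℝ → ℝ) : ∫ x in Ioo 0 ℓ, ψ x • (0 : L2I ℓ F) x = 0 := by
    rw [integral_congr_ae (g := fun _ => (0 : F)), integral_zero]
    filter_upwards [Lp.coeFn_zero F 2 (volume.restrict (Ioo (0 : ℝ) ℓ))] with x hx
    rw [hx]; exact smul_zero _
  rw [e, e, neg_zero]

variable [CompleteSpace F]

theorem ae_eq_zero_of_test {ℓ : ℝ} {f : ℝ → F}
    (hf : Integrable f (volume.restrict (Ioo (0 : ℝ) ℓ)))
    (h : ∀ φ, IsTest ℓ φ → ∫ x in Ioo 0 ℓ, φ x • f x = 0) :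
    f =ᵐ[volume.restrict (Ioo (0 : ℝ) ℓ)] 0 := by
  have := IsOpen.ae_eq_zero_of_integral_contDiff_smul_eq_zero (f := f) (μ := volume)
    (isOpen_Ioo (a := (0 : ℝ)) (b := ℓ)) (IntegrableOn.locallyIntegrableOn hf) (by
      intro g h1 h2 h3
      rw [← h g ⟨h1, h2, h3⟩, setIntegral_eq_integral_of_forall_compl_eq_zero]
      intro x hx
      rw [image_eq_zero_of_notMem_tsupport (fun hx' => hx (h3 hx')), zero_smul])
  exact (ae_restrict_iff' measurableSet_Ioo).2 this

theorem IsWeakDeriv.unique {ℓ : ℝ} {u g g' : L2I ℓ F} (h : IsWeakDeriv u g)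
    (h' : IsWeakDeriv u g') : g = g' := by
  have := ae_eq_zero_of_test (f := fun x => g x - g' x)
    ((L2I.integrable g).sub (L2I.integrable g')) (by
      intro φ hφ
      simp_rw [smul_sub]
      rw [integral_sub (g.integrable_smul hφ.continuous hφ.2.1)
        (g'.integrable_smul hφ.continuous hφ.2.1), sub_eq_zero, ← neg_inj, ← h φ hφ, h' φ hφ])
  apply Lp.ext
  filter_upwards [this] with x hx
  exact sub_eq_zero.1 hx

/-- Integration by parts for a primitive of an integrable function. -/
theorem integral_deriv_smul_primitive {ℓ : ℝ} {g : ℝ → F}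
    (hg : Integrable g (volume.restrict (Ioo (0 : ℝ) ℓ))) {φ : ℝ → ℝ} (hφ : IsTest ℓ φ) :
    ∫ x in Ioo 0 ℓ, deriv φ x • (∫ y in (0 : ℝ)..x, g y) = - ∫ x in Ioo 0 ℓ, φ x • g x := by
  set μ := volume.restrict (Ioo (0 : ℝ) ℓ) with hμ
  have hd : Integrable (deriv φ) μ :=
    (hφ.continuous_deriv.integrable_of_hasCompactSupport hφ.2.1.deriv).restrict
  let k : ℝ → ℝ → F := fun x y => {p : ℝ × ℝ | p.2 < p.1}.indicator
    (fun p => deriv φ p.1 • g p.2) (x, y)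
  have hk : Integrable (Function.uncurry k) (μ.prod μ) := by
    have := (hd.smul_prod hg).indicator (s := {p : ℝ × ℝ | p.2 < p.1})
      (measurableSet_lt measurable_snd measurable_fst)
    exact this
  have hswap := integral_integral_swap hk
  have h1 : ∀ᵐ x ∂μ, ∫ y, k x y ∂μ = deriv φ x • (∫ y in (0 : ℝ)..x, g y) := by
    rw [hμ, ae_restrict_iff' measurableSet_Ioo]
    refine Eventually.of_forall fun x hx => ?_
    have : ∀ y, k x y = (Iio x).indicator (fun y => deriv φ x • g y) y := by
      intro y; simp [k, indicator]
    simp_rw [this]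
    rw [integral_indicator measurableSet_Iio, integral_smul,
      intervalIntegral.integral_of_le hx.1.le, ← integral_Ioc_eq_integral_Ioo.symm,
      Measure.restrict_restrict measurableSet_Iio]
    congr 3
    ext y; simp only [mem_inter_iff, mem_Iio, mem_Ioo]; constructor
    · rintro ⟨a, b, c⟩; exact ⟨b, a⟩
    · rintro ⟨a, b⟩; exact ⟨b, a, b.trans hx.2⟩
  have h2 : ∀ᵐ y ∂μ, ∫ x, k x y ∂μ = - (φ y • g y) := by
    rw [hμ, ae_restrict_iff' measurableSet_Ioo]
    refine Eventually.of_forall fun y hy => ?_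
    have : ∀ x, k x y = (Ioi y).indicator (fun x => deriv φ x • g y) x := by
      intro x; simp [k, indicator]
    simp_rw [this]
    rw [integral_indicator measurableSet_Ioi, integral_smul_const,
      Measure.restrict_restrict measurableSet_Ioi]
    have hs : Ioi y ∩ Ioo 0 ℓ = Ioo y ℓ := by
      ext x; simp only [mem_inter_iff, mem_Ioi, mem_Ioo]; constructor
      · rintro ⟨a, b, c⟩; exact ⟨a, c⟩
      · rintro ⟨a, b⟩; exact ⟨a, hy.1.trans a, b⟩
    rw [hs, ← integral_Ioc_eq_integral_Ioo, ← intervalIntegral.integral_of_le hy.2.le,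
      intervalIntegral.integral_deriv_eq_sub
        (fun x _ => (hφ.1.differentiable (by norm_num)).differentiableAt)
        (hφ.continuous_deriv.intervalIntegrable _ _),
      image_eq_zero_of_notMem_tsupport (fun h => lt_irrefl _ (hφ.2.2 h).2), zero_sub, neg_smul]
  rw [← integral_congr_ae h1, hswap, integral_congr_ae h2, integral_neg]

theorem exists_test_integral_one {ℓ : ℝ} (hℓ : 0 < ℓ) :
    ∃ ψ : ℝ → ℝ, IsTest ℓ ψ ∧ ∫ x, ψ x = 1 := by
  let b : ContDiffBump (ℓ / 2) := ⟨ℓ / 8, ℓ / 4, by positivity, by linarith⟩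
  refine ⟨b.normed volume, ⟨b.contDiff_normed, b.hasCompactSupport_normed, ?_⟩, b.integral_normed⟩
  rw [b.tsupport_normed_eq, Real.closedBall_eq_Icc]
  intro x hx
  have h1 : ℓ / 2 - ℓ / 4 ≤ x := hx.1
  have h2 : x ≤ ℓ / 2 + ℓ / 4 := hx.2
  constructor <;> linarith

/-- A test function of vanishing integral is the derivative of a test function. -/
theorem IsTest.exists_deriv_eq {ℓ : ℝ} (hℓ : 0 < ℓ) {h : ℝ → ℝ} (hh : IsTest ℓ h)
    (h0 : ∫ x, h x = 0) : ∃ θ : ℝ → ℝ, IsTest ℓ θ ∧ deriv θ = h := by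
  obtain ⟨a, b, ha, hb, hab⟩ : ∃ a b : ℝ, 0 < a ∧ b < ℓ ∧ tsupport h ⊆ Icc a b := by
    have hK : IsCompact (tsupport h) := hh.2.1
    rcases (tsupport h).eq_empty_or_nonempty with he | hne
    · exact ⟨ℓ / 2, ℓ / 2, by positivity, by linarith, by simp [he]⟩
    · obtain ⟨a, haK, ha⟩ := hK.exists_isLeast hne
      obtain ⟨b, hbK, hb⟩ := hK.exists_isGreatest hne
      exact ⟨a, b, (hh.2.2 haK).1, (hh.2.2 hbK).2, fun x hx => ⟨ha hx, hb hx⟩⟩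
  have hz : ∀ x, x ∉ Icc a b → h x = 0 := fun x hx =>
    image_eq_zero_of_notMem_tsupport (fun hx' => hx (hab hx'))
  let θ : ℝ → ℝ := fun x => ∫ t in (0 : ℝ)..x, h t
  have hd : ∀ x, HasDerivAt θ (h x) x := fun x =>
    intervalIntegral.integral_hasDerivAt_right (hh.continuous.intervalIntegrable _ _)
      (hh.continuous.stronglyMeasurableAtFilter _ _) hh.continuous.continuousAt
  have hde : deriv θ = h := funext fun x => (hd x).deriv
  have hθ : ∀ x, x ∉ Icc a b → θ x = 0 := by
    intro x hx
    rcases lt_or_ge x a with hxa | hxa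
    · refine (intervalIntegral.integral_congr_ae (g := fun _ => 0)
        (Eventually.of_forall fun t ht => hz t fun ht' => ?_)).trans (by simp)
      have h1 : t ≤ max 0 x := ht.2
      have h2 : max 0 x < a := max_lt ha hxa
      exact absurd ht'.1 (not_le.2 (h1.trans_lt h2))
    · have hxb : b < x := by
        by_contra hcon
        exact hx ⟨hxa, not_lt.1 hcon⟩
      have : θ x = ∫ t, h t := by
        apply intervalIntegral.integral_eq_integral_of_support_subset
        intro t ht
        have ht' : t ∈ Icc a b := by
          by_contra hcon
          exact ht (hz t hcon)
        exact ⟨ha.trans_le ht'.1, ht'.2.trans hxb.le⟩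
      rw [this, h0]
  have hts : tsupport θ ⊆ Icc a b := by
    refine closure_minimal (fun x hx => ?_) isClosed_Icc
    by_contra hcon
    exact hx (hθ x hcon)
  refine ⟨θ, ⟨?_, ?_, ?_⟩, hde⟩
  · rw [contDiff_infty_iff_deriv]
    exact ⟨fun x => (hd x).differentiableAt, hde ▸ hh.1⟩
  · exact isCompact_Icc.of_isClosed_subset (isClosed_tsupport θ) hts
  · exact hts.trans fun x hx => ⟨ha.trans_le hx.1, hx.2.trans_lt hb⟩

/-- An `H¹` function on an interval is, almost everywhere, the primitive of its weak derivative. -/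
theorem IsWeakDeriv.exists_primitive {ℓ : ℝ} (hℓ : 0 < ℓ) {u g : L2I ℓ F} (h : IsWeakDeriv u g) :
    ∃ c : F, u =ᵐ[volume.restrict (Ioo (0 : ℝ) ℓ)] fun x => c + ∫ y in (0 : ℝ)..x, g y := by
  obtain ⟨ψ, hψ, hψ1⟩ := exists_test_integral_one hℓ
  have hgI : IntegrableOn g (Icc 0 ℓ) volume := by
    rw [integrableOn_Icc_iff_integrableOn_Ioo]; exact L2I.integrable g
  have hGc : ContinuousOn (fun x => ∫ y in (0 : ℝ)..x, g y) (Icc 0 ℓ) :=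
    intervalIntegral.continuousOn_primitive_interval (by rwa [uIcc_of_le hℓ.le])
      |>.mono (by rw [uIcc_of_le hℓ.le])
  have hGI : Integrable (fun x => ∫ y in (0 : ℝ)..x, g y) (volume.restrict (Ioo (0 : ℝ) ℓ)) :=
    (hGc.integrableOn_Icc).mono_set Ioo_subset_Icc_self
  let w : ℝ → F := fun x => u x - ∫ y in (0 : ℝ)..x, g y
  have hwI : Integrable w (volume.restrict (Ioo (0 : ℝ) ℓ)) := (L2I.integrable u).sub hGI
  have hint : ∀ {φ : ℝ → ℝ} {f : ℝ → F}, Continuous φ → HasCompactSupport φ →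
      Integrable f (volume.restrict (Ioo (0 : ℝ) ℓ)) →
      Integrable (fun x => φ x • f x) (volume.restrict (Ioo (0 : ℝ) ℓ)) := by
    intro φ f hφ hc hf
    obtain ⟨C, hC⟩ := hc.exists_bound_of_continuous hφ
    exact Integrable.bdd_smul (𝕜 := ℝ) hf C hφ.aestronglyMeasurable (Eventually.of_forall hC)
  have hw : ∀ φ, IsTest ℓ φ → ∫ x in Ioo 0 ℓ, deriv φ x • w x = 0 := by
    intro φ hφ
    simp_rw [w, smul_sub]
    rw [integral_sub (hint hφ.continuous_deriv hφ.2.1.deriv (L2I.integrable u))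
      (hint hφ.continuous_deriv hφ.2.1.deriv hGI), h φ hφ,
      integral_deriv_smul_primitive (L2I.integrable g) hφ, sub_self]
  refine ⟨∫ x in Ioo 0 ℓ, ψ x • w x, ?_⟩
  set c := ∫ x in Ioo 0 ℓ, ψ x • w x with hc
  have key := ae_eq_zero_of_test (ℓ := ℓ) (f := fun x => w x - c)
    (hwI.sub (integrable_const c)) (by
      intro φ hφ
      have hφI : Integrable φ := hφ.continuous.integrable_of_hasCompactSupport hφ.2.1
      have hψI : Integrable ψ := hψ.continuous.integrable_of_hasCompactSupport hψ.2.1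
      have hT : IsTest ℓ (fun x => φ x - (∫ t, φ t) * ψ x) := by
        refine ⟨hφ.1.sub (contDiff_const.mul hψ.1), hφ.2.1.sub hψ.2.1.mul_left, ?_⟩
        refine (tsupport_sub φ (fun x => (∫ t, φ t) * ψ x)).trans (union_subset hφ.2.2 ?_)
        exact (tsupport_mul_subset_right).trans hψ.2.2
      obtain ⟨θ, hθ, hθd⟩ := hT.exists_deriv_eq hℓ (by
        rw [integral_sub hφI (hψI.const_mul _), integral_const_mul, hψ1, mul_one, sub_self])
      have h1 := hw θ hθ
      rw [hθd] at h1
      have h2 : ∫ x in Ioo 0 ℓ, φ x • w x = (∫ t, φ t) • c := by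
        have hI2 : Integrable (fun x => (∫ t, φ t) • ψ x • w x)
            (volume.restrict (Ioo (0 : ℝ) ℓ)) :=
          (hint hψ.continuous hψ.2.1 hwI).smul (∫ t, φ t)
        rw [hc, ← integral_smul, ← sub_eq_zero,
          ← integral_sub (hint hφ.continuous hφ.2.1 hwI) hI2, ← h1]
        refine integral_congr_ae (Eventually.of_forall fun x => ?_)
        simp only [sub_smul, mul_smul]
      have h3 : ∫ x in Ioo 0 ℓ, φ x = ∫ t, φ t :=
        setIntegral_eq_integral_of_forall_compl_eq_zero fun x hx =>
          image_eq_zero_of_notMem_tsupport (fun hx' => hx (hφ.2.2 hx'))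
      simp_rw [smul_sub]
      rw [integral_sub (hint hφ.continuous hφ.2.1 hwI) (hφI.restrict.smul_const c), h2,
        integral_smul_const, h3, sub_self])
  filter_upwards [key] with x hx
  have hx' : w x = c := sub_eq_zero.1 hx
  rw [← hx']
  simp [w]

/-- The Sobolev space `H¹(0,ℓ)`: square integrable functions with square integrable weak
derivative. -/
def H1 (ℓ : ℝ) (F : Type*) [NormedAddCommGroup F] [NormedSpace ℂ F] :
    Submodule ℂ (L2I ℓ F) where
  carrier := {u | ∃ g, IsWeakDeriv u g}
  add_mem' := fun ⟨g, hg⟩ ⟨g', hg'⟩ => ⟨g + g', hg.add hg'⟩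
  zero_mem' := ⟨0, IsWeakDeriv.zero⟩
  smul_mem' := fun c _ ⟨g, hg⟩ => ⟨c • g, hg.smul c⟩

/-- The weak derivative `u ↦ u'` on `H¹(0,ℓ)`. -/
def H1.deriv {ℓ : ℝ} : H1 ℓ F →ₗ[ℂ] L2I ℓ F where
  toFun u := u.2.choose
  map_add' u w := (u + w).2.choose_spec.unique (u.2.choose_spec.add w.2.choose_spec)
  map_smul' c u := (c • u).2.choose_spec.unique (u.2.choose_spec.smul c)

theorem H1.exists_continuous {ℓ : ℝ} (hℓ : 0 < ℓ) (u : H1 ℓ F) :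
    ∃ f : ℝ → F, ContinuousOn f (Icc 0 ℓ) ∧
      (u : L2I ℓ F) =ᵐ[volume.restrict (Ioo (0 : ℝ) ℓ)] f := by
  obtain ⟨g, hg⟩ := u.2
  obtain ⟨c, hc⟩ := hg.exists_primitive hℓ
  have hgI : IntegrableOn g (Icc 0 ℓ) volume := by
    rw [integrableOn_Icc_iff_integrableOn_Ioo]; exact L2I.integrable g
  refine ⟨_, ?_, hc⟩
  exact continuousOn_const.add
    (intervalIntegral.continuousOn_primitive_interval (by rwa [uIcc_of_le hℓ.le])
      |>.mono (by rw [uIcc_of_le hℓ.le]))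

/-- The continuous representative on `[0,ℓ]` of an element of `H¹(0,ℓ)`. -/
def H1.rep {ℓ : ℝ} (hℓ : 0 < ℓ) (u : H1 ℓ F) : ℝ → F :=
  (H1.exists_continuous hℓ u).choose

theorem H1.rep_unique {ℓ : ℝ} (hℓ : 0 < ℓ) (u : H1 ℓ F) {f : ℝ → F}
    (hf : ContinuousOn f (Icc 0 ℓ))
    (hu : (u : L2I ℓ F) =ᵐ[volume.restrict (Ioo (0 : ℝ) ℓ)] f) :
    EqOn (H1.rep hℓ u) f (Icc 0 ℓ) := by
  have h := (H1.exists_continuous hℓ u).choose_spec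
  refine Measure.eqOn_Icc_of_ae_eq volume hℓ.ne ?_ h.1 hf
  rw [restrict_Ioo_eq_restrict_Icc.symm]
  exact h.2.symm.trans hu

/-- The value `u(x)` of `u ∈ H¹(0,ℓ)` at `x ∈ [0,ℓ]`, endpoints included. -/
def H1.eval {ℓ : ℝ} (hℓ : 0 < ℓ) (x : ℝ) (hx : x ∈ Icc 0 ℓ) : H1 ℓ F →ₗ[ℂ] F where
  toFun u := H1.rep hℓ u x
  map_add' u w := by
    have h := (H1.exists_continuous hℓ u).choose_spec
    have h' := (H1.exists_continuous hℓ w).choose_spec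
    refine H1.rep_unique hℓ (u + w) (f := fun x => H1.rep hℓ u x + H1.rep hℓ w x)
      (h.1.add h'.1) ?_ hx
    filter_upwards [Lp.coeFn_add (u : L2I ℓ F) w, h.2, h'.2] with y hy h1 h2
    rw [Submodule.coe_add, hy, Pi.add_apply, h1, h2]
    rfl
  map_smul' c u := by
    have h := (H1.exists_continuous hℓ u).choose_spec
    refine H1.rep_unique hℓ (c • u) (f := fun x => c • H1.rep hℓ u x) (h.1.const_smul c) ?_ hx
    filter_upwards [Lp.coeFn_smul c (u : L2I ℓ F), h.2] with y hy h1
    rw [Submodule.coe_smul, hy, Pi.smul_apply, h1]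
    rfl

end Sobolev

section Multiplication

variable {n : Type*} {ℓ : ℝ}

/-- Matrix functions on `(0,ℓ)` of class `L^∞`. -/
def IsLinfty (ℓ : ℝ) (A : ℝ → Matrix n n ℂ) : Prop :=
  ∀ i j, MemLp (fun x => A x i j) ⊤ (volume.restrict (Ioo (0 : ℝ) ℓ))

/-- Matrix functions that are Lipschitz continuous on `[0,ℓ]`. -/
def IsLip (ℓ : ℝ) (A : ℝ → Matrix n n ℂ) : Prop :=
  ∀ i j, ∃ K, LipschitzOnWith K (fun x => A x i j) (Icc 0 ℓ)

theorem IsLip.isLinfty {A : ℝ → Matrix n n ℂ} (h : IsLip ℓ A) : IsLinfty ℓ A := by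
  intro i j
  obtain ⟨K, hK⟩ := h i j
  obtain ⟨C, hC⟩ := isCompact_Icc.exists_bound_of_continuousOn hK.continuousOn
  refine memLp_top_of_bound
    ((hK.continuousOn.mono Ioo_subset_Icc_self).aestronglyMeasurable measurableSet_Ioo) C ?_
  rw [ae_restrict_iff' measurableSet_Ioo]
  exact Eventually.of_forall fun x hx => hC x (Ioo_subset_Icc_self hx)

variable [Fintype n] [DecidableEq n]

theorem IsLinfty.memLp {A : ℝ → Matrix n n ℂ} (h : IsLinfty ℓ A)
    (u : L2I ℓ (EuclideanSpace ℂ n)) :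
    MemLp (fun x => Matrix.toEuclideanLin (A x) (u x)) 2 (volume.restrict (Ioo (0 : ℝ) ℓ)) := by
  refine MemLp.of_eval_piLp fun i => ?_
  have : (fun x => Matrix.toEuclideanLin (A x) (u x) i) = fun x => ∑ j, A x i j * u x j := by
    funext x; simp [Matrix.toLpLin_apply, Matrix.mulVec, dotProduct]
  rw [this]
  refine memLp_finsetSum _ fun j _ => ?_
  exact ((Lp.memLp u).eval_piLp j).mul (h i j)

/-- The bounded operator on `L²(0,ℓ)^n` of pointwise multiplication by an `L^∞` matrix function. -/
def mulL2 (A : ℝ → Matrix n n ℂ) (h : IsLinfty ℓ A) :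
    L2I ℓ (EuclideanSpace ℂ n) →ₗ[ℂ] L2I ℓ (EuclideanSpace ℂ n) where
  toFun u := (h.memLp u).toLp _
  map_add' u w := by
    apply Lp.ext
    filter_upwards [(h.memLp (u + w)).coeFn_toLp, (h.memLp u).coeFn_toLp, (h.memLp w).coeFn_toLp,
      Lp.coeFn_add u w, Lp.coeFn_add ((h.memLp u).toLp _) ((h.memLp w).toLp _)] with x h1 h2 h3 h4 h5
    rw [h1, h5, Pi.add_apply, h2, h3, h4, Pi.add_apply, map_add]
  map_smul' c u := by
    apply Lp.ext
    filter_upwards [(h.memLp (c • u)).coeFn_toLp, (h.memLp u).coeFn_toLp,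
      Lp.coeFn_smul c u, Lp.coeFn_smul c ((h.memLp u).toLp _)] with x h1 h2 h3 h4
    rw [RingHom.id_apply, h1, h4, Pi.smul_apply, h2, h3, Pi.smul_apply, map_smul]

end Multiplication

/-- A finite metric graph: edges are oriented from `src e` to `tgt e`, identified with `[0, ℓ e]`,
and carry vector-valued functions of size `k e`. Loops are excluded. -/
structure MetricGraph (V E : Type*) where
  src : E → V
  tgt : E → V
  src_ne_tgt : ∀ e, src e ≠ tgt e
  k : E → ℕ
  k_pos : ∀ e, 0 < k e
  ℓ : E → ℝ
  ℓ_pos : ∀ e, 0 < ℓ e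

namespace MetricGraph

variable {V E : Type*} (G : MetricGraph V E)

/-- The space `ℂ^{k_e}`. -/
abbrev EdgeSpace (e : E) : Type := EuclideanSpace ℂ (Fin (G.k e))

/-- The set `E_v` of edges incident to `v`. -/
abbrev Inc (v : V) : Type _ := {e : E // G.src e = v ∨ G.tgt e = v}

/-- The space `ℂ^{k_v}`, with coordinates grouped by the edges incident to `v`. -/
abbrev VSpace (v : V) : Type _ := EuclideanSpace ℂ (Σ e : G.Inc v, Fin (G.k e))

/-- The space `ℂ^k`, with coordinates grouped by the edges. -/
abbrev TotalSpace : Type _ := EuclideanSpace ℂ (Σ e : E, Fin (G.k e))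

/-- The extension by zero `w ↦ w̃` from `ℂ^{k_v}` to `ℂ^k`. -/
def extend [DecidableEq V] (v : V) (w : G.VSpace v) : G.TotalSpace :=
  WithLp.toLp 2 fun p => if h : G.src p.1 = v ∨ G.tgt p.1 = v then w ⟨⟨p.1, h⟩, p.2⟩ else 0

/-- The signed incidence matrix: `1` at the terminal, `-1` at the initial endpoint. -/
def incidence [DecidableEq V] (v : V) (e : E) : ℂ :=
  (if G.tgt e = v then 1 else 0) - (if G.src e = v then 1 else 0)

/-- The point of `[0, ℓ e]` that corresponds to the endpoint `v` of `e`. -/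
def coord [DecidableEq V] (v : V) (e : E) : ℝ := if G.src e = v then 0 else G.ℓ e

theorem coord_mem [DecidableEq V] (v : V) (e : E) : G.coord v e ∈ Icc 0 (G.ℓ e) := by
  unfold coord
  split_ifs
  · exact ⟨le_rfl, (G.ℓ_pos e).le⟩
  · exact ⟨(G.ℓ_pos e).le, le_rfl⟩

/-- The maximal domain `⨁ₑ H¹(0,ℓ_e)^{k_e}`. -/
abbrev Dmax : Type _ := ∀ e, H1 (G.ℓ e) (G.EdgeSpace e)

/-- The trace operator `γ_v u = (u_e(v))_{e ∈ E_v}`. -/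
def trace [DecidableEq V] (v : V) : G.Dmax →ₗ[ℂ] G.VSpace v where
  toFun u := WithLp.toLp 2 fun p =>
    H1.eval (G.ℓ_pos p.1) (G.coord v p.1) (G.coord_mem v p.1) (u p.1) p.2
  map_add' u w := by ext p; simp
  map_smul' c u := by ext p; simp

end MetricGraph

/-- The data of a hyperbolic system with dynamic vertex conditions on a metric graph: coefficient
matrices `M`, `N` with a Friedrichs symmetrizer `Q` on the edges, and spaces `Yd v ≤ Y v` with
operators `B`, `C`, `Qd` (the latter is `Q_v`) in the vertices. -/
structure HypSystem {V E : Type*} [Fintype E] [DecidableEq V] (G : MetricGraph V E) where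
  M : ∀ e, ℝ → Matrix (Fin (G.k e)) (Fin (G.k e)) ℂ
  N : ∀ e, ℝ → Matrix (Fin (G.k e)) (Fin (G.k e)) ℂ
  Q : ∀ e, ℝ → Matrix (Fin (G.k e)) (Fin (G.k e)) ℂ
  M_lip : ∀ e, IsLip (G.ℓ e) (M e)
  M_invertible : ∀ e, ∀ x ∈ Icc 0 (G.ℓ e), IsUnit (M e x)
  N_bdd : ∀ e, IsLinfty (G.ℓ e) (N e)
  Q_lip : ∀ e, IsLip (G.ℓ e) (Q e)
  Q_herm : ∀ e, ∀ x ∈ Icc 0 (G.ℓ e), (Q e x).IsHermitian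
  QM_herm : ∀ e, ∀ x ∈ Icc 0 (G.ℓ e), (Q e x * M e x).IsHermitian
  Q_pos : ∀ e, ∃ q : ℝ, 0 < q ∧ ∀ x ∈ Icc 0 (G.ℓ e), ∀ ξ : G.EdgeSpace e,
    q * ‖ξ‖ ^ 2 ≤ (⟪ξ, Matrix.toEuclideanLin (Q e x) ξ⟫_ℂ).re
  Y : ∀ v, Submodule ℂ (G.VSpace v)
  Yd : ∀ v, Submodule ℂ (G.VSpace v)
  Yd_le : ∀ v, Yd v ≤ Y v
  B : ∀ v, Y v →ₗ[ℂ] Yd v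
  C : ∀ v, Yd v →ₗ[ℂ] Yd v
  Qd : ∀ v, Yd v →ₗ[ℂ] Yd v
  Qd_symm : ∀ v, ∀ x y : Yd v, ⟪Qd v x, y⟫_ℂ = ⟪x, Qd v y⟫_ℂ
  Qd_pos : ∀ v, ∀ x : Yd v, x ≠ 0 → 0 < (⟪x, Qd v x⟫_ℂ).re

namespace HypSystem

variable {V E : Type*} [Fintype E] [DecidableEq V] {G : MetricGraph V E}
  (S : HypSystem G)

/-- The space `L²_d(G) = ⨁ₑ L²(0,ℓ_e)^{k_e} ⊕ ⨁ᵥ Yd v`. -/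
def L2d : Type _ := (∀ e, L2I (G.ℓ e) (G.EdgeSpace e)) × (∀ v, S.Yd v)

instance : AddCommGroup S.L2d :=
  inferInstanceAs (AddCommGroup ((∀ e, L2I (G.ℓ e) (G.EdgeSpace e)) × (∀ v, S.Yd v)))

instance : Module ℂ S.L2d :=
  inferInstanceAs (Module ℂ ((∀ e, L2I (G.ℓ e) (G.EdgeSpace e)) × (∀ v, S.Yd v)))

/-- `L²_d(G)` is, as a vector space, the direct sum of its edge and vertex components. -/
def toProd : S.L2d ≃ₗ[ℂ] (∀ e, L2I (G.ℓ e) (G.EdgeSpace e)) × (∀ v, S.Yd v) :=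
  LinearEquiv.refl ℂ _

/-- The edge component `u` of `(u, x)`. -/
def edge (z : S.L2d) (e : E) : L2I (G.ℓ e) (G.EdgeSpace e) := (S.toProd z).1 e

/-- The vertex component `x` of `(u, x)`. -/
def vert (z : S.L2d) (v : V) : S.Yd v := (S.toProd z).2 v

theorem mulQ_symm (e : E) (u w : L2I (G.ℓ e) (G.EdgeSpace e)) :
    ⟪mulL2 (S.Q e) (S.Q_lip e).isLinfty u, w⟫_ℂ
      = ⟪u, mulL2 (S.Q e) (S.Q_lip e).isLinfty w⟫_ℂ := by
  rw [L2.inner_def, L2.inner_def]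
  refine integral_congr_ae ?_
  filter_upwards [((S.Q_lip e).isLinfty.memLp u).coeFn_toLp,
    ((S.Q_lip e).isLinfty.memLp w).coeFn_toLp, ae_restrict_mem measurableSet_Ioo] with x h1 h2 hx
  have hs := Matrix.isSymmetric_toEuclideanLin_iff.2 (S.Q_herm e x (Ioo_subset_Icc_self hx))
  exact ((congrArg (fun a => ⟪a, w x⟫_ℂ) h1).trans (hs (u x) (w x))).trans
    (congrArg (fun a => ⟪u x, a⟫_ℂ) h2.symm)

theorem mulQ_pos (e : E) : ∃ q : ℝ, 0 < q ∧ ∀ u : L2I (G.ℓ e) (G.EdgeSpace e),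
    q * ‖u‖ ^ 2 ≤ (⟪u, mulL2 (S.Q e) (S.Q_lip e).isLinfty u⟫_ℂ).re := by
  obtain ⟨q, hq, h⟩ := S.Q_pos e
  refine ⟨q, hq, fun u => ?_⟩
  set Qu := mulL2 (S.Q e) (S.Q_lip e).isLinfty u with hQu
  have e1 : q * ‖u‖ ^ 2 = ∫ x in Ioo 0 (G.ℓ e), q * (⟪u x, u x⟫_ℂ).re := by
    rw [integral_const_mul, ← inner_self_eq_norm_sq (𝕜 := ℂ) u, L2.inner_def]
    congr 1
    exact (integral_re (L2.integrable_inner (𝕜 := ℂ) u u)).symm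
  have e2 : (⟪u, Qu⟫_ℂ).re = ∫ x in Ioo 0 (G.ℓ e), (⟪u x, Qu x⟫_ℂ).re := by
    rw [L2.inner_def]
    exact (integral_re (L2.integrable_inner (𝕜 := ℂ) u Qu)).symm
  rw [e1, e2]
  refine integral_mono_ae ((L2.integrable_inner (𝕜 := ℂ) u u).re.const_mul q)
    (L2.integrable_inner (𝕜 := ℂ) u Qu).re ?_
  filter_upwards [((S.Q_lip e).isLinfty.memLp u).coeFn_toLp,
    ae_restrict_mem measurableSet_Ioo] with x h1 hx
  have h2 := h x (Ioo_subset_Icc_self hx) (u x)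
  rw [← inner_self_eq_norm_sq (𝕜 := ℂ)] at h2
  exact h2.trans_eq (congrArg (fun a => (⟪u x, a⟫_ℂ).re) h1.symm)

theorem re_Qd_nonneg (v : V) (x : S.Yd v) : 0 ≤ (⟪x, S.Qd v x⟫_ℂ).re := by
  rcases eq_or_ne x 0 with rfl | hx
  · simp
  · exact (S.Qd_pos v x hx).le

variable [Fintype V]

/-- The inner product of `L²_d(G)`, weighted by the matrices `Q_e` and the operators `Q_v`.
It is conjugate linear in the first argument. -/
def innerD (z w : S.L2d) : ℂ :=
  (∑ e, ∫ x in Ioo 0 (G.ℓ e), ⟪S.edge z e x, Matrix.toEuclideanLin (S.Q e x) (S.edge w e x)⟫_ℂ)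
    + ∑ v, ⟪S.vert z v, S.Qd v (S.vert w v)⟫_ℂ

theorem innerD_eq (z w : S.L2d) : S.innerD z w =
    ∑ e, ⟪S.edge z e, mulL2 (S.Q e) (S.Q_lip e).isLinfty (S.edge w e)⟫_ℂ
      + ∑ v, ⟪S.vert z v, S.Qd v (S.vert w v)⟫_ℂ := by
  unfold innerD
  congr 1
  refine Finset.sum_congr rfl fun e _ => ?_
  rw [L2.inner_def]
  refine integral_congr_ae ?_
  filter_upwards [((S.Q_lip e).isLinfty.memLp (S.edge w e)).coeFn_toLp] with x hx
  exact congrArg _ hx.symm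

/-- The weighted form `innerD` is an inner product. -/
@[reducible]
def innerCore : InnerProductSpace.Core ℂ S.L2d where
  inner := S.innerD
  conj_inner_symm z w := by
    rw [innerD_eq, innerD_eq, map_add, map_sum, map_sum]
    congr 1
    · refine Finset.sum_congr rfl fun e _ => ?_
      rw [inner_conj_symm, mulQ_symm]
    · refine Finset.sum_congr rfl fun v _ => ?_
      exact (inner_conj_symm (𝕜 := ℂ) (E := S.Yd v) _ _).trans (S.Qd_symm v _ _)
  re_inner_nonneg z := by
    rw [innerD_eq, map_add, map_sum, map_sum]
    refine add_nonneg (Finset.sum_nonneg fun e _ => ?_)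
      (Finset.sum_nonneg fun v _ => S.re_Qd_nonneg v _)
    obtain ⟨q, hq, h⟩ := S.mulQ_pos e
    exact le_trans (by positivity) (h (S.edge z e))
  add_left x y z := by
    simp_rw [innerD_eq]
    have h1 : ∀ e, S.edge (x + y) e = S.edge x e + S.edge y e := fun _ => rfl
    have h2 : ∀ v, S.vert (x + y) v = S.vert x v + S.vert y v := fun _ => rfl
    have h3 : ∀ v, ⟪S.vert x v + S.vert y v, S.Qd v (S.vert z v)⟫_ℂ
        = ⟪S.vert x v, S.Qd v (S.vert z v)⟫_ℂ + ⟪S.vert y v, S.Qd v (S.vert z v)⟫_ℂ := fun v =>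
      inner_add_left (𝕜 := ℂ) (E := S.Yd v) _ _ _
    simp_rw [h1, h2, h3, inner_add_left, Finset.sum_add_distrib]
    ring
  smul_left x y r := by
    simp_rw [innerD_eq]
    have h1 : ∀ e, S.edge (r • x) e = r • S.edge x e := fun _ => rfl
    have h2 : ∀ v, S.vert (r • x) v = r • S.vert x v := fun _ => rfl
    have h3 : ∀ v, ⟪r • S.vert x v, S.Qd v (S.vert y v)⟫_ℂ
        = (starRingEnd ℂ) r * ⟪S.vert x v, S.Qd v (S.vert y v)⟫_ℂ := fun v =>
      inner_smul_left (𝕜 := ℂ) (E := S.Yd v) _ _ _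
    simp_rw [h1, h2, h3, inner_smul_left, mul_add, Finset.mul_sum]
  definite z hz := by
    have h0 := congrArg Complex.re hz
    rw [innerD_eq, Complex.add_re, Complex.re_sum, Complex.re_sum, Complex.zero_re] at h0
    have hE : ∀ e, 0 ≤ (⟪S.edge z e, mulL2 (S.Q e) (S.Q_lip e).isLinfty (S.edge z e)⟫_ℂ).re := fun e => by
      obtain ⟨q, hq, h⟩ := S.mulQ_pos e
      exact le_trans (by positivity) (h (S.edge z e))
    have hV : ∀ v, 0 ≤ (⟪S.vert z v, S.Qd v (S.vert z v)⟫_ℂ).re := fun v => S.re_Qd_nonneg v _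
    obtain ⟨hE0, hV0⟩ := (add_eq_zero_iff_of_nonneg (Finset.sum_nonneg fun e _ => hE e)
      (Finset.sum_nonneg fun v _ => hV v)).1 h0
    rw [Finset.sum_eq_zero_iff_of_nonneg fun e _ => hE e] at hE0
    rw [Finset.sum_eq_zero_iff_of_nonneg fun v _ => hV v] at hV0
    refine Prod.ext (funext fun e => ?_) (funext fun v => ?_)
    · obtain ⟨q, hq, h⟩ := S.mulQ_pos e
      have h3 := (h (S.edge z e)).trans_eq (hE0 e (Finset.mem_univ _))
      have h4 : ‖S.edge z e‖ ^ 2 ≤ 0 := by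
        by_contra hcon
        exact absurd h3 (not_le.2 (mul_pos hq (not_le.1 hcon)))
      exact norm_eq_zero.1 (pow_eq_zero_iff (two_ne_zero)|>.1 (le_antisymm h4 (by positivity)))
    · by_contra hcon
      exact absurd (hV0 v (Finset.mem_univ _)) (S.Qd_pos v _ hcon).ne'

instance : NormedAddCommGroup S.L2d := S.innerCore.toNormedAddCommGroup

instance : InnerProductSpace ℂ S.L2d := InnerProductSpace.ofCore S.innerCore.toCore

theorem inner_eq_innerD (z w : S.L2d) : ⟪z, w⟫_ℂ = S.innerD z w := rfl

/-- The matrix `T_v = diag (ι_{ve} Q_e(v) M_e(v))`, as an operator on `ℂ^{k_v}`. -/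
def T [DecidableEq E] (v : V) : G.VSpace v →ₗ[ℂ] G.VSpace v :=
  Matrix.toEuclideanLin (Matrix.blockDiagonal' fun e : G.Inc v =>
    G.incidence v e • (S.Q e (G.coord v e) * S.M e (G.coord v e)))

/-- The adjoint `B_v^* : Yd v → Y v` with respect to the Euclidean inner products. -/
def Badj (v : V) : S.Yd v →ₗ[ℂ] S.Y v := 
  LinearMap.adjoint (𝕜 := ℂ) (E := S.Y v) (F := S.Yd v) (S.B v)

/-- The orthogonal projector `P_v^{(d)}` of `ℂ^{k_v}` onto `Yd v`. -/
def P (v : V) : G.VSpace v →ₗ[ℂ] S.Yd v := (S.Yd v).orthogonalProjectionOnto.toLinearMap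

/-- The operator `T_v + Q_v B_v + B_v^* Q_v` on `Y v`, where `Q_v` is extended from `Yd v` by means
of the orthogonal projector onto `Yd v`. -/
def boundaryOp [DecidableEq E] (v : V) : S.Y v →ₗ[ℂ] G.VSpace v :=
  S.T v ∘ₗ (S.Y v).subtype
    + (S.Yd v).subtype ∘ₗ S.Qd v ∘ₗ S.B v
    + (S.Y v).subtype ∘ₗ S.Badj v ∘ₗ S.Qd v ∘ₗ S.P v ∘ₗ (S.Y v).subtype

/-- `Y v` is contained in the null isotropic cone of the quadratic form associated with
`T_v + Q_v B_v + B_v^* Q_v`. -/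
def IsNullIsotropic [DecidableEq E] (v : V) : Prop :=
  ∀ ξ : S.Y v, ⟪(ξ : G.VSpace v), S.boundaryOp v ξ⟫_ℂ = 0

/-- A choice of bases of `(Y v)ᗮ`, `Ran B_v` and `Ker B_v^*` for every vertex `v`. -/
structure VertexBases where
  w : ∀ v, Module.Basis (Fin (Module.finrank ℂ (S.Y v)ᗮ)) ℂ (S.Y v)ᗮ
  y : ∀ v, Module.Basis (Fin (Module.finrank ℂ (LinearMap.range (S.B v)))) ℂ
    (LinearMap.range (S.B v))
  z : ∀ v, Module.Basis (Fin (Module.finrank ℂ (LinearMap.ker (S.Badj v)))) ℂ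
    (LinearMap.ker (S.Badj v))

namespace VertexBases

variable {S}

/-- The index set `I_v ⊔ J_v^{(R)} ⊔ J_v^{(K)}`. -/
abbrev Index (S : HypSystem G) (v : V) : Type :=
  Fin (Module.finrank ℂ (S.Y v)ᗮ) ⊕
    Fin (Module.finrank ℂ (LinearMap.range (S.B v))) ⊕
    Fin (Module.finrank ℂ (LinearMap.ker (S.Badj v)))

/-- The family `𝒲_v` of vectors of `ℂ^{k_v}`: the basis of `(Y v)ᗮ`, the images under `B_v^*` of
the basis of `Ran B_v`, and the basis of `Ker B_v^*`. -/
def vec (b : S.VertexBases) (v : V) : Index S v → G.VSpace v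
  | .inl i => (b.w v i : G.VSpace v)
  | .inr (.inl j) => (S.Badj v (b.y v j : S.Yd v) : G.VSpace v)
  | .inr (.inr l) => ((b.z v l : S.Yd v) : G.VSpace v)

/-- The family of all vectors of all `𝒲_v`, extended by zero to `ℂ^k`. -/
def extVec (b : S.VertexBases) : (Σ v, Index S v) → G.TotalSpace :=
  fun p => G.extend p.1 (b.vec p.1 p.2)

/-- The basis condition: the family of all extended vectors is a basis of `ℂ^k`. -/
def BasisCondition (b : S.VertexBases) : Prop :=
  LinearIndependent ℂ b.extVec ∧ Submodule.span ℂ (range b.extVec) = ⊤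

end VertexBases

/-- `(𝒜 u)_e = M_e u_e' + N_e u_e`. -/
def opA : G.Dmax →ₗ[ℂ] ∀ e, L2I (G.ℓ e) (G.EdgeSpace e) :=
  LinearMap.pi fun e =>
    (mulL2 (S.M e) (S.M_lip e).isLinfty ∘ₗ H1.deriv
      + mulL2 (S.N e) (S.N_bdd e) ∘ₗ (H1 (G.ℓ e) (G.EdgeSpace e)).subtype) ∘ₗ LinearMap.proj e

/-- The element of `D_max` given by the first component of `z`, if that lies in `H¹`. -/
def toDmax (z : S.L2d) (h : ∀ e, S.edge z e ∈ H1 (G.ℓ e) (G.EdgeSpace e)) : G.Dmax :=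
  fun e => ⟨S.edge z e, h e⟩

/-- The operator `𝔸 = (𝒜 0; ℬ 𝒞)` with domain the pairs `(u, x)` such that `u ∈ D_max`,
`γ_v u ∈ Y v` and `x_v = P_v^{(d)} γ_v u` for all `v`. -/
def opAA : S.L2d →ₗ.[ℂ] S.L2d where
  domain :=
    { carrier := {z | ∃ h : ∀ e, S.edge z e ∈ H1 (G.ℓ e) (G.EdgeSpace e),
        ∀ v, G.trace v (S.toDmax z h) ∈ S.Y v ∧ S.vert z v = S.P v (G.trace v (S.toDmax z h))}
      add_mem' := by
        rintro a b ⟨ha, ha'⟩ ⟨hb, hb'⟩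
        refine ⟨fun e => add_mem (ha e) (hb e), fun v => ?_⟩
        have : S.toDmax (a + b) (fun e => add_mem (ha e) (hb e))
          = S.toDmax a ha + S.toDmax b hb := rfl
        rw [this, map_add, map_add, ← (ha' v).2, ← (hb' v).2]
        exact ⟨add_mem (ha' v).1 (hb' v).1, rfl⟩
      zero_mem' := by
        refine ⟨fun e => zero_mem _, fun v => ?_⟩
        have : S.toDmax 0 (fun e => zero_mem _) = 0 := rfl
        rw [this, map_zero, map_zero]
        exact ⟨zero_mem _, rfl⟩
      smul_mem' := by
        rintro c a ⟨ha, ha'⟩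
        refine ⟨fun e => Submodule.smul_mem _ c (ha e), fun v => ?_⟩
        have : S.toDmax (c • a) (fun e => Submodule.smul_mem _ c (ha e)) = c • S.toDmax a ha := rfl
        rw [this, map_smul, map_smul, ← (ha' v).2]
        exact ⟨Submodule.smul_mem _ c (ha' v).1, rfl⟩ }
  toFun :=
    { toFun := fun z =>
        S.toProd.symm (S.opA (S.toDmax z.1 z.2.choose),
          fun v => S.B v ⟨G.trace v (S.toDmax z.1 z.2.choose), (z.2.choose_spec v).1⟩
            + S.C v (S.vert z.1 v))
      map_add' := by
        intro a b
        have : S.toDmax (a + b : S.L2d) (fun e => add_mem (a.2.choose e) (b.2.choose e))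
          = S.toDmax a a.2.choose + S.toDmax b b.2.choose := rfl
        refine Prod.ext ?_ (funext fun v => ?_)
        · exact map_add S.opA (S.toDmax a a.2.choose) (S.toDmax b b.2.choose)
        · have h1 := map_add (S.C v) (S.vert a.1 v) (S.vert b.1 v)
          have h2 := map_add (S.B v)
            ⟨G.trace v (S.toDmax a a.2.choose), (a.2.choose_spec v).1⟩
            ⟨G.trace v (S.toDmax b b.2.choose), (b.2.choose_spec v).1⟩
          have h3 := map_add (G.trace v) (S.toDmax a a.2.choose) (S.toDmax b b.2.choose)
          exact (congrArg₂ (· + ·) ((congrArg (S.B v) (Subtype.ext h3)).trans h2) h1).trans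
            (add_add_add_comm _ _ _ _)
      map_smul' := by
        intro c a
        refine Prod.ext ?_ (funext fun v => ?_)
        · exact map_smul S.opA c (S.toDmax a a.2.choose)
        · have h1 := map_smul (S.C v) c (S.vert a.1 v)
          have h2 := map_smul (S.B v) c
            ⟨G.trace v (S.toDmax a a.2.choose), (a.2.choose_spec v).1⟩
          have h3 := map_smul (G.trace v) c (S.toDmax a a.2.choose)
          exact (congrArg₂ (· + ·) ((congrArg (S.B v) (Subtype.ext h3)).trans h2) h1).trans
            (smul_add _ _ _).symm }

end HypSystem

/-- A strongly continuous one-parameter group of bounded operators. -/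
structure IsC0Group {H : Type*} [NormedAddCommGroup H] [NormedSpace ℂ H]
    (U : ℝ → H →L[ℂ] H) : Prop where
  map_zero : U 0 = ContinuousLinearMap.id ℂ H
  map_add : ∀ s t, U (s + t) = (U s).comp (U t)
  continuous : ∀ z, Continuous fun t => U t z

/-- `A` is the generator of a strongly continuous group: `z ∈ D(A)` and `A z = w` if and only if
`(U t z - z) / t → w` as `t → 0`. -/
def GeneratesC0Group {H : Type*} [NormedAddCommGroup H] [NormedSpace ℂ H]
    (A : H →ₗ.[ℂ] H) : Prop :=
  ∃ U : ℝ → H →L[ℂ] H, IsC0Group U ∧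
    ∀ z w : H, (z, w) ∈ A.graph ↔
      Tendsto (fun t : ℝ => (t : ℂ)⁻¹ • (U t z - z)) (𝓝[≠] 0) (𝓝 w)

end

end DynNet

/-! The proof is an energy estimate, a dimension count and a Hilbert space generation theorem.

Energy. For `(u, x)` in the domain of `𝔸`, the Hermitian product `Q M` lets the real part of `(Q M
u', u)` be integrated by parts on each edge. This leaves half the difference of the boundary forms
at the two endpoints, and an error controlled by the Lipschitz constant of `Q M`. Regrouped by
vertices, the boundary forms become the quadratic forms of `T_v` at the traces. Null isotropy says
that the real part of the form of `T_v` at `ξ` is `-2 Re (Q_v B_v ξ, P_v ξ)`. As `x_v = P_v γ_v u`,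
this cancels the contribution of `B_v` to the vertex part of the inner product. Only bounded terms
remain, so `|Re (𝔸 z, z)| ≤ β ‖z‖²` (`HypSystem.exists_abs_re_inner_opAA_le`).

Range. Let `|μ| > β`, `μ` real. As `M` is invertible, `μ u - 𝒜 u = f` is a linear system of ordinary
differential equations, solvable with any initial values in `ℂ^k`; hence the space of homogeneous
solutions has dimension at least `k`. The vertex conditions take values in a space of dimension `∑
(dim Y_vᗮ + dim Yd_v)`, and since `dim Ran B_v + dim Ker B_v^* = dim Yd_v`, the basis condition
makes this sum equal to `k`. The energy bound makes the boundary map injective on homogeneous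
solutions, hence bijective, and every right-hand side is attained
(`HypSystem.resolvent_surjective`).

Generation. With the numerical range of `A` in a vertical strip and `μ - A` onto for all large
`|μ|`, the bounded commuting operators `ν² A (ν² - A²)⁻¹` obey one common numerical range bound and
converge to `A` on its domain. Their exponentials converge to a group with generator `A`
(`generatesC0Group_of_bound`). -/

namespace DynNet

open MeasureTheory Set Filter Topology
open scoped ContDiff InnerProductSpace

/-! ### Exponentials of bounded operators and their strong limits. -/

section BoundedGroup

variable {H : Type*} [NormedAddCommGroup H] [InnerProductSpace ℂ H] [CompleteSpace H]

theorem hasDerivAt_exp_smul_apply (L : H →L[ℂ] H) (z : H) (t : ℝ) :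
    HasDerivAt (fun s : ℝ => NormedSpace.exp (s • L) z) (NormedSpace.exp (t • L) (L z)) t := by
  have h := hasDerivAt_exp_smul_const (𝕂 := ℝ) L t
  exact (((ContinuousLinearMap.apply ℂ H z).restrictScalars ℝ).hasFDerivAt.comp_hasDerivAt t h)

theorem exp_smul_apply_comm (L : H →L[ℂ] H) (z : H) (t : ℝ) :
    NormedSpace.exp (t • L) (L z) = L (NormedSpace.exp (t • L) z) := by
  have h : Commute (NormedSpace.exp (t • L)) L :=
    ((Commute.refl L).smul_left t).exp_left
  exact congrArg (fun f : H →L[ℂ] H => f z) h.eq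

/-- The derivative of `‖u s‖²` along `u' = L u` is `2 Re ⟪u, L u⟫`, at most `2 κ ‖u‖²` in modulus;
Gronwall applies. The rate depends on the numerical range alone and not on `‖L‖`, so it survives the
limit of unbounded approximations. -/
theorem norm_exp_smul_apply_le_of_nonneg {L : H →L[ℂ] H} {κ : ℝ}
    (h : ∀ z, |(⟪z, L z⟫_ℂ).re| ≤ κ * ‖z‖ ^ 2) {t : ℝ} (ht : 0 ≤ t) (z : H) :
    ‖NormedSpace.exp (t • L) z‖ ≤ Real.exp (κ * t) * ‖z‖ := by
  set u : ℝ → H := fun s => NormedSpace.exp (s • L) z with hu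
  have hd : ∀ s, HasDerivAt u (L (u s)) s := fun s => by
    rw [hu, ← exp_smul_apply_comm]; exact hasDerivAt_exp_smul_apply L z s
  have hsq : ∀ s, HasDerivAt (fun s => ‖u s‖ ^ 2) (2 * (⟪u s, L (u s)⟫_ℂ).re) s := fun s => by
    let _ : InnerProductSpace ℝ H := InnerProductSpace.complexToReal
    exact HasDerivAt.norm_sq (F := H) (hd s)
  have hu0 : u 0 = z := by simp [hu]
  have key := norm_le_gronwallBound_of_norm_deriv_right_le (f := fun s => ‖u s‖ ^ 2)
    (f' := fun s => 2 * (⟪u s, L (u s)⟫_ℂ).re) (δ := ‖z‖ ^ 2) (K := 2 * κ) (ε := 0)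
    (a := 0) (b := t) (fun s _ => (hsq s).continuousAt.continuousWithinAt)
    (fun s _ => (hsq s).hasDerivWithinAt) (by simp [hu0])
    (fun s _ => by
      have := h (u s)
      rw [Real.norm_eq_abs, abs_mul, Real.norm_eq_abs, abs_of_nonneg (sq_nonneg ‖u s‖)]
      simp only [abs_two]
      linarith) t ⟨ht, le_rfl⟩
  rw [gronwallBound_ε0, Real.norm_eq_abs, abs_of_nonneg (sq_nonneg _), sub_zero] at key
  refine abs_le_of_sq_le_sq' ?_ (by positivity) |>.2
  refine key.trans_eq ?_
  rw [mul_pow, ← Real.exp_nat_mul]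
  push_cast
  ring_nf

theorem norm_exp_smul_apply_le {L : H →L[ℂ] H} {κ : ℝ}
    (h : ∀ z, |(⟪z, L z⟫_ℂ).re| ≤ κ * ‖z‖ ^ 2) (t : ℝ) (z : H) :
    ‖NormedSpace.exp (t • L) z‖ ≤ Real.exp (κ * |t|) * ‖z‖ := by
  rcases le_total 0 t with ht | ht
  · rw [abs_of_nonneg ht]; exact norm_exp_smul_apply_le_of_nonneg h ht z
  · rw [abs_of_nonpos ht]
    have := norm_exp_smul_apply_le_of_nonneg (L := -L) (κ := κ)
      (fun z => by simpa using h z) (neg_nonneg.2 ht) z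
    rwa [neg_smul_neg] at this

/-- The exponentials of two commuting operators that satisfy the same numerical range bound
differ at most by the difference of the operators. -/
theorem norm_exp_smul_sub_exp_smul_le {L L' : H →L[ℂ] H} {κ : ℝ} (hκ : 0 ≤ κ)
    (h : ∀ z, |(⟪z, L z⟫_ℂ).re| ≤ κ * ‖z‖ ^ 2) (h' : ∀ z, |(⟪z, L' z⟫_ℂ).re| ≤ κ * ‖z‖ ^ 2)
    (hc : Commute L L') (t : ℝ) (z : H) :
    ‖NormedSpace.exp (t • L) z - NormedSpace.exp (t • L') z‖
      ≤ |t| * Real.exp (2 * κ * |t|) * ‖L z - L' z‖ := by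
  -- Duhamel interpolation from `exp (t L') z` at `s = 0` to `exp (t L) z` at `s = t`. Commutation
  -- moves `L - L'` next to `z`, so the derivative is controlled by `‖L z - L' z‖`; the mean value
  -- inequality finishes.
  let f : ℝ → H := fun s => NormedSpace.exp (s • L) (NormedSpace.exp ((t - s) • L') z)
  have hf : ∀ s, HasDerivAt f
      (NormedSpace.exp (s • L) (NormedSpace.exp ((t - s) • L') (L z - L' z))) s := by
    intro s
    have h1 := hasDerivAt_exp_smul_const (𝕂 := ℝ) L s
    have h2 : HasDerivAt (fun s : ℝ => NormedSpace.exp ((t - s) • L'))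
        (-(NormedSpace.exp ((t - s) • L') * L')) s := by
      have h3 := hasDerivAt_exp_smul_const (𝕂 := ℝ) L' (t - s)
      exact (h3.scomp s ((hasDerivAt_id s).const_sub t)).congr_deriv (by simp)
    have h4 := h1.mul h2
    have h5 := ((ContinuousLinearMap.apply ℂ H z).restrictScalars ℝ).hasFDerivAt.comp_hasDerivAt s h4
    have h6 : Commute (NormedSpace.exp ((t - s) • L')) L :=
      (hc.symm.smul_left (t - s)).exp_left
    refine HasDerivAt.congr_deriv (f := f) h5 ?_
    rw [mul_assoc, ← h6.eq, map_sub, map_sub]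
    simp [sub_eq_add_neg]
  have hb : ∀ s ∈ uIcc 0 t,
      ‖NormedSpace.exp (s • L) (NormedSpace.exp ((t - s) • L') (L z - L' z))‖
        ≤ Real.exp (2 * κ * |t|) * ‖L z - L' z‖ := by
    intro s hs
    have hs1 : |s| ≤ |t| := by
      have := abs_sub_left_of_mem_uIcc hs
      simpa using this
    have hs2 : |t - s| ≤ |t| := by
      have := abs_sub_right_of_mem_uIcc hs
      simpa using this
    calc _ ≤ Real.exp (κ * |s|) * (Real.exp (κ * |t - s|) * ‖L z - L' z‖) :=
          (norm_exp_smul_apply_le h _ _).trans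
            (mul_le_mul_of_nonneg_left (norm_exp_smul_apply_le h' _ _) (Real.exp_nonneg _))
      _ ≤ Real.exp (κ * |t|) * (Real.exp (κ * |t|) * ‖L z - L' z‖) := by gcongr
      _ = _ := by rw [← mul_assoc, ← Real.exp_add]; ring_nf
  have := Convex.norm_image_sub_le_of_norm_hasDerivWithin_le (𝕜 := ℝ)
    (fun s _ => (hf s).hasDerivWithinAt) hb (convex_uIcc 0 t) left_mem_uIcc right_mem_uIcc
  simp only [f, zero_smul, NormedSpace.exp_zero, sub_zero, sub_self, Real.norm_eq_abs,
    one_apply_eq_self] at this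
  linarith

/-- For a vector of the dense set, the Duhamel bound makes the exponentials uniformly Cauchy. The
growth bound, common to all `n`, carries this over to an arbitrary `z`. -/
theorem uniformCauchySeqOn_exp_smul {L : ℕ → H →L[ℂ] H} {κ : ℝ} (hκ : 0 ≤ κ)
    (h : ∀ n z, |(⟪z, L n z⟫_ℂ).re| ≤ κ * ‖z‖ ^ 2) (hc : ∀ m n, Commute (L m) (L n))
    {D : Set H} (hD : Dense D) (hlim : ∀ z ∈ D, CauchySeq fun n => L n z) (z : H) {T : ℝ}
    (hT : 0 ≤ T) :
    UniformCauchySeqOn (fun n (t : ℝ) => NormedSpace.exp (t • L n) z) atTop (Icc (-T) T) := by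
  rw [Metric.uniformCauchySeqOn_iff]
  intro ε hε
  set C := Real.exp (2 * κ * T) with hC
  have hC0 : 0 < C := Real.exp_pos _
  obtain ⟨z', hz'D, hz'⟩ := Metric.dense_iff.1 hD z (ε / (4 * C)) (by positivity)
  -- The summand `1` keeps the denominator positive when `T = 0`.
  obtain ⟨N, hN⟩ := Metric.cauchySeq_iff.1 (hlim z' hz') (ε / (4 * (T * C + 1))) (by positivity)
  refine ⟨N, fun m hm n hn t ht => ?_⟩
  have htT : |t| ≤ T := abs_le.2 ht
  have hexp : Real.exp (κ * |t|) ≤ C := Real.exp_le_exp.2 (by nlinarith [abs_nonneg t])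
  have hz : ‖z - z'‖ < ε / (4 * C) := by rw [← dist_eq_norm, dist_comm]; exact hz'D
  have hb : ∀ k, ‖NormedSpace.exp (t • L k) (z - z')‖ ≤ ε / 4 := fun k =>
    calc _ ≤ Real.exp (κ * |t|) * ‖z - z'‖ := norm_exp_smul_apply_le (h k) t _
      _ ≤ C * (ε / (4 * C)) := by gcongr
      _ = ε / 4 := by field_simp
  have hm' : ‖NormedSpace.exp (t • L m) z' - NormedSpace.exp (t • L n) z'‖ ≤ ε / 4 :=
    calc _ ≤ |t| * Real.exp (2 * κ * |t|) * ‖L m z' - L n z'‖ :=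
          norm_exp_smul_sub_exp_smul_le hκ (h m) (h n) (hc m n) t z'
      _ ≤ (T * C) * (ε / (4 * (T * C + 1))) := by
          have := (hN m hm n hn).le
          rw [dist_eq_norm] at this
          have h2 : Real.exp (2 * κ * |t|) ≤ C := Real.exp_le_exp.2 (by gcongr)
          gcongr
      _ ≤ (T * C + 1) * (ε / (4 * (T * C + 1))) := by gcongr; linarith
      _ = ε / 4 := by field_simp
  have e : NormedSpace.exp (t • L m) z - NormedSpace.exp (t • L n) z
      = NormedSpace.exp (t • L m) (z - z') - NormedSpace.exp (t • L n) (z - z')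
        + (NormedSpace.exp (t • L m) z' - NormedSpace.exp (t • L n) z') := by
    rw [map_sub, map_sub]; abel
  rw [dist_eq_norm, e]
  calc _ ≤ ‖NormedSpace.exp (t • L m) (z - z')‖ + ‖NormedSpace.exp (t • L n) (z - z')‖
        + ‖NormedSpace.exp (t • L m) z' - NormedSpace.exp (t • L n) z'‖ :=
        (norm_add_le _ _).trans (by gcongr; exact norm_sub_le _ _)
    _ < ε := by linarith [hb m, hb n]

/-- Commuting bounded operators with a common bound on the real part of the numerical range, which
converge on a dense set, have exponentials that converge to a strongly continuous group. -/
theorem exists_group_of_tendsto {L : ℕ → H →L[ℂ] H} {κ : ℝ} (hκ : 0 ≤ κ)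
    (h : ∀ n z, |(⟪z, L n z⟫_ℂ).re| ≤ κ * ‖z‖ ^ 2) (hc : ∀ m n, Commute (L m) (L n))
    {G : Set (H × H)} (hD : Dense (Prod.fst '' G))
    (hlim : ∀ p ∈ G, Tendsto (fun n => L n p.1) atTop (𝓝 p.2)) :
    ∃ U : ℝ → H →L[ℂ] H, IsC0Group U ∧ (∀ t z, ‖U t z‖ ≤ Real.exp (κ * |t|) * ‖z‖) ∧
      ∀ p ∈ G, ∀ t, HasDerivAt (fun s => U s p.1) (U t p.2) t := by
  have hcau : ∀ z {T : ℝ}, 0 ≤ T → UniformCauchySeqOn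
      (fun n (t : ℝ) => NormedSpace.exp (t • L n) z) atTop (Icc (-T) T) := fun z T hT =>
    uniformCauchySeqOn_exp_smul hκ h hc hD
      (by rintro _ ⟨p, hp, rfl⟩; exact (hlim p hp).cauchySeq) z hT
  have hex : ∀ (t : ℝ) z, ∃ y, Tendsto (fun n => NormedSpace.exp (t • L n) z) atTop (𝓝 y) :=
    fun t z => cauchySeq_tendsto_of_complete
      ((hcau z (abs_nonneg t)).cauchySeq ⟨neg_abs_le t, le_abs_self t⟩)
  choose u hu using hex
  have hub : ∀ t z, ‖u t z‖ ≤ Real.exp (κ * |t|) * ‖z‖ := fun t z =>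
    le_of_tendsto (hu t z).norm (Eventually.of_forall fun n => norm_exp_smul_apply_le (h n) t z)
  let U : ℝ → H →L[ℂ] H := fun t => LinearMap.mkContinuous
    { toFun := u t
      map_add' := fun x y => tendsto_nhds_unique (hu t (x + y))
        (by simpa only [map_add] using (hu t x).add (hu t y))
      map_smul' := fun c x => tendsto_nhds_unique (hu t (c • x))
        (by simpa only [map_smul, RingHom.id_apply] using (hu t x).const_smul c) } (Real.exp (κ * |t|)) (hub t)
  have hunif : ∀ z {T : ℝ}, 0 ≤ T → TendstoUniformlyOn
      (fun n (t : ℝ) => NormedSpace.exp (t • L n) z) (fun t => U t z) atTop (Icc (-T) T) :=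
    fun z T hT => (hcau z hT).tendstoUniformlyOn_of_tendsto fun t _ => hu t z
  refine ⟨U, ⟨?_, ?_, ?_⟩, hub, ?_⟩
  · ext z
    refine tendsto_nhds_unique (hu 0 z) ?_
    simp
  · intro s t
    ext z
    refine tendsto_nhds_unique (hu (s + t) z) ?_
    -- The factors depend on `n` simultaneously. Comparing the inner one with its limit isolates an
    -- error that the uniform bound on `exp (s L n)` sends to zero.
    have e : ∀ n, NormedSpace.exp ((s + t) • L n) z
        = NormedSpace.exp (s • L n) (NormedSpace.exp (t • L n) z - u t z)
          + NormedSpace.exp (s • L n) (u t z) := by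
      intro n
      have hcomm : Commute (s • L n) (t • L n) := ((Commute.refl _).smul_left s).smul_right t
      let _ : NormedAlgebra ℚ (H →L[ℂ] H) := NormedAlgebra.restrictScalars ℚ ℝ _
      rw [add_smul, NormedSpace.exp_add_of_commute hcomm, map_sub]
      simp
    simp_rw [e]
    have h1 : Tendsto (fun n => NormedSpace.exp (s • L n) (NormedSpace.exp (t • L n) z - u t z))
        atTop (𝓝 0) := by
      refine squeeze_zero_norm (fun n => norm_exp_smul_apply_le (h n) s _) ?_
      have := ((hu t z).sub_const (u t z)).norm.const_mul (Real.exp (κ * |s|))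
      simpa using this
    have h2 := h1.add (hu s (u t z))
    rwa [zero_add] at h2
  · intro z
    rw [continuous_iff_continuousAt]
    intro t
    have hT : (0 : ℝ) ≤ |t| + 1 := by positivity
    have hct : ContinuousOn (fun t => U t z) (Icc (-(|t| + 1)) (|t| + 1)) :=
      (hunif z hT).continuousOn (Eventually.frequently (Eventually.of_forall fun n s _ =>
        (hasDerivAt_exp_smul_apply (L n) z s).continuousAt.continuousWithinAt))
    exact hct.continuousAt (Icc_mem_nhds (by linarith [neg_abs_le t]) (by linarith [le_abs_self t]))
  · rintro ⟨z, w⟩ hp t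
    set T : ℝ := |t| + 1 with hTdef
    have hT : 0 ≤ T := by positivity
    -- Local uniform convergence of the derivatives `exp (s L n) (L n z)` to `U s w` permits
    -- differentiation of the limit.
    have htl : TendstoUniformlyOn (fun n (s : ℝ) => NormedSpace.exp (s • L n) (L n z))
        (fun s => U s w) atTop (Ioo (-T) T) := by
      rw [Metric.tendstoUniformlyOn_iff]
      intro ε hε
      have h1 := (Metric.tendstoUniformlyOn_iff.1 ((hunif w hT).mono Ioo_subset_Icc_self)) (ε / 2)
        (by positivity)
      have h2 := (Metric.tendsto_nhds.1 (hlim _ hp)) (ε / (2 * Real.exp (κ * T))) (by positivity)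
      filter_upwards [h1, h2] with n h1 h2 s hs
      have hsT : |s| ≤ T := abs_le.2 ⟨hs.1.le, hs.2.le⟩
      rw [dist_eq_norm] at h2
      calc dist (U s w) (NormedSpace.exp (s • L n) (L n z))
          ≤ dist (U s w) (NormedSpace.exp (s • L n) w)
            + dist (NormedSpace.exp (s • L n) w) (NormedSpace.exp (s • L n) (L n z)) :=
            dist_triangle _ _ _
        _ < ε / 2 + ε / 2 := by
            refine add_lt_add_of_lt_of_le (h1 s hs) ?_
            rw [dist_comm, dist_eq_norm, ← map_sub]
            calc _ ≤ Real.exp (κ * |s|) * ‖L n z - w‖ := norm_exp_smul_apply_le (h n) s _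
              _ ≤ Real.exp (κ * T) * (ε / (2 * Real.exp (κ * T))) := by gcongr
              _ = ε / 2 := by field_simp
        _ = ε := by ring
    exact hasDerivAt_of_tendstoLocallyUniformlyOn isOpen_Ioo htl.tendstoLocallyUniformlyOn
      (Eventually.of_forall fun n s _ => hasDerivAt_exp_smul_apply (L n) z s)
      (fun s _ => hu s z) ⟨by linarith [neg_abs_le t], by linarith [le_abs_self t]⟩

end BoundedGroup

/-! ### Resolvents, two-sided Yosida approximation and the generation theorem. -/

section Generation

variable {H : Type*} [NormedAddCommGroup H] [InnerProductSpace ℂ H]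

/-- Pair `μ p.1 - p.2` with `p.1` and use Cauchy–Schwarz. The numerical range bound is two-sided, so
both signs of `μ` are covered. -/
theorem mul_norm_le_of_mem_graph {G : Submodule ℂ (H × H)} {β : ℝ}
    (hG : ∀ p ∈ G, |(⟪p.1, p.2⟫_ℂ).re| ≤ β * ‖p.1‖ ^ 2) (μ : ℝ) {p : H × H} (hp : p ∈ G) :
    (|μ| - β) * ‖p.1‖ ≤ ‖(μ : ℂ) • p.1 - p.2‖ := by
  have h1 : (⟪p.1, (μ : ℂ) • p.1 - p.2⟫_ℂ).re = μ * ‖p.1‖ ^ 2 - (⟪p.1, p.2⟫_ℂ).re := by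
    rw [inner_sub_right, inner_smul_right, inner_self_eq_norm_sq_to_K, Complex.sub_re]
    congr 1
    rw [Complex.re_ofReal_mul]
    norm_cast
  have h2 : |(⟪p.1, (μ : ℂ) • p.1 - p.2⟫_ℂ).re| ≤ ‖p.1‖ * ‖(μ : ℂ) • p.1 - p.2‖ :=
    (Complex.abs_re_le_norm _).trans (norm_inner_le_norm _ _)
  have h3 : |μ| * ‖p.1‖ ^ 2 - |(⟪p.1, p.2⟫_ℂ).re| ≤ |(⟪p.1, (μ : ℂ) • p.1 - p.2⟫_ℂ).re| := by
    rw [h1]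
    refine le_trans (le_of_eq ?_) (abs_sub_abs_le_abs_sub _ _)
    rw [abs_mul, abs_of_nonneg (sq_nonneg ‖p.1‖)]
  rcases (norm_nonneg p.1).eq_or_lt with h0 | h0
  · rw [← h0, mul_zero]; exact norm_nonneg _
  · refine le_of_mul_le_mul_left ?_ h0
    nlinarith [hG p hp]

/-- The lower bound makes the solution `p` unique in its first component; uniqueness gives linearity
of the choice, and the same bound gives continuity. -/
theorem exists_resolvent {G : Submodule ℂ (H × H)} {β : ℝ}
    (hG : ∀ p ∈ G, |(⟪p.1, p.2⟫_ℂ).re| ≤ β * ‖p.1‖ ^ 2) {μ : ℝ} (hμ : β < |μ|)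
    (hs : ∀ f : H, ∃ p ∈ G, (μ : ℂ) • p.1 - p.2 = f) :
    ∃ R : H →L[ℂ] H, (∀ f, (R f, (μ : ℂ) • R f - f) ∈ G) ∧
      (∀ p ∈ G, R ((μ : ℂ) • p.1 - p.2) = p.1) ∧ ∀ f, ‖R f‖ ≤ (|μ| - β)⁻¹ * ‖f‖ := by
  have hpos : 0 < |μ| - β := sub_pos.2 hμ
  choose P hP hPf using hs
  have huniq : ∀ p ∈ G, (P ((μ : ℂ) • p.1 - p.2)).1 = p.1 := by
    intro p hp
    have h1 := mul_norm_le_of_mem_graph hG μ (G.sub_mem (hP ((μ : ℂ) • p.1 - p.2)) hp)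
    have h2 := hPf ((μ : ℂ) • p.1 - p.2)
    have h3 : (μ : ℂ) • (P ((μ : ℂ) • p.1 - p.2) - p).1 - (P ((μ : ℂ) • p.1 - p.2) - p).2 = 0 := by
      rw [Prod.fst_sub, Prod.snd_sub, smul_sub, sub_sub_sub_comm, h2, sub_self]
    rw [h3, norm_zero] at h1
    have h4 : ‖(P ((μ : ℂ) • p.1 - p.2) - p).1‖ ≤ 0 := by
      by_contra hcon
      exact absurd h1 (not_le.2 (mul_pos hpos (not_le.1 hcon)))
    exact sub_eq_zero.1 (norm_le_zero_iff.1 h4)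
  have hbound : ∀ f, ‖(P f).1‖ ≤ (|μ| - β)⁻¹ * ‖f‖ := by
    intro f
    have h1 := mul_norm_le_of_mem_graph hG μ (hP f)
    rw [hPf f] at h1
    rw [inv_mul_eq_div, le_div_iff₀ hpos]
    linarith
  refine ⟨LinearMap.mkContinuous
    { toFun := fun f => (P f).1
      map_add' := fun f g => ?_
      map_smul' := fun c f => ?_ } _ hbound, fun f => ?_, huniq, hbound⟩
  · have h := huniq _ (G.add_mem (hP f) (hP g))
    rwa [Prod.fst_add, Prod.snd_add, smul_add, add_sub_add_comm, hPf, hPf] at h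
  · have h := huniq _ (G.smul_mem c (hP f))
    rwa [Prod.smul_fst, Prod.smul_snd, smul_comm, ← smul_sub, hPf] at h
  · have h : ((P f).1, (μ : ℂ) • (P f).1 - f) = P f := by
      refine Prod.ext rfl ?_
      have := hPf f
      change (μ : ℂ) • (P f).1 - f = (P f).2
      rw [sub_eq_iff_eq_add] at this ⊢
      rw [this]; abel
    change ((P f).1, (μ : ℂ) • (P f).1 - f) ∈ G
    rw [h]; exact hP f

/-- Numerical range bound for the two-sided Yosida approximation `ν² A (ν² - A²)⁻¹`. -/
theorem abs_re_inner_yosida_le {G : Submodule ℂ (H × H)} {β : ℝ} (hβ : 0 ≤ β)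
    (hG : ∀ p ∈ G, |(⟪p.1, p.2⟫_ℂ).re| ≤ β * ‖p.1‖ ^ 2) {ν : ℝ} (hν : 0 < ν) (hβν : 4 * β ≤ ν)
    {w y x : H} (h1 : (w, y) ∈ G) (h2 : (y, x) ∈ G) :
    |(⟪((ν ^ 2 : ℝ) : ℂ) • w - x, ((ν ^ 2 : ℝ) : ℂ) • y⟫_ℂ).re|
      ≤ 2 * β * ‖((ν ^ 2 : ℝ) : ℂ) • w - x‖ ^ 2 := by
  have hp := hG _ h1
  have hq := hG _ h2
  have hplus := hG _ (G.add_mem (G.smul_mem (ν : ℂ) h1) h2)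
  have hminus := hG _ (G.sub_mem (G.smul_mem (ν : ℂ) h1) h2)
  simp only [Prod.smul_mk, Prod.mk_add_mk, Prod.mk_sub_mk] at hp hq hplus hminus
  have hyw : (⟪y, w⟫_ℂ).re = (⟪w, y⟫_ℂ).re := inner_re_symm (𝕜 := ℂ) y w
  have hxw : (⟪x, w⟫_ℂ).re = (⟪w, x⟫_ℂ).re := inner_re_symm (𝕜 := ℂ) x w
  have hxy : (⟪x, y⟫_ℂ).re = (⟪y, x⟫_ℂ).re := inner_re_symm (𝕜 := ℂ) x y
  have hnorm : ∀ v : H, ‖v‖ ^ 2 = (⟪v, v⟫_ℂ).re := fun v =>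
    (inner_self_eq_norm_sq (𝕜 := ℂ) v).symm
  rw [hnorm] at hp hq hplus hminus ⊢
  have ha : 0 ≤ (⟪w, w⟫_ℂ).re := inner_self_nonneg (𝕜 := ℂ)
  have hb : 0 ≤ (⟪y, y⟫_ℂ).re := inner_self_nonneg (𝕜 := ℂ)
  have hc : 0 ≤ (⟪x, x⟫_ℂ).re := inner_self_nonneg (𝕜 := ℂ)
  simp only [inner_add_left, inner_add_right, inner_sub_left, inner_sub_right, inner_smul_left,
    inner_smul_right, Complex.conj_ofReal, Complex.add_re, Complex.sub_re, Complex.re_ofReal_mul,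
    hyw, hxw, hxy] at hp hq hplus hminus ⊢
  set a := (⟪w, w⟫_ℂ).re
  set b := (⟪y, y⟫_ℂ).re
  set c := (⟪x, x⟫_ℂ).re
  set p := (⟪w, y⟫_ℂ).re
  set q := (⟪y, x⟫_ℂ).re
  set s := (⟪w, x⟫_ℂ).re
  -- Here `y = A w` and `x = A² w`. Subtracting the bounds for `ν w + y` and `ν w - y` cancels the
  -- diagonal terms and leaves an upper bound for `Re ⟪w, A² w⟫ + ‖A w‖²`.
  have hs : ν * s + ν * b ≤ β * (ν ^ 2 * a + b) := by
    have e1 := (abs_le.1 hplus).2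
    have e2 := (abs_le.1 hminus).1
    nlinarith
  have hK : 0 ≤ ν ^ 2 * a + b := by positivity
  have hlhs : |ν ^ 2 * (ν ^ 2 * p) - ν ^ 2 * q| ≤ ν ^ 2 * (β * (ν ^ 2 * a + b)) := by
    rw [← mul_sub, abs_mul, abs_of_nonneg (sq_nonneg ν)]
    refine mul_le_mul_of_nonneg_left ?_ (sq_nonneg ν)
    refine (abs_sub _ _).trans ?_
    rw [abs_mul, abs_of_nonneg (sq_nonneg ν)]
    nlinarith [mul_le_mul_of_nonneg_left hp (sq_nonneg ν)]
  -- Lower bound for `‖ν² w - x‖²`. By `4 β ≤ ν` the subtracted term is at most half of the first,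
  -- which is the source of the factor `2` in `2 β`.
  have hN : ν ^ 2 * (ν ^ 2 * a + b) - 2 * ν * β * (ν ^ 2 * a + b)
      ≤ ν ^ 2 * (ν ^ 2 * a) - ν ^ 2 * s - (ν ^ 2 * s - c) := by
    have := mul_le_mul_of_nonneg_left hs (by positivity : 0 ≤ 2 * ν)
    nlinarith [mul_nonneg (sq_nonneg ν) hb]
  have hfin : ν ^ 2 * (β * (ν ^ 2 * a + b))
      ≤ 2 * β * (ν ^ 2 * (ν ^ 2 * a + b) - 2 * ν * β * (ν ^ 2 * a + b)) := by
    have : 0 ≤ β * ν * (ν ^ 2 * a + b) * (ν - 4 * β) :=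
      mul_nonneg (mul_nonneg (mul_nonneg hβ hν.le) hK) (by linarith)
    nlinarith
  calc _ = |ν ^ 2 * (ν ^ 2 * p) - ν ^ 2 * q| := by
        congr 1; ring
    _ ≤ _ := hlhs
    _ ≤ _ := hfin
    _ ≤ 2 * β * (ν ^ 2 * (ν ^ 2 * a) - ν ^ 2 * s - (ν ^ 2 * s - c)) :=
        mul_le_mul_of_nonneg_left hN (by positivity)
    _ = _ := by ring

/-- A vector orthogonal to the domain has the form `μ x - y` with `(x, y)` in the graph. Pairing it
with `x` gives `(μ - β) ‖x‖² ≤ 0`, so `x = 0`, and then `y = 0` because the graph is single-valued.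
-/
theorem dense_fst_graph [CompleteSpace H] {G : Submodule ℂ (H × H)} {β : ℝ}
    (hG : ∀ p ∈ G, |(⟪p.1, p.2⟫_ℂ).re| ≤ β * ‖p.1‖ ^ 2) (hG0 : ∀ w, ((0 : H), w) ∈ G → w = 0)
    {μ : ℝ} (hμ : β < μ) (hs : ∀ f : H, ∃ p ∈ G, (μ : ℂ) • p.1 - p.2 = f) :
    Dense (Prod.fst '' (G : Set (H × H))) := by
  have h : (G.map (LinearMap.fst ℂ H H)).topologicalClosure = ⊤ := by
    rw [Submodule.topologicalClosure_eq_top_iff, Submodule.eq_bot_iff]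
    intro z hz
    obtain ⟨⟨x, y⟩, hp, rfl⟩ := hs z
    rw [Submodule.mem_orthogonal] at hz
    have h1 := congrArg Complex.re (hz x ⟨(x, y), hp, rfl⟩)
    have h2 := (abs_le.1 (hG _ hp)).2
    rw [inner_sub_right, inner_smul_right, inner_self_eq_norm_sq_to_K, Complex.sub_re] at h1
    have h3 : ((μ : ℂ) * ((‖x‖ : ℝ) : ℂ) ^ 2).re = μ * ‖x‖ ^ 2 := by norm_cast
    have h4 : μ * ‖x‖ ^ 2 - (⟪x, y⟫_ℂ).re = 0 := by rw [← h3]; exact h1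
    have h5 : ‖x‖ ^ 2 ≤ 0 := by
      by_contra hcon
      have : 0 < (μ - β) * ‖x‖ ^ 2 := mul_pos (sub_pos.2 hμ) (not_le.1 hcon)
      simp only at h2
      linarith
    have h6 : x = 0 := norm_eq_zero.1 (pow_eq_zero_iff two_ne_zero |>.1 (le_antisymm h5 (sq_nonneg _)))
    subst h6
    simp [hG0 y hp]
  have h2 := congrArg (fun K : Submodule ℂ H => (K : Set H)) h
  simp only [Submodule.topologicalClosure_coe, Submodule.map_coe, Submodule.top_coe] at h2
  exact dense_iff_closure_eq.2 h2

/-- On the domain `μ R x - x = R w`, which tends to zero. Density and a uniform bound on `μ R` give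
all vectors. -/
theorem tendsto_smul_resolvent {ι : Type*} {l : Filter ι} {G : Submodule ℂ (H × H)} {β : ℝ}
    (hβ : 0 ≤ β) (hD : Dense (Prod.fst '' (G : Set (H × H)))) {μ : ι → ℝ} {R : ι → H →L[ℂ] H}
    (hR : ∀ i, ∀ p ∈ G, R i ((μ i : ℂ) • p.1 - p.2) = p.1)
    (hRb : ∀ i f, ‖R i f‖ ≤ (|μ i| - β)⁻¹ * ‖f‖) (hμ : Tendsto (fun i => |μ i|) l atTop) (z : H) :
    Tendsto (fun i => (μ i : ℂ) • R i z) l (𝓝 z) := by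
  rw [Metric.tendsto_nhds]
  intro ε hε
  obtain ⟨_, hx, ⟨⟨x, w⟩, hp, rfl⟩⟩ := Metric.dense_iff.1 hD z (ε / 4) (by positivity)
  have hxz : ‖z - x‖ < ε / 4 := by rw [← dist_eq_norm, dist_comm]; exact hx
  have h1 : Tendsto (fun i => (|μ i| - β)⁻¹ * ‖w‖) l (𝓝 (0 * ‖w‖)) :=
    (tendsto_inv_atTop_zero.comp (tendsto_atTop_add_const_right l (-β) hμ)).mul_const _
  rw [zero_mul] at h1
  filter_upwards [h1.eventually (gt_mem_nhds (show 0 < ε / 4 by positivity)),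
    -- From here on `|μ| / (|μ| - β) ≤ 2`, which bounds `‖μ R‖` by `2`.
    hμ.eventually_ge_atTop (2 * β + 1)] with i hi hi2
  have hpos : 0 < |μ i| - β := by linarith
  have e : (μ i : ℂ) • R i z - z = (μ i : ℂ) • R i (z - x) + R i w + (x - z) := by
    have h2 : (μ i : ℂ) • R i x - R i w = x := by simpa only [map_sub, map_smul] using hR i _ hp
    rw [map_sub, smul_sub, ← sub_eq_zero, ← sub_eq_zero.2 h2]
    abel
  have h2 : ‖(μ i : ℂ) • R i (z - x)‖ ≤ 2 * ‖z - x‖ := by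
    rw [norm_smul, Complex.norm_real, Real.norm_eq_abs]
    calc |μ i| * ‖R i (z - x)‖ ≤ |μ i| * ((|μ i| - β)⁻¹ * ‖z - x‖) := by
          gcongr; exact hRb i _
      _ = (|μ i| * (|μ i| - β)⁻¹) * ‖z - x‖ := by ring
      _ ≤ 2 * ‖z - x‖ := by
          gcongr
          rw [← div_eq_mul_inv, div_le_iff₀ hpos]
          linarith
  rw [dist_eq_norm, e]
  calc _ ≤ ‖(μ i : ℂ) • R i (z - x)‖ + ‖R i w‖ + ‖x - z‖ := norm_add₃_le
    _ < ε := by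
      have := hRb i w
      rw [norm_sub_rev x z]
      linarith

/-- With `R μ = (μ - A)⁻¹` one has `R ν + R (-ν) = 2 A (ν² - A²)⁻¹`, so half of `ν²` times this sum
approximates `A`. The symmetric use of `ν` and `-ν` yields a bound on both sides of the numerical
range. -/
theorem exists_yosida [CompleteSpace H] {G : Submodule ℂ (H × H)} {β : ℝ} (hβ : 0 ≤ β)
    (hG : ∀ p ∈ G, |(⟪p.1, p.2⟫_ℂ).re| ≤ β * ‖p.1‖ ^ 2) (hG0 : ∀ w, ((0 : H), w) ∈ G → w = 0)
    {r : ℝ} (hs : ∀ μ : ℝ, r ≤ |μ| → ∀ f : H, ∃ p ∈ G, (μ : ℂ) • p.1 - p.2 = f) :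
    ∃ L : ℕ → H →L[ℂ] H, (∀ n z, |(⟪z, L n z⟫_ℂ).re| ≤ 2 * β * ‖z‖ ^ 2) ∧
      (∀ m n, Commute (L m) (L n)) ∧
      ∀ p ∈ G, Tendsto (fun n => L n p.1) atTop (𝓝 p.2) := by
  -- Above `ρ` the resolvent equation is solvable, `4 β ≤ ν` holds as the numerical range estimate
  -- requires, and `ν > 0`.
  set ρ : ℝ := max r (4 * β + 1) with hρ
  have hρr : r ≤ ρ := le_max_left _ _
  have hρβ : 4 * β + 1 ≤ ρ := le_max_right _ _
  -- `R` is chosen for every real `μ`, with the irrelevant value `0` when `|μ| < ρ`.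
  have hex : ∀ μ : ℝ, ∃ R : H →L[ℂ] H, ρ ≤ |μ| → (∀ f, (R f, (μ : ℂ) • R f - f) ∈ G) ∧
      (∀ p ∈ G, R ((μ : ℂ) • p.1 - p.2) = p.1) ∧ ∀ f, ‖R f‖ ≤ (|μ| - β)⁻¹ * ‖f‖ := by
    intro μ
    by_cases h : ρ ≤ |μ|
    · obtain ⟨R, hR⟩ := exists_resolvent hG (show β < |μ| by linarith) (hs μ (hρr.trans h))
      exact ⟨R, fun _ => hR⟩
    · exact ⟨0, fun h' => absurd h' h⟩
  choose R hR using hex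
  -- The resolvent identity; dividing by `μ - μ'` and exchanging the roles gives commutation.
  have hres : ∀ μ μ', ρ ≤ |μ| → ρ ≤ |μ'| → ∀ f,
      ((μ : ℂ) - μ') • R μ (R μ' f) = R μ' f - R μ f := by
    intro μ μ' h h' f
    have := (hR μ h).2.1 _ ((hR μ' h').1 f)
    simp only [map_sub, map_smul] at this
    rw [sub_smul, ← sub_eq_zero, ← sub_eq_zero.2 this]
    abel
  have hcomm : ∀ μ μ', ρ ≤ |μ| → ρ ≤ |μ'| → Commute (R μ) (R μ') := by
    intro μ μ' h h'
    rcases eq_or_ne μ μ' with rfl | hne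
    · exact Commute.refl _
    · ext f
      change R μ (R μ' f) = R μ' (R μ f)
      have hne' : (μ : ℂ) - μ' ≠ 0 := by
        rw [sub_ne_zero]; exact_mod_cast hne
      refine smul_right_injective H hne' ?_
      simp only
      rw [hres μ μ' h h', ← neg_sub (μ' : ℂ) μ, neg_smul, hres μ' μ h' h, neg_sub]
  let ν : ℕ → ℝ := fun n => n + ρ
  have hρ0 : 0 < ρ := by linarith
  have hν : ∀ n, ρ ≤ ν n := fun n => le_add_of_nonneg_left n.cast_nonneg
  have hν1 : ∀ n, ρ ≤ |ν n| := fun n => (hν n).trans (le_abs_self _)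
  have hν2 : ∀ n, ρ ≤ |-ν n| := fun n => by rw [abs_neg]; exact hν1 n
  have hνlim : Tendsto ν atTop atTop :=
    tendsto_atTop_add_const_right _ _ tendsto_natCast_atTop_atTop
  have hD := dense_fst_graph hG hG0 (show β < ρ by linarith)
    (hs ρ (hρr.trans (le_abs_self _)))
  refine ⟨fun n => ((ν n ^ 2 / 2 : ℝ) : ℂ) • (R (ν n) + R (-ν n)), fun n z => ?_, fun m n => ?_,
    fun p hp => ?_⟩
  · have hn0 : (ν n : ℂ) ≠ 0 := by exact_mod_cast (hρ0.trans_le (hν n)).ne'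
    have a1 := (hR _ (hν1 n)).1 z
    have a2 := (hR _ (hν2 n)).1 z
    -- The chain `w = (ν² - A²)⁻¹ z`, `y = A w`, `x = A² w = ν² w - z`, written through the two
    -- resolvents.
    have g1 : ((2 * (ν n : ℂ))⁻¹ • (R (ν n) z - R (-ν n) z),
        (2 : ℂ)⁻¹ • (R (ν n) z + R (-ν n) z)) ∈ G := by
      convert G.smul_mem (2 * (ν n : ℂ))⁻¹ (G.sub_mem a1 a2) using 1
      refine Prod.ext rfl ?_
      simp only [Prod.smul_mk, Prod.mk_sub_mk, Complex.ofReal_neg, neg_smul]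
      rw [show ∀ a b : H, (ν n : ℂ) • a - z - (-((ν n : ℂ) • b) - z) = (ν n : ℂ) • (a + b) from
        fun a b => by rw [smul_add]; abel, smul_smul]
      congr 1
      field_simp
    have g2 : ((2 : ℂ)⁻¹ • (R (ν n) z + R (-ν n) z),
        ((ν n ^ 2 : ℝ) : ℂ) • (2 * (ν n : ℂ))⁻¹ • (R (ν n) z - R (-ν n) z) - z) ∈ G := by
      convert G.smul_mem (2 : ℂ)⁻¹ (G.add_mem a1 a2) using 1
      refine Prod.ext rfl ?_
      simp only [Prod.smul_mk, Prod.mk_add_mk, Complex.ofReal_neg, neg_smul]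
      rw [show ∀ a b : H, (ν n : ℂ) • a - z + (-((ν n : ℂ) • b) - z)
        = (ν n : ℂ) • (a - b) - (2 : ℂ) • z from
        fun a b => by rw [smul_sub, two_smul]; abel, smul_sub (2 : ℂ)⁻¹, smul_smul, smul_smul,
        smul_smul, inv_mul_cancel₀ (two_ne_zero' ℂ), one_smul]
      congr 2
      push_cast
      field_simp
    have := abs_re_inner_yosida_le hβ hG (hρ0.trans_le (hν n)) (by linarith [hν n]) g1 g2
    rw [sub_sub_cancel, smul_smul] at this
    convert this using 5
    simp only [smul_apply, add_apply]
    congr 1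
    push_cast
    ring
  · have h : ∀ a b : ℝ, ρ ≤ |a| → ρ ≤ |-a| → ρ ≤ |b| → ρ ≤ |-b| →
        Commute (R a + R (-a)) (R b + R (-b)) := fun a b h1 h2 h3 h4 =>
      ((hcomm _ _ h1 h3).add_right (hcomm _ _ h1 h4)).add_left
        ((hcomm _ _ h2 h3).add_right (hcomm _ _ h2 h4))
    exact ((h _ _ (hν1 m) (hν2 m) (hν1 n) (hν2 n)).smul_left _).smul_right _
  · have habs : Tendsto (fun n => |ν n|) atTop atTop := tendsto_abs_atTop_atTop.comp hνlim
    have t1 := tendsto_smul_resolvent hβ hD (fun n => (hR _ (hν1 n)).2.1)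
      (fun n => (hR _ (hν1 n)).2.2) habs p.2
    have t2 := tendsto_smul_resolvent hβ hD (fun n => (hR _ (hν2 n)).2.1)
      (fun n => (hR _ (hν2 n)).2.2) (by simpa using habs) p.2
    -- On the domain the approximation of `A p.1` equals the mean of `ν R(ν) p.2` and `-ν R(-ν)
    -- p.2`, both of which tend to `p.2`.
    have t3 := (t1.add t2).const_smul (2 : ℂ)⁻¹
    rw [← two_smul ℂ p.2, smul_smul, inv_mul_cancel₀ (two_ne_zero' ℂ), one_smul] at t3
    refine t3.congr fun n => ?_
    have b1 := (hR _ (hν1 n)).2.1 p hp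
    have b2 := (hR _ (hν2 n)).2.1 p hp
    simp only [map_sub, map_smul] at b1 b2
    have c1 : R (ν n) p.2 = (ν n : ℂ) • R (ν n) p.1 - p.1 := by
      nth_rewrite 2 [← b1]; abel
    have c2 : R (-ν n) p.2 = ((-ν n : ℝ) : ℂ) • R (-ν n) p.1 - p.1 := by
      nth_rewrite 2 [← b2]; abel
    rw [c1, c2]
    simp only [smul_apply, add_apply]
    push_cast
    module

/-- Generation theorem: an operator in a Hilbert space such that both `A` and `-A` are
quasi-dissipative and `μ - A` is onto for all real `μ` of large modulus generates a strongly
continuous group. -/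
theorem generatesC0Group_of_bound [CompleteSpace H] (A : H →ₗ.[ℂ] H) {β : ℝ} (hβ : 0 ≤ β)
    (hA : ∀ p ∈ A.graph, |(⟪p.1, p.2⟫_ℂ).re| ≤ β * ‖p.1‖ ^ 2) {r : ℝ}
    (hs : ∀ μ : ℝ, r ≤ |μ| → ∀ f : H, ∃ p ∈ A.graph, (μ : ℂ) • p.1 - p.2 = f) :
    GeneratesC0Group A := by
  have hG0 : ∀ w, ((0 : H), w) ∈ A.graph → w = 0 := fun w hw =>
    LinearPMap.graph_fst_eq_zero_snd A hw rfl
  obtain ⟨L, hL1, hL2, hL3⟩ := exists_yosida hβ hA hG0 hs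
  have hD := dense_fst_graph hA hG0 (show β < max r (β + 1) by
    have := le_max_right r (β + 1); linarith) (hs _ ((le_max_left _ _).trans (le_abs_self _)))
  obtain ⟨U, hU, hUb, hUd⟩ := exists_group_of_tendsto (by positivity) hL1 hL2 hD hL3
  have hslope : ∀ z w, HasDerivAt (fun t => U t z) w 0 ↔
      Tendsto (fun t : ℝ => (t : ℂ)⁻¹ • (U t z - z)) (𝓝[≠] 0) (𝓝 w) := by
    intro z w
    rw [hasDerivAt_iff_tendsto_slope_zero]
    refine tendsto_congr fun t => ?_
    rw [zero_add, hU.map_zero, ← Complex.ofReal_inv, Complex.coe_smul]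
    rfl
  have hfwd : ∀ z w, (z, w) ∈ A.graph → HasDerivAt (fun t => U t z) w 0 := by
    intro z w h
    have := hUd _ h 0
    rwa [hU.map_zero] at this
  refine ⟨U, hU, fun z w => ⟨fun h => (hslope z w).1 (hfwd z w h), fun h => ?_⟩⟩
  have hd := (hslope z w).2 h
  -- It remains to show that the generator of `U` is no larger than `A`. Solving `μ x - y = μ z - w`
  -- in the graph of `A` leaves `z - x` as an eigenvector of the generator with eigenvalue `μ`. As
  -- `μ` exceeds the growth rate `2 β` of `U`, it must vanish.
  set μ : ℝ := max r (2 * β + 1) with hμ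
  obtain ⟨⟨x, y⟩, hp, hxy⟩ := hs μ ((le_max_left _ _).trans (le_abs_self _)) ((μ : ℂ) • z - w)
  simp only at hxy
  have hv : HasDerivAt (fun t => U t (z - x)) (μ • (z - x)) 0 := by
    have h1 := hd.sub (hfwd x y hp)
    refine HasDerivAt.congr_deriv (f := fun t => U t (z - x)) ?_ (f' := w - y) ?_
    · refine h1.congr_of_eventuallyEq (Eventually.of_forall fun t => ?_)
      simp
    · rw [smul_sub, ← Complex.coe_smul, ← Complex.coe_smul, sub_eq_sub_iff_add_eq_add]
      rw [sub_eq_sub_iff_add_eq_add] at hxy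
      rw [add_comm, ← hxy]
  have hvt : ∀ t, HasDerivAt (fun s => U s (z - x)) (μ • U t (z - x)) t := by
    intro t
    have h1 : HasDerivAt (fun s => U (s - t) (z - x)) (μ • (z - x)) t := by
      have h2 : HasDerivAt (fun s => U s (z - x)) (μ • (z - x)) (t - t) := by rwa [sub_self]
      exact h2.comp_sub_const t t
    have h3 := ((U t).restrictScalars ℝ).hasFDerivAt.comp_hasDerivAt t h1
    refine (h3.congr_deriv ?_).congr_of_eventuallyEq (Eventually.of_forall fun s => ?_)
    · simp
    · change U s (z - x) = U t (U (s - t) (z - x))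
      rw [← ContinuousLinearMap.comp_apply, ← hU.map_add, add_sub_cancel]
  -- Hence `U t (z - x) = exp (μ t) (z - x)`; the growth bound at `t = 1` contradicts this unless `z
  -- = x`.
  have hconst : ∀ t, HasDerivAt (fun s => Real.exp (-μ * s) • U s (z - x)) 0 t := by
    intro t
    have h1 : HasDerivAt (fun s => Real.exp (-μ * s)) (Real.exp (-μ * t) * -μ) t := by
      simpa using ((hasDerivAt_id t).const_mul (-μ)).exp
    refine (h1.smul (hvt t)).congr_deriv ?_
    module
  have hc := is_const_of_deriv_eq_zero (fun t => (hconst t).differentiableAt)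
    (fun t => (hconst t).deriv) 1 0
  simp only [mul_zero, Real.exp_zero, one_smul, hU.map_zero, mul_one,
    ContinuousLinearMap.id_apply] at hc
  have hb := hUb 1 (z - x)
  have hzero : z - x = 0 := by
    by_contra hne
    have hn : 0 < ‖z - x‖ := norm_pos_iff.2 hne
    have h1 : ‖z - x‖ ≤ Real.exp (-μ) * (Real.exp (2 * β) * ‖z - x‖) := by
      conv_lhs => rw [← hc, norm_smul, Real.norm_eq_abs, abs_of_pos (Real.exp_pos _)]
      simpa using mul_le_mul_of_nonneg_left hb (Real.exp_pos (-μ)).le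
    rw [← mul_assoc, ← Real.exp_add] at h1
    have h2 : Real.exp (-μ + 2 * β) < 1 := by
      rw [Real.exp_lt_one_iff]
      have := le_max_right r (2 * β + 1)
      linarith
    nlinarith
  rw [sub_eq_zero] at hzero
  subst hzero
  have : y = w := sub_right_injective hxy
  rwa [← this]

end Generation

/-! ### Bounds for multiplication by matrix functions. -/

section MultiplicationBounds

variable {n : Type*} [Fintype n] [DecidableEq n] {ℓ : ℝ}

theorem norm_toEuclideanLin_le (A : Matrix n n ℂ) (ξ : EuclideanSpace ℂ n) :
    ‖Matrix.toEuclideanLin A ξ‖ ≤ (∑ i, ∑ j, ‖A i j‖) * ‖ξ‖ := by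
  set v := Matrix.toEuclideanLin A ξ with hv
  have h1 : ‖v‖ ≤ ∑ i, ‖v i‖ := by
    rw [EuclideanSpace.norm_eq]
    refine Real.sqrt_le_iff.2 ⟨Finset.sum_nonneg fun i _ => norm_nonneg _, ?_⟩
    exact Finset.sum_sq_le_sq_sum_of_nonneg fun i _ => norm_nonneg _
  refine h1.trans ?_
  rw [Finset.sum_mul]
  refine Finset.sum_le_sum fun i _ => ?_
  have h2 : v i = ∑ j, A i j * ξ j := by
    simp [hv, Matrix.toLpLin_apply, Matrix.mulVec, dotProduct]
  rw [h2, Finset.sum_mul]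
  refine (norm_sum_le _ _).trans (Finset.sum_le_sum fun j _ => ?_)
  rw [norm_mul]
  exact mul_le_mul_of_nonneg_left (PiLp.norm_apply_le ξ j) (norm_nonneg _)

theorem mulL2_coeFn {A : ℝ → Matrix n n ℂ} (h : IsLinfty ℓ A) (u : L2I ℓ (EuclideanSpace ℂ n)) :
    mulL2 A h u =ᵐ[volume.restrict (Ioo (0 : ℝ) ℓ)] fun x => Matrix.toEuclideanLin (A x) (u x) :=
  (h.memLp u).coeFn_toLp

theorem mulL2_comp {A A' : ℝ → Matrix n n ℂ} (h : IsLinfty ℓ A) (h' : IsLinfty ℓ A')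
    (h'' : IsLinfty ℓ fun x => A x * A' x) (u : L2I ℓ (EuclideanSpace ℂ n)) :
    mulL2 A h (mulL2 A' h' u) = mulL2 (fun x => A x * A' x) h'' u := by
  apply Lp.ext
  filter_upwards [mulL2_coeFn h (mulL2 A' h' u), mulL2_coeFn h' u, mulL2_coeFn h'' u]
    with x h1 h2 h3
  rw [h1, h2, h3]
  simp [Matrix.toLpLin_apply]

/-- The bound is pointwise almost everywhere and not merely in norm, because the Volterra iteration
below needs it at each point. -/
theorem IsLinfty.exists_norm_mulL2_le {A : ℝ → Matrix n n ℂ} (h : IsLinfty ℓ A) :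
    ∃ C : ℝ, 0 ≤ C ∧ ∀ u : L2I ℓ (EuclideanSpace ℂ n),
      ∀ᵐ x ∂volume.restrict (Ioo (0 : ℝ) ℓ), ‖mulL2 A h u x‖ ≤ C * ‖u x‖ := by
  have h1 : ∀ i j, ∃ c : ℝ, 0 ≤ c ∧ ∀ᵐ x ∂volume.restrict (Ioo (0 : ℝ) ℓ), ‖A x i j‖ ≤ c := by
    intro i j
    refine ⟨(eLpNormEssSup (fun x => A x i j) (volume.restrict (Ioo (0 : ℝ) ℓ))).toReal,
      ENNReal.toReal_nonneg, ?_⟩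
    have hfin := (h i j).2
    rw [eLpNorm_exponent_top] at hfin
    filter_upwards [enorm_ae_le_eLpNormEssSup (fun x => A x i j) _] with x hx
    rw [← toReal_enorm]
    exact ENNReal.toReal_mono hfin.ne hx
  choose c hc0 hc using h1
  refine ⟨∑ i, ∑ j, c i j, Finset.sum_nonneg fun i _ => Finset.sum_nonneg fun j _ => hc0 i j,
    fun u => ?_⟩
  have hall : ∀ᵐ x ∂volume.restrict (Ioo (0 : ℝ) ℓ), ∀ i j, ‖A x i j‖ ≤ c i j :=
    ae_all_iff.2 fun i => ae_all_iff.2 fun j => hc i j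
  filter_upwards [mulL2_coeFn h u, hall] with x h1 h2
  rw [h1]
  refine (norm_toEuclideanLin_le _ _).trans ?_
  gcongr with i _ j _
  exact h2 i j

theorem norm_le_mul_norm_of_ae {F : Type*} [NormedAddCommGroup F] {C : ℝ} {u w : L2I ℓ F}
    (h : ∀ᵐ x ∂volume.restrict (Ioo (0 : ℝ) ℓ), ‖w x‖ ≤ C * ‖u x‖) : ‖w‖ ≤ C * ‖u‖ :=
  Lp.norm_le_mul_norm_of_ae_le_mul h

end MultiplicationBounds

/-! ### Equivalence of the weighted and the product norm; completeness. -/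

namespace HypSystem

variable {V E : Type*} [Fintype E] [DecidableEq V] {G : MetricGraph V E} (S : HypSystem G)

/-- A positive continuous function on the compact unit sphere attains a positive minimum;
homogeneity does the rest. The sphere is empty only if `Yd v = 0`, where any constant serves. -/
theorem exists_Qd_coercive (v : V) : ∃ q : ℝ, 0 < q ∧ ∀ x : S.Yd v,
    q * ‖x‖ ^ 2 ≤ (⟪x, S.Qd v x⟫_ℂ).re := by
  have hc : Continuous fun x : S.Yd v => (⟪x, S.Qd v x⟫_ℂ).re :=
    Complex.continuous_re.comp (Continuous.inner (𝕜 := ℂ) (E := S.Yd v) continuous_id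
      (S.Qd v).continuous_of_finiteDimensional)
  rcases (Metric.sphere (0 : S.Yd v) 1).eq_empty_or_nonempty with he | hne
  · refine ⟨1, one_pos, fun x => ?_⟩
    have : x = 0 := by
      by_contra hx
      have hmem : ((‖x‖ : ℂ)⁻¹) • x ∈ Metric.sphere (0 : S.Yd v) 1 := by
        rw [mem_sphere_zero_iff_norm, norm_smul, norm_inv, Complex.norm_real, norm_norm,
          inv_mul_cancel₀ (norm_ne_zero_iff.2 hx)]
      rw [he] at hmem
      exact hmem
    simp [this]
  · obtain ⟨y, hy, hmin⟩ := (isCompact_sphere (0 : S.Yd v) 1).exists_isMinOn hne hc.continuousOn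
    have hy1 : ‖y‖ = 1 := mem_sphere_zero_iff_norm.1 hy
    refine ⟨_, S.Qd_pos v y (fun h0 => by simp [h0] at hy1), fun x => ?_⟩
    rcases eq_or_ne x 0 with rfl | hx
    · simp
    have hn : ‖x‖ ≠ 0 := norm_ne_zero_iff.2 hx
    have hmem : ((‖x‖⁻¹ : ℝ) : ℂ) • x ∈ Metric.sphere (0 : S.Yd v) 1 := by
      rw [mem_sphere_zero_iff_norm, norm_smul, Complex.norm_real, norm_inv, norm_norm,
        inv_mul_cancel₀ hn]
    have h1 := isMinOn_iff.1 hmin _ hmem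
    have h2 : ⟪((‖x‖⁻¹ : ℝ) : ℂ) • x, ((‖x‖⁻¹ : ℝ) : ℂ) • S.Qd v x⟫_ℂ
        = ((‖x‖⁻¹ : ℝ) : ℂ) * (((‖x‖⁻¹ : ℝ) : ℂ) * ⟪x, S.Qd v x⟫_ℂ) := by
      refine (inner_smul_left (𝕜 := ℂ) (E := S.Yd v) _ _ _).trans ?_
      rw [Complex.conj_ofReal]
      exact congrArg _ (inner_smul_right (𝕜 := ℂ) (E := S.Yd v) _ _ _)
    simp only [map_smul] at h1
    rw [h2, Complex.re_ofReal_mul, Complex.re_ofReal_mul] at h1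
    calc _ ≤ (‖x‖⁻¹ * (‖x‖⁻¹ * (⟪x, S.Qd v x⟫_ℂ).re)) * ‖x‖ ^ 2 := by gcongr
      _ = _ := by field_simp

theorem re_mulQ_nonneg (e : E) (u : L2I (G.ℓ e) (G.EdgeSpace e)) :
    0 ≤ (⟪u, mulL2 (S.Q e) (S.Q_lip e).isLinfty u⟫_ℂ).re := by
  obtain ⟨q, hq, h⟩ := S.mulQ_pos e
  exact le_trans (by positivity) (h u)

variable [Fintype V]

theorem norm_sq_eq (z : S.L2d) : ‖z‖ ^ 2 =
    ∑ e, (⟪S.edge z e, mulL2 (S.Q e) (S.Q_lip e).isLinfty (S.edge z e)⟫_ℂ).re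
      + ∑ v, (⟪S.vert z v, S.Qd v (S.vert z v)⟫_ℂ).re := by
  rw [← inner_self_eq_norm_sq (𝕜 := ℂ) z, inner_eq_innerD, innerD_eq, map_add, map_sum, map_sum]
  rfl

theorem exists_norm_edge_le (e : E) : ∃ C : ℝ, 0 ≤ C ∧ ∀ z : S.L2d, ‖S.edge z e‖ ^ 2 ≤ C * ‖z‖ ^ 2 := by
  obtain ⟨q, hq, h⟩ := S.mulQ_pos e
  refine ⟨q⁻¹, by positivity, fun z => ?_⟩
  rw [inv_mul_eq_div, le_div_iff₀ hq, mul_comm, norm_sq_eq]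
  refine (h (S.edge z e)).trans ?_
  refine le_add_of_le_of_nonneg ?_ (Finset.sum_nonneg fun v _ => S.re_Qd_nonneg v _)
  exact Finset.single_le_sum (f := fun e =>
    (⟪S.edge z e, mulL2 (S.Q e) (S.Q_lip e).isLinfty (S.edge z e)⟫_ℂ).re)
    (fun e _ => S.re_mulQ_nonneg e _) (Finset.mem_univ e)

theorem exists_norm_vert_le (v : V) : ∃ C : ℝ, 0 ≤ C ∧ ∀ z : S.L2d, ‖S.vert z v‖ ^ 2 ≤ C * ‖z‖ ^ 2 := by
  obtain ⟨q, hq, h⟩ := S.exists_Qd_coercive v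
  refine ⟨q⁻¹, by positivity, fun z => ?_⟩
  rw [inv_mul_eq_div, le_div_iff₀ hq, mul_comm, norm_sq_eq]
  refine (h (S.vert z v)).trans ?_
  refine le_add_of_nonneg_of_le (Finset.sum_nonneg fun e _ => S.re_mulQ_nonneg e _) ?_
  exact Finset.single_le_sum (f := fun v => (⟪S.vert z v, S.Qd v (S.vert z v)⟫_ℂ).re)
    (fun v _ => S.re_Qd_nonneg v _) (Finset.mem_univ v)

theorem exists_norm_sq_le : ∃ C : ℝ, ∀ z : S.L2d, ‖z‖ ^ 2 ≤ C * ‖S.toProd z‖ ^ 2 := by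
  choose c hc0 hc using fun e => (S.Q_lip e).isLinfty.exists_norm_mulL2_le
  let d : V → ℝ := fun v => ‖(S.Qd v).toContinuousLinearMap‖
  refine ⟨∑ e, c e + ∑ v, d v, fun z => ?_⟩
  rw [norm_sq_eq, add_mul, Finset.sum_mul, Finset.sum_mul]
  refine add_le_add (Finset.sum_le_sum fun e _ => ?_) (Finset.sum_le_sum fun v _ => ?_)
  · have h1 : ‖S.edge z e‖ ≤ ‖S.toProd z‖ :=
      (norm_le_pi_norm (S.toProd z).1 e).trans (norm_fst_le _)
    calc _ ≤ ‖S.edge z e‖ * ‖mulL2 (S.Q e) (S.Q_lip e).isLinfty (S.edge z e)‖ :=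
          (Complex.re_le_norm _).trans (norm_inner_le_norm _ _)
      _ ≤ ‖S.edge z e‖ * (c e * ‖S.edge z e‖) := by
          gcongr; exact norm_le_mul_norm_of_ae (hc e (S.edge z e))
      _ = c e * ‖S.edge z e‖ ^ 2 := by ring
      _ ≤ _ := by gcongr; exact hc0 e
  · have h1 : ‖S.vert z v‖ ≤ ‖S.toProd z‖ :=
      (norm_le_pi_norm (S.toProd z).2 v).trans (norm_snd_le _)
    calc _ ≤ ‖S.vert z v‖ * ‖S.Qd v (S.vert z v)‖ :=
          (Complex.re_le_norm _).trans (norm_inner_le_norm _ _)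
      _ ≤ ‖S.vert z v‖ * (d v * ‖S.vert z v‖) := by
          gcongr; exact (S.Qd v).toContinuousLinearMap.le_opNorm _
      _ = d v * ‖S.vert z v‖ ^ 2 := by ring
      _ ≤ _ := by gcongr

theorem exists_norm_toProd_le : ∃ C : ℝ, ∀ z : S.L2d, ‖S.toProd z‖ ≤ C * ‖z‖ := by
  choose c hc0 hc using S.exists_norm_edge_le
  choose d hd0 hd using S.exists_norm_vert_le
  set K := ∑ e, c e + ∑ v, d v with hK
  have hcK : ∀ e, c e ≤ K := fun e => le_add_of_le_of_nonneg
    (Finset.single_le_sum (fun e _ => hc0 e) (Finset.mem_univ e)) (Finset.sum_nonneg fun v _ => hd0 v)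
  have hdK : ∀ v, d v ≤ K := fun v => le_add_of_nonneg_of_le (Finset.sum_nonneg fun e _ => hc0 e)
    (Finset.single_le_sum (fun v _ => hd0 v) (Finset.mem_univ v))
  have hK0 : 0 ≤ K := add_nonneg (Finset.sum_nonneg fun e _ => hc0 e)
    (Finset.sum_nonneg fun v _ => hd0 v)
  refine ⟨√K, fun z => ?_⟩
  have key : ∀ {a b : ℝ}, 0 ≤ a → b ≤ K → a ^ 2 ≤ b * ‖z‖ ^ 2 → a ≤ √K * ‖z‖ := by
    intro a b ha hb h
    refine (abs_le_of_sq_le_sq' ?_ (by positivity)).2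
    rw [mul_pow, Real.sq_sqrt hK0]
    exact h.trans (by gcongr)
  refine norm_prod_le_iff.2 ⟨(pi_norm_le_iff_of_nonneg (by positivity)).2 fun e => ?_,
    (pi_norm_le_iff_of_nonneg (by positivity)).2 fun v => ?_⟩
  · exact key (norm_nonneg _) (hcK e) (hc e z)
  · exact key (norm_nonneg _) (hdK v) (hd v z)

instance : CompleteSpace S.L2d := by
  obtain ⟨C, hC⟩ := S.exists_norm_sq_le
  obtain ⟨D, hD⟩ := S.exists_norm_toProd_le
  let f : S.L2d →L[ℂ] (∀ e, L2I (G.ℓ e) (G.EdgeSpace e)) × (∀ v, S.Yd v) :=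
    LinearMap.mkContinuous S.toProd.toLinearMap D hD
  have hg : ∀ p, ‖S.toProd.symm p‖ ≤ √(max C 0) * ‖p‖ := by
    intro p
    refine (abs_le_of_sq_le_sq' ?_ (by positivity)).2
    rw [mul_pow, Real.sq_sqrt (le_max_right _ _)]
    have := hC (S.toProd.symm p)
    rw [LinearEquiv.apply_symm_apply] at this
    exact this.trans (by gcongr; exact le_max_left _ _)
  let g : (∀ e, L2I (G.ℓ e) (G.EdgeSpace e)) × (∀ v, S.Yd v) →L[ℂ] S.L2d :=
    LinearMap.mkContinuous S.toProd.symm.toLinearMap _ hg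
  let eqv : S.L2d ≃L[ℂ] (∀ e, L2I (G.ℓ e) (G.EdgeSpace e)) × (∀ v, S.Yd v) :=
    ContinuousLinearEquiv.equivOfInverse f g (fun z => rfl) (fun p => rfl)
  exact (completeSpace_congr (e := eqv.toEquiv) eqv.isUniformEmbedding).2 inferInstance

end HypSystem

/-! ### The energy identity on an interval. -/

section Energy

/-- Absolute continuity of the energy density will follow by comparing its increments with those of
`x` and of the primitive of `‖g‖`. -/
theorem absolutelyContinuousOnInterval_of_dist_le {X : Type*} [PseudoMetricSpace X] {h : ℝ → X}
    {p q : ℝ → ℝ} {a b C : ℝ} (hp : AbsolutelyContinuousOnInterval p a b)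
    (hq : AbsolutelyContinuousOnInterval q a b)
    (hd : ∀ x ∈ uIcc a b, ∀ y ∈ uIcc a b,
      dist (h x) (h y) ≤ C * (dist (p x) (p y) + dist (q x) (q y))) :
    AbsolutelyContinuousOnInterval h a b := by
  have h1 := (Tendsto.add (show Tendsto _ _ _ from hp) (show Tendsto _ _ _ from hq)).const_mul C
  rw [add_zero, mul_zero] at h1
  refine squeeze_zero' (Eventually.of_forall fun I => Finset.sum_nonneg fun i _ => dist_nonneg) ?_ h1
  have hev : ∀ᶠ I in AbsolutelyContinuousOnInterval.totalLengthFilter ⊓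
      𝓟 (AbsolutelyContinuousOnInterval.disjWithin a b),
      I ∈ AbsolutelyContinuousOnInterval.disjWithin a b :=
    eventually_inf_principal.2 (Eventually.of_forall fun _ h => h)
  filter_upwards [hev] with I hI
  rw [← Finset.sum_add_distrib, Finset.mul_sum]
  exact Finset.sum_le_sum fun i hi => hd _ (hI.1 i hi).1 _ (hI.1 i hi).2

variable {F : Type*} [NormedAddCommGroup F] [InnerProductSpace ℂ F]

theorem abs_re_inner_le_norm (a b : F) : |(⟪a, b⟫_ℂ).re| ≤ ‖a‖ * ‖b‖ :=
  (Complex.abs_re_le_norm _).trans (norm_inner_le_norm _ _)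

theorem hasDerivAt_re_inner {f k : ℝ → F} {f' k' : F} {x : ℝ} (hf : HasDerivAt f f' x)
    (hk : HasDerivAt k k' x) :
    HasDerivAt (fun x => (⟪f x, k x⟫_ℂ).re) ((⟪f x, k'⟫_ℂ).re + (⟪f', k x⟫_ℂ).re) x := by
  let _ : InnerProductSpace ℝ F := InnerProductSpace.complexToReal
  exact HasDerivAt.inner ℝ hf hk

/-- Energy identity for the primitive of an integrable function and a Lipschitz continuous
symmetric operator function, up to the contribution of the derivative of the latter. -/
theorem abs_energy_sub_le [FiniteDimensional ℂ F] {ℓ : ℝ} (hℓ : 0 < ℓ) {f g : ℝ → F}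
    (hg : IntervalIntegrable g volume 0 ℓ) (hfg : ∀ x ∈ Icc 0 ℓ, f x = f 0 + ∫ y in (0 : ℝ)..x, g y)
    {L : ℝ → F →L[ℝ] F} {K : NNReal} (hL : LipschitzOnWith K L (Icc 0 ℓ))
    (hsym : ∀ x ∈ Icc 0 ℓ, ∀ a b, ⟪L x a, b⟫_ℂ = ⟪a, L x b⟫_ℂ) :
    |(⟪f ℓ, L ℓ (f ℓ)⟫_ℂ).re - (⟪f 0, L 0 (f 0)⟫_ℂ).re
        - 2 * ∫ x in (0 : ℝ)..ℓ, (⟪f x, L x (g x)⟫_ℂ).re|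
      ≤ ∫ x in (0 : ℝ)..ℓ, K * ‖f x‖ ^ 2 := by
  have : CompleteSpace F := FiniteDimensional.complete ℂ F
  have : FiniteDimensional ℝ F := FiniteDimensional.complexToReal F
  have hfc : ContinuousOn f (Icc 0 ℓ) := by
    refine ContinuousOn.congr ?_ hfg
    have h1 := intervalIntegral.continuousOn_primitive_interval'
      (a := 0) (b₁ := 0) (b₂ := ℓ) hg left_mem_uIcc
    rw [uIcc_of_le hℓ.le] at h1
    exact continuousOn_const.add h1
  obtain ⟨A, hA⟩ := isCompact_Icc.exists_bound_of_continuousOn hfc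
  obtain ⟨B, hB⟩ := isCompact_Icc.exists_bound_of_continuousOn hL.continuousOn
  have h0 : (0 : ℝ) ∈ Icc 0 ℓ := ⟨le_rfl, hℓ.le⟩
  have hA0 : 0 ≤ A := (norm_nonneg _).trans (hA 0 h0)
  have hB0 : 0 ≤ B := (norm_nonneg _).trans (hB 0 h0)
  set h : ℝ → ℝ := fun x => (⟪f x, L x (f x)⟫_ℂ).re with hh
  have hsub : ∀ x ∈ Icc 0 ℓ, ∀ y ∈ Icc 0 ℓ, IntervalIntegrable g volume x y := fun x hx y hy =>
    hg.mono_set (by rw [uIcc_of_le hℓ.le]; exact uIcc_subset_Icc hx hy)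
  have hfd : ∀ x ∈ Icc 0 ℓ, ∀ y ∈ Icc 0 ℓ,
      ‖f x - f y‖ ≤ dist (∫ t in (0 : ℝ)..x, ‖g t‖) (∫ t in (0 : ℝ)..y, ‖g t‖) := by
    intro x hx y hy
    rw [hfg x hx, hfg y hy, add_sub_add_left_eq_sub,
      intervalIntegral.integral_interval_sub_left (hsub 0 h0 x hx) (hsub 0 h0 y hy),
      Real.dist_eq, intervalIntegral.integral_interval_sub_left (hsub 0 h0 x hx).norm
        (hsub 0 h0 y hy).norm]
    exact intervalIntegral.norm_integral_le_abs_integral_norm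
  have hac : AbsolutelyContinuousOnInterval h 0 ℓ := by
    have hid : AbsolutelyContinuousOnInterval (fun x : ℝ => x) 0 ℓ :=
      (LipschitzWith.id.lipschitzOnWith (s := uIcc 0 ℓ)).absolutelyContinuousOnInterval
    have hpr : AbsolutelyContinuousOnInterval (fun x => ∫ t in (0 : ℝ)..x, ‖g t‖) 0 ℓ :=
      hg.norm.absolutelyContinuousOnInterval_intervalIntegral left_mem_uIcc
    -- The increment splits into three: two move `f`, each costing `A B δ`, and one moves `L`,
    -- costing `K A² |x - y|`.
    refine absolutelyContinuousOnInterval_of_dist_le (C := 2 * A * B + K * A ^ 2) hid hpr ?_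
    rw [uIcc_of_le hℓ.le]
    intro x hx y hy
    have e : h x - h y = (⟪f x - f y, L x (f x)⟫_ℂ).re + (⟪f y, (L x - L y) (f x)⟫_ℂ).re
        + (⟪f y, L y (f x - f y)⟫_ℂ).re := by
      simp only [hh, inner_sub_left, inner_sub_right, sub_apply, map_sub, Complex.sub_re]
      ring
    have d1 := hfd x hx y hy
    have d2 : ‖L x - L y‖ ≤ K * dist x y := by rw [← dist_eq_norm]; exact hL.dist_le_mul x hx y hy
    set δ := dist (∫ t in (0 : ℝ)..x, ‖g t‖) (∫ t in (0 : ℝ)..y, ‖g t‖)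
    have hδ : 0 ≤ δ := dist_nonneg
    have t1 : |(⟪f x - f y, L x (f x)⟫_ℂ).re| ≤ δ * (B * A) :=
      (abs_re_inner_le_norm _ _).trans (by
        gcongr
        exact (L x).le_of_opNorm_le_of_le (hB x hx) (hA x hx))
    have t2 : |(⟪f y, (L x - L y) (f x)⟫_ℂ).re| ≤ A * (K * dist x y * A) :=
      (abs_re_inner_le_norm _ _).trans (by
        gcongr
        · exact hA y hy
        · exact (L x - L y).le_of_opNorm_le_of_le d2 (hA x hx))
    have t3 : |(⟪f y, L y (f x - f y)⟫_ℂ).re| ≤ A * (B * δ) :=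
      (abs_re_inner_le_norm _ _).trans (by
        gcongr
        · exact hA y hy
        · exact (L y).le_of_opNorm_le_of_le (hB y hy) d1)
    rw [Real.dist_eq, e]
    have hxy : 0 ≤ dist x y := dist_nonneg
    have hK : 0 ≤ (K : ℝ) := K.2
    calc _ ≤ δ * (B * A) + A * (K * dist x y * A) + A * (B * δ) :=
          (abs_add_three _ _ _).trans (by gcongr)
      _ ≤ _ := by
        have : 0 ≤ 2 * A * B * dist x y + K * A ^ 2 * δ := by positivity
        nlinarith
  -- Almost everywhere `h' = 2 Re ⟪f, L g⟫ + Re ⟪f, L' f⟫` by symmetry of `L`, and `‖L'‖ ≤ K`.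
  have hder : ∀ᵐ x ∂volume.restrict (Ioc 0 ℓ),
      |deriv h x - 2 * (⟪f x, L x (g x)⟫_ℂ).re| ≤ K * ‖f x‖ ^ 2 := by
    rw [restrict_Ioo_eq_restrict_Ioc.symm, ae_restrict_iff' measurableSet_Ioo]
    filter_upwards [hg.ae_hasDerivAt_integral, hL.ae_differentiableWithinAt_of_mem (μ := volume)]
      with x hx1 hx2 hx
    have hxI : x ∈ Icc 0 ℓ := Ioo_subset_Icc_self hx
    have hnhds : Icc 0 ℓ ∈ 𝓝 x := Icc_mem_nhds hx.1 hx.2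
    have hf' : HasDerivAt f (g x) x :=
      ((hx1 (by rwa [uIcc_of_le hℓ.le]) 0 left_mem_uIcc).const_add (f 0)).congr_of_eventuallyEq
        (by filter_upwards [hnhds] with y hy using hfg y hy)
    have hL' : HasDerivAt L (deriv L x) x := ((hx2 hxI).differentiableAt hnhds).hasDerivAt
    have hLK : ‖deriv L x‖ ≤ K := norm_deriv_le_of_lipschitzOn hnhds hL
    have hh' := hasDerivAt_re_inner hf' (hL'.clm_apply hf')
    rw [hh'.deriv]
    have e : (⟪g x, L x (f x)⟫_ℂ).re = (⟪f x, L x (g x)⟫_ℂ).re := by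
      rw [← hsym x hxI]; exact inner_re_symm (𝕜 := ℂ) _ _
    rw [inner_add_right, Complex.add_re, e,
      show ∀ a b : ℝ, a + b + b - 2 * b = a from fun a b => by ring]
    calc _ ≤ ‖f x‖ * ‖deriv L x (f x)‖ := abs_re_inner_le_norm _ _
      _ ≤ ‖f x‖ * (K * ‖f x‖) := by gcongr; exact (deriv L x).le_of_opNorm_le hLK _
      _ = K * ‖f x‖ ^ 2 := by ring
  have hint1 : IntervalIntegrable (fun x => (⟪f x, L x (g x)⟫_ℂ).re) volume 0 ℓ := by
    rw [intervalIntegrable_iff_integrableOn_Icc_of_le hℓ.le] at hg ⊢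
    have m1 : AEStronglyMeasurable f (volume.restrict (Icc 0 ℓ)) :=
      hfc.aestronglyMeasurable measurableSet_Icc
    have m2 : AEStronglyMeasurable L (volume.restrict (Icc 0 ℓ)) :=
      hL.continuousOn.aestronglyMeasurable measurableSet_Icc
    have m3 : AEStronglyMeasurable (fun x => L x (g x)) (volume.restrict (Icc 0 ℓ)) :=
      (isBoundedBilinearMap_apply (𝕜 := ℝ) (E := F) (F := F)).continuous.comp_aestronglyMeasurable
        (m2.prodMk hg.aestronglyMeasurable)
    refine (hg.norm.const_mul (A * B)).mono'
      (Complex.continuous_re.comp_aestronglyMeasurable (m1.inner m3)) ?_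
    rw [ae_restrict_iff' measurableSet_Icc]
    refine Eventually.of_forall fun x hx => (abs_re_inner_le_norm _ _).trans ?_
    rw [mul_assoc]
    gcongr
    · exact hA x hx
    · exact (L x).le_of_opNorm_le (hB x hx) _
  have hint2 : IntervalIntegrable (fun x => (K : ℝ) * ‖f x‖ ^ 2) volume 0 ℓ := by
    refine ContinuousOn.intervalIntegrable ?_
    rw [uIcc_of_le hℓ.le]
    exact continuousOn_const.mul (hfc.norm.pow 2)
  have hftc := hac.integral_deriv_eq_sub
  change |h ℓ - h 0 - _| ≤ _
  rw [← hftc, ← intervalIntegral.integral_const_mul,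
    ← intervalIntegral.integral_sub hac.intervalIntegrable_deriv (hint1.const_mul 2)]
  exact intervalIntegral.norm_integral_le_of_norm_le hℓ.le
    (f := fun x => deriv h x - 2 * (⟪f x, L x (g x)⟫_ℂ).re) ((ae_restrict_iff' measurableSet_Ioc).1 hder) hint2

end Energy

/-! ### Lipschitz matrix functions as operator functions. -/

section MatrixFunctions

variable {n : Type*} {ℓ : ℝ}

theorem IsLip.continuousOn {A : ℝ → Matrix n n ℂ} (hA : IsLip ℓ A) : ContinuousOn A (Icc 0 ℓ) := by
  refine continuousOn_pi.2 fun i => continuousOn_pi.2 fun j => ?_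
  obtain ⟨K, hK⟩ := hA i j
  exact hK.continuousOn

variable [Fintype n]

theorem IsLip.mul {A B : ℝ → Matrix n n ℂ} (hA : IsLip ℓ A) (hB : IsLip ℓ B) :
    IsLip ℓ fun x => A x * B x := by
  intro i j
  have h : ∀ k, ∃ K, LipschitzOnWith K (fun x => A x i k * B x k j) (Icc 0 ℓ) := by
    intro k
    obtain ⟨K, hK⟩ := hA i k
    obtain ⟨K', hK'⟩ := hB k j
    obtain ⟨C, hC⟩ := isCompact_Icc.exists_bound_of_continuousOn hK.continuousOn
    obtain ⟨C', hC'⟩ := isCompact_Icc.exists_bound_of_continuousOn hK'.continuousOn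
    refine ⟨_, LipschitzOnWith.of_dist_le' (K := C * K' + K * C') fun x hx y hy => ?_⟩
    have e : A x i k * B x k j - A y i k * B y k j
        = A x i k * (B x k j - B y k j) + (A x i k - A y i k) * B y k j := by ring
    rw [dist_eq_norm, e]
    have h1 := hK.dist_le_mul x hx y hy
    have h2 := hK'.dist_le_mul x hx y hy
    rw [dist_eq_norm] at h1 h2
    calc _ ≤ C * (K' * dist x y) + K * dist x y * C' := by
          refine (norm_add_le _ _).trans ?_
          rw [norm_mul, norm_mul]
          have := (norm_nonneg _).trans (hC x hx)
          gcongr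
          · exact hC x hx
          · exact hC' y hy
      _ = _ := by ring
  choose K hK using h
  refine ⟨_, LipschitzOnWith.of_dist_le' (K := ∑ k, (K k : ℝ)) fun x hx y hy => ?_⟩
  simp only [Matrix.mul_apply]
  rw [Finset.sum_mul]
  refine (dist_sum_sum_le _ _ _).trans (Finset.sum_le_sum fun k _ => ?_)
  exact (hK k).dist_le_mul x hx y hy

variable [DecidableEq n]

/-- A matrix acting as a real bounded operator on `ℂⁿ`. -/
noncomputable def matrixOp (A : Matrix n n ℂ) : EuclideanSpace ℂ n →L[ℝ] EuclideanSpace ℂ n :=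
  ((Matrix.toEuclideanLin A).toContinuousLinearMap).restrictScalars ℝ

theorem matrixOp_apply (A : Matrix n n ℂ) (ξ : EuclideanSpace ℂ n) :
    matrixOp A ξ = Matrix.toEuclideanLin A ξ := rfl

theorem IsLip.exists_lipschitzOnWith_matrixOp {A : ℝ → Matrix n n ℂ} (hA : IsLip ℓ A) :
    ∃ K, LipschitzOnWith K (fun x => matrixOp (A x)) (Icc 0 ℓ) := by
  choose K hK using hA
  refine ⟨_, LipschitzOnWith.of_dist_le' (K := ∑ i, ∑ j, (K i j : ℝ)) fun x hx y hy => ?_⟩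
  rw [dist_eq_norm]
  refine ContinuousLinearMap.opNorm_le_bound _ (by positivity) fun ξ => ?_
  rw [sub_apply, matrixOp_apply, matrixOp_apply, ← LinearMap.sub_apply, ← map_sub]
  refine (norm_toEuclideanLin_le _ _).trans ?_
  gcongr
  rw [Finset.sum_mul]
  refine Finset.sum_le_sum fun i _ => ?_
  rw [Finset.sum_mul]
  refine Finset.sum_le_sum fun j _ => ?_
  rw [Matrix.sub_apply, ← dist_eq_norm]
  exact (hK i j).dist_le_mul x hx y hy

end MatrixFunctions

/-! ### Continuous representatives and the energy estimate in `H¹(0,ℓ)`. -/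

section SobolevInterval

variable {F : Type*} [NormedAddCommGroup F] [NormedSpace ℂ F] [CompleteSpace F] {ℓ : ℝ}

theorem H1.isWeakDeriv_deriv (u : H1 ℓ F) : IsWeakDeriv (u : L2I ℓ F) (H1.deriv u) :=
  u.2.choose_spec

theorem H1.coeFn_ae_eq_rep (hℓ : 0 < ℓ) (u : H1 ℓ F) :
    (u : L2I ℓ F) =ᵐ[volume.restrict (Ioo (0 : ℝ) ℓ)] H1.rep hℓ u :=
  (H1.exists_continuous hℓ u).choose_spec.2

theorem L2I.intervalIntegrable {F : Type*} [NormedAddCommGroup F] {ℓ : ℝ} (hℓ : 0 < ℓ)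
    (u : L2I ℓ F) : IntervalIntegrable u volume 0 ℓ := by
  rw [intervalIntegrable_iff_integrableOn_Ioo_of_le hℓ.le]
  exact L2I.integrable u

omit [CompleteSpace F] in
theorem L2I.continuousOn_primitive (hℓ : 0 < ℓ) (g : L2I ℓ F) :
    ContinuousOn (fun x => ∫ y in (0 : ℝ)..x, g y) (Icc 0 ℓ) := by
  have h := intervalIntegral.continuousOn_primitive_interval'
    (a := 0) (L2I.intervalIntegrable hℓ g) left_mem_uIcc
  rwa [uIcc_of_le hℓ.le] at h

theorem H1.rep_eq_primitive (hℓ : 0 < ℓ) (u : H1 ℓ F) :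
    ∀ x ∈ Icc 0 ℓ, H1.rep hℓ u x = H1.rep hℓ u 0 + ∫ y in (0 : ℝ)..x, H1.deriv u y := by
  obtain ⟨c, hc⟩ := (H1.isWeakDeriv_deriv u).exists_primitive hℓ
  have h := H1.rep_unique hℓ u
    (continuousOn_const.add (L2I.continuousOn_primitive hℓ (H1.deriv u))) hc
  intro x hx
  rw [h hx, h ⟨le_rfl, hℓ.le⟩]
  simp

/-- Energy estimate in `H¹(0,ℓ)` for a Lipschitz continuous Hermitian matrix function. -/
theorem H1.exists_energy_le {n : Type*} [Fintype n] [DecidableEq n] (hℓ : 0 < ℓ)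
    {A : ℝ → Matrix n n ℂ} (hA : IsLip ℓ A) (hherm : ∀ x ∈ Icc 0 ℓ, (A x).IsHermitian) :
    ∃ K : ℝ, 0 ≤ K ∧ ∀ u : H1 ℓ (EuclideanSpace ℂ n),
      |(⟪H1.rep hℓ u ℓ, Matrix.toEuclideanLin (A ℓ) (H1.rep hℓ u ℓ)⟫_ℂ).re
        - (⟪H1.rep hℓ u 0, Matrix.toEuclideanLin (A 0) (H1.rep hℓ u 0)⟫_ℂ).re
        - 2 * (⟪(u : L2I ℓ (EuclideanSpace ℂ n)), mulL2 A hA.isLinfty (H1.deriv u)⟫_ℂ).re|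
        ≤ K * ‖u‖ ^ 2 := by
  obtain ⟨K, hK⟩ := hA.exists_lipschitzOnWith_matrixOp
  refine ⟨K, K.2, fun u => ?_⟩
  have h := abs_energy_sub_le hℓ (L2I.intervalIntegrable hℓ (H1.deriv u))
    (H1.rep_eq_primitive hℓ u) hK
    (fun x hx a b => Matrix.isSymmetric_toEuclideanLin_iff.2 (hherm x hx) a b)
  have e1 : (⟪(u : L2I ℓ (EuclideanSpace ℂ n)), mulL2 A hA.isLinfty (H1.deriv u)⟫_ℂ).re
      = ∫ x in (0 : ℝ)..ℓ, (⟪H1.rep hℓ u x, matrixOp (A x) (H1.deriv u x)⟫_ℂ).re := by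
    rw [intervalIntegral.integral_of_le hℓ.le, integral_Ioc_eq_integral_Ioo, L2.inner_def]
    refine (integral_re (L2.integrable_inner (𝕜 := ℂ) _ _)).symm.trans (integral_congr_ae ?_)
    filter_upwards [H1.coeFn_ae_eq_rep hℓ u, mulL2_coeFn hA.isLinfty (H1.deriv u)] with x h1 h2
    rw [h1, h2]
    rfl
  have e2 : ∫ x in (0 : ℝ)..ℓ, (K : ℝ) * ‖H1.rep hℓ u x‖ ^ 2 = K * ‖u‖ ^ 2 := by
    rw [intervalIntegral.integral_const_mul, intervalIntegral.integral_of_le hℓ.le,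
      integral_Ioc_eq_integral_Ioo, Submodule.coe_norm,
      ← inner_self_eq_norm_sq (𝕜 := ℂ) (u : L2I ℓ (EuclideanSpace ℂ n)), L2.inner_def]
    congr 1
    refine Eq.trans ?_ (integral_re (L2.integrable_inner (𝕜 := ℂ) _ _))
    refine integral_congr_ae ?_
    filter_upwards [H1.coeFn_ae_eq_rep hℓ u] with x h1
    rw [h1, inner_self_eq_norm_sq (𝕜 := ℂ)]
  rw [e1, ← e2]
  exact h

end SobolevInterval

/-! ### Null isotropy and the boundary forms at the vertices. -/

section NullForm

variable {W : Type*} [NormedAddCommGroup W] [InnerProductSpace ℂ W] [FiniteDimensional ℂ W]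

theorem inner_coe_eq_inner_projection (U : Submodule ℂ W) (ξ : W) (y : U) :
    ⟪ξ, (y : W)⟫_ℂ = ⟪U.orthogonalProjectionOnto ξ, y⟫_ℂ :=
  (Submodule.inner_orthogonalProjectionOnto_eq_of_mem_right y ξ).symm

/-- Moving the projector and the adjoint across the inner product turns the two terms with `Q` into
`⟪P ξ, Q B ξ⟫` and its conjugate, so their real parts agree. -/
theorem re_inner_eq_of_null_form {Y Z : Submodule ℂ W} (T : W →ₗ[ℂ] W) (B : Y →ₗ[ℂ] Z)
    (Q : Z →ₗ[ℂ] Z) (hQ : ∀ x y : Z, ⟪Q x, y⟫_ℂ = ⟪x, Q y⟫_ℂ) (ξ : Y)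
    (h : ⟪(ξ : W), T ξ + (Q (B ξ) : W)
      + (LinearMap.adjoint B (Q (Z.orthogonalProjectionOnto (ξ : W))) : W)⟫_ℂ = 0) :
    (⟪(ξ : W), T ξ⟫_ℂ).re
      = - 2 * (⟪Z.orthogonalProjectionOnto (ξ : W), Q (B ξ)⟫_ℂ).re := by
  rw [inner_add_right, inner_add_right, inner_coe_eq_inner_projection Z] at h
  have hB : ⟪(ξ : W), (LinearMap.adjoint B (Q (Z.orthogonalProjectionOnto (ξ : W))) : W)⟫_ℂ
      = ⟪Q (B ξ), Z.orthogonalProjectionOnto (ξ : W)⟫_ℂ := by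
    refine (LinearMap.adjoint_inner_right B ξ _).trans ?_
    exact (hQ _ _).symm
  have hs : (⟪Q (B ξ), Z.orthogonalProjectionOnto (ξ : W)⟫_ℂ).re
      = (⟪Z.orthogonalProjectionOnto (ξ : W), Q (B ξ)⟫_ℂ).re :=
    inner_re_symm (𝕜 := ℂ) (E := Z) _ _
  rw [hB] at h
  have h1 := congrArg Complex.re h
  rw [Complex.add_re, Complex.add_re, hs, Complex.zero_re] at h1
  linarith

end NullForm

namespace HypSystem

variable {V E : Type*} [Fintype E] [DecidableEq V] {G : MetricGraph V E} (S : HypSystem G)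

/-- The boundary form `⟨Q_e M_e u_e, u_e⟩` at the point `x` of the edge `e`. -/
noncomputable def boundaryForm (u : G.Dmax) (e : E) (x : ℝ) : ℂ :=
  ⟪H1.rep (G.ℓ_pos e) (u e) x,
    Matrix.toEuclideanLin (S.Q e x * S.M e x) (H1.rep (G.ℓ_pos e) (u e) x)⟫_ℂ

theorem inner_T_eq [DecidableEq E] (v : V) (u : G.Dmax) :
    ⟪G.trace v u, S.T v (G.trace v u)⟫_ℂ
      = ∑ e : G.Inc v, G.incidence v e * S.boundaryForm u e (G.coord v e) := by
  rw [PiLp.inner_apply, Fintype.sum_sigma]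
  refine Finset.sum_congr rfl fun e _ => ?_
  rw [boundaryForm, PiLp.inner_apply, Finset.mul_sum]
  refine Finset.sum_congr rfl fun i _ => ?_
  have h : S.T v (G.trace v u) ⟨e, i⟩ = G.incidence v e *
      Matrix.toEuclideanLin (S.Q e (G.coord v e) * S.M e (G.coord v e))
        (H1.rep (G.ℓ_pos e) (u e) (G.coord v e)) i := by
    have h1 : ∀ p : (Σ e : G.Inc v, Fin (G.k e)), G.trace v u p
        = H1.rep (G.ℓ_pos p.1) (u p.1) (G.coord v p.1) p.2 := fun p => rfl
    simp only [T, Matrix.toLpLin_apply, Matrix.mulVec, dotProduct, h1]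
    rw [Fintype.sum_sigma, Finset.sum_eq_single e, Finset.mul_sum]
    · refine Finset.sum_congr rfl fun j _ => ?_
      rw [Matrix.blockDiagonal'_apply_eq, Matrix.smul_apply, smul_eq_mul, mul_assoc]
    · intro e' _ hne
      refine Finset.sum_eq_zero fun j _ => ?_
      rw [Matrix.blockDiagonal'_apply_ne _ _ _ hne.symm, zero_mul]
    · intro h; exact absurd (Finset.mem_univ e) h
  rw [h, RCLike.inner_apply, RCLike.inner_apply]
  change _ * (starRingEnd ℂ) (H1.rep (G.ℓ_pos e) (u e) (G.coord v e) i) = _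
  ring

/-- Exchange the sums over vertices and edges: each edge is met once at its terminal endpoint with
sign `+` and once at its initial endpoint with sign `-`. Absence of loops is what gives the terminal
endpoint the coordinate `ℓ e`. -/
theorem sum_inner_T_eq [Fintype V] [DecidableEq E] (u : G.Dmax) :
    ∑ v, ⟪G.trace v u, S.T v (G.trace v u)⟫_ℂ
      = ∑ e, (S.boundaryForm u e (G.ℓ e) - S.boundaryForm u e 0) := by
  have h1 : ∀ v, ⟪G.trace v u, S.T v (G.trace v u)⟫_ℂ
      = ∑ e, G.incidence v e * S.boundaryForm u e (G.coord v e) := by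
    intro v
    rw [inner_T_eq]
    rw [← Finset.sum_subtype (Finset.univ.filter fun e => G.src e = v ∨ G.tgt e = v)
      (fun e => by simp) (fun e => G.incidence v e * S.boundaryForm u e (G.coord v e))]
    refine Finset.sum_filter_of_ne fun e _ hne => ?_
    by_contra hcon
    rw [not_or] at hcon
    simp [MetricGraph.incidence, hcon.1, hcon.2] at hne
  simp_rw [h1]
  rw [Finset.sum_comm]
  refine Finset.sum_congr rfl fun e _ => ?_
  simp only [MetricGraph.incidence, sub_mul, ite_mul, one_mul, zero_mul, Finset.sum_sub_distrib,
    Finset.sum_ite_eq, Finset.mem_univ, if_true]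
  simp [MetricGraph.coord, G.src_ne_tgt e]

theorem re_inner_T_of_isNullIsotropic [DecidableEq E] {v : V} (h : S.IsNullIsotropic v)
    (ξ : S.Y v) :
    (⟪(ξ : G.VSpace v), S.T v ξ⟫_ℂ).re = - 2 * (⟪S.P v ξ, S.Qd v (S.B v ξ)⟫_ℂ).re :=
  re_inner_eq_of_null_form (S.T v) (S.B v) (S.Qd v) (S.Qd_symm v) ξ (h ξ)

end HypSystem

/-! ### Quasi-dissipativity of `𝔸` and `-𝔸`. -/

namespace HypSystem

variable {V E : Type*} [Fintype E] [DecidableEq V] {G : MetricGraph V E} (S : HypSystem G)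
  [Fintype V]

-- Replaces the chosen membership witness in `opAA` by an explicit `u` in the maximal domain.
omit [Fintype V] in
theorem mem_graph_opAA_iff (z w : S.L2d) : (z, w) ∈ S.opAA.graph ↔
    ∃ (u : G.Dmax) (hv : ∀ v, G.trace v u ∈ S.Y v), (∀ e, S.edge z e = u e) ∧
      (∀ v, S.vert z v = S.P v (G.trace v u)) ∧ (∀ e, S.edge w e = S.opA u e) ∧
      ∀ v, S.vert w v = S.B v ⟨G.trace v u, hv v⟩ + S.C v (S.vert z v) := by
  rw [LinearPMap.mem_graph_iff]
  constructor
  · rintro ⟨y, rfl, rfl⟩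
    exact ⟨S.toDmax y.1 y.2.choose, fun v => (y.2.choose_spec v).1, fun e => rfl,
      fun v => (y.2.choose_spec v).2, fun e => rfl, fun v => rfl⟩
  · rintro ⟨u, hv, h1, h2, h3, h4⟩
    have hE : ∀ e, S.edge z e ∈ H1 (G.ℓ e) (G.EdgeSpace e) := fun e => by
      rw [h1 e]; exact (u e).2
    have hu : S.toDmax z hE = u := funext fun e => Subtype.ext (h1 e)
    have hz : z ∈ S.opAA.domain := ⟨hE, fun v => by rw [hu]; exact ⟨hv v, h2 v⟩⟩
    refine ⟨⟨z, hz⟩, rfl, ?_⟩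
    refine Prod.ext (funext fun e => ?_) (funext fun v => ?_)
    · change S.opA (S.toDmax z hE) e = S.edge w e
      rw [hu, h3]
    · change S.B v ⟨G.trace v (S.toDmax z hE), _⟩ + S.C v (S.vert z v) = S.vert w v
      rw [h4]
      congr 2
      exact Subtype.ext (congrArg (G.trace v) hu)

omit [Fintype V] in
theorem exists_norm_inner_mulQ_mulN_le (e : E) : ∃ C : ℝ, 0 ≤ C ∧
    ∀ u : L2I (G.ℓ e) (G.EdgeSpace e),
      |(⟪u, mulL2 (S.Q e) (S.Q_lip e).isLinfty (mulL2 (S.N e) (S.N_bdd e) u)⟫_ℂ).re|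
        ≤ C * ‖u‖ ^ 2 := by
  obtain ⟨C, hC0, hC⟩ := (S.Q_lip e).isLinfty.exists_norm_mulL2_le
  obtain ⟨D, hD0, hD⟩ := (S.N_bdd e).exists_norm_mulL2_le
  refine ⟨C * D, by positivity, fun u => (abs_re_inner_le_norm _ _).trans ?_⟩
  calc _ ≤ ‖u‖ * (C * (D * ‖u‖)) := by
        gcongr
        refine (norm_le_mul_norm_of_ae (hC _)).trans ?_
        gcongr
        exact norm_le_mul_norm_of_ae (hD u)
    _ = _ := by ring

omit [Fintype V] in
theorem exists_norm_inner_Qd_C_le (v : V) : ∃ C : ℝ, 0 ≤ C ∧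
    ∀ x : S.Yd v, |(⟪x, S.Qd v (S.C v x)⟫_ℂ).re| ≤ C * ‖x‖ ^ 2 := by
  let f := (S.Qd v ∘ₗ S.C v).toContinuousLinearMap
  refine ⟨‖f‖, ContinuousLinearMap.opNorm_nonneg f, fun x => (abs_re_inner_le_norm (F := S.Yd v) _ _).trans ?_⟩
  calc _ ≤ ‖x‖ * (‖f‖ * ‖x‖) := by gcongr; exact f.le_opNorm x
    _ = _ := by ring

/-- Both `𝔸` and `-𝔸` are quasi-dissipative. -/
theorem exists_abs_re_inner_opAA_le [DecidableEq E] (hY : ∀ v, S.IsNullIsotropic v) :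
    ∃ β : ℝ, 0 ≤ β ∧ ∀ p ∈ S.opAA.graph, |(⟪p.1, p.2⟫_ℂ).re| ≤ β * ‖p.1‖ ^ 2 := by
  choose K hK0 hK using fun e => H1.exists_energy_le (G.ℓ_pos e)
    ((S.Q_lip e).mul (S.M_lip e)) (S.QM_herm e)
  choose C hC0 hC using S.exists_norm_inner_mulQ_mulN_le
  choose D hD0 hD using S.exists_norm_inner_Qd_C_le
  choose c hc0 hc using S.exists_norm_edge_le
  choose d hd0 hd using S.exists_norm_vert_le
  refine ⟨∑ e, (K e / 2 + C e) * c e + ∑ v, D v * d v, ?_, ?_⟩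
  · exact add_nonneg
      (Finset.sum_nonneg fun e _ => mul_nonneg (by have := hK0 e; have := hC0 e; positivity) (hc0 e))
      (Finset.sum_nonneg fun v _ => mul_nonneg (hD0 v) (hd0 v))
  rintro ⟨z, w⟩ hp
  obtain ⟨u, hv, h1, h2, h3, h4⟩ := (S.mem_graph_opAA_iff z w).1 hp
  set a : E → ℝ := fun e => (⟪(u e : L2I (G.ℓ e) (G.EdgeSpace e)),
    mulL2 _ ((S.Q_lip e).mul (S.M_lip e)).isLinfty (H1.deriv (u e))⟫_ℂ).re with ha
  set b : E → ℝ := fun e => (⟪(u e : L2I (G.ℓ e) (G.EdgeSpace e)),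
    mulL2 (S.Q e) (S.Q_lip e).isLinfty (mulL2 (S.N e) (S.N_bdd e) (u e))⟫_ℂ).re with hb
  set p : V → ℝ := fun v =>
    (⟪S.P v (G.trace v u), S.Qd v (S.B v ⟨G.trace v u, hv v⟩)⟫_ℂ).re with hpdef
  set q : V → ℝ := fun v => (⟪S.vert z v, S.Qd v (S.C v (S.vert z v))⟫_ℂ).re with hq
  set t : E → ℝ := fun e =>
    (S.boundaryForm u e (G.ℓ e)).re - (S.boundaryForm u e 0).re with ht
  have hinner : (⟪z, w⟫_ℂ).re = ∑ e, (a e + b e) + ∑ v, (p v + q v) := by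
    rw [inner_eq_innerD, innerD_eq, Complex.add_re, Complex.re_sum, Complex.re_sum]
    refine congrArg₂ (· + ·) (Finset.sum_congr rfl fun e _ => ?_)
      (Finset.sum_congr rfl fun v _ => ?_)
    · rw [h1, h3]
      change (⟪(u e : L2I (G.ℓ e) (G.EdgeSpace e)), mulL2 (S.Q e) (S.Q_lip e).isLinfty
        (mulL2 (S.M e) (S.M_lip e).isLinfty (H1.deriv (u e))
          + mulL2 (S.N e) (S.N_bdd e) (u e))⟫_ℂ).re = _
      rw [map_add, inner_add_right, Complex.add_re,
        mulL2_comp (S.Q_lip e).isLinfty (S.M_lip e).isLinfty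
          ((S.Q_lip e).mul (S.M_lip e)).isLinfty]
    · rw [h4, map_add]
      have h5 : ⟪S.vert z v, S.Qd v (S.B v ⟨G.trace v u, hv v⟩) + S.Qd v (S.C v (S.vert z v))⟫_ℂ
          = ⟪S.vert z v, S.Qd v (S.B v ⟨G.trace v u, hv v⟩)⟫_ℂ
            + ⟪S.vert z v, S.Qd v (S.C v (S.vert z v))⟫_ℂ :=
        inner_add_right (𝕜 := ℂ) (E := S.Yd v) _ _ _
      rw [h5, Complex.add_re]
      simp only [hpdef, hq, h2]
  have hbd : ∑ e, t e = - 2 * ∑ v, p v := by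
    have h5 := congrArg Complex.re (S.sum_inner_T_eq u)
    rw [Complex.re_sum, Complex.re_sum] at h5
    simp only [Complex.sub_re] at h5
    rw [← h5, Finset.mul_sum]
    exact Finset.sum_congr rfl fun v _ =>
      S.re_inner_T_of_isNullIsotropic (hY v) ⟨G.trace v u, hv v⟩
  -- The vertex terms with `B_v` cancel half of the boundary terms: each `a e` becomes `a e - t e /
  -- 2`, which the energy estimate bounds although neither part is bounded in `L²`.
  have hsplit : (⟪z, w⟫_ℂ).re = ∑ e, (-(t e - 2 * a e) / 2 + b e) + ∑ v, q v := by
    rw [hinner]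
    have : ∑ v, p v = - (∑ e, t e) / 2 := by linarith
    rw [Finset.sum_add_distrib (f := p), this]
    have h6 : ∑ e, (-(t e - 2 * a e) / 2 + b e) = ∑ e, (a e + b e) - (∑ e, t e) / 2 := by
      rw [Finset.sum_div, ← Finset.sum_sub_distrib]
      exact Finset.sum_congr rfl fun e _ => by ring
    rw [h6]; ring
  simp only
  rw [hsplit, add_mul, Finset.sum_mul, Finset.sum_mul]
  refine (abs_add_le _ _).trans (add_le_add ((Finset.abs_sum_le_sum_abs _ _).trans
    (Finset.sum_le_sum fun e _ => ?_)) ((Finset.abs_sum_le_sum_abs _ _).trans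
    (Finset.sum_le_sum fun v _ => ?_)))
  · have e1 : |t e - 2 * a e| ≤ K e * ‖S.edge z e‖ ^ 2 := by rw [h1]; exact hK e (u e)
    have e2 : |b e| ≤ C e * ‖S.edge z e‖ ^ 2 := by rw [h1]; exact hC e (u e)
    calc _ ≤ |t e - 2 * a e| / 2 + |b e| := by
          refine (abs_add_le _ _).trans (le_of_eq ?_)
          rw [abs_div, abs_neg, abs_two]
      _ ≤ (K e / 2 + C e) * ‖S.edge z e‖ ^ 2 := by linarith
      _ ≤ (K e / 2 + C e) * (c e * ‖z‖ ^ 2) :=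
          mul_le_mul_of_nonneg_left (hc e z) (by have := hK0 e; have := hC0 e; positivity)
      _ = _ := by ring
  · calc _ ≤ D v * ‖S.vert z v‖ ^ 2 := hD v _
      _ ≤ D v * (d v * ‖z‖ ^ 2) := mul_le_mul_of_nonneg_left (hd v z) (hD0 v)
      _ = _ := by ring

end HypSystem

/-! ### The Volterra operator and initial value problems in `H¹(0,ℓ)`. -/

section Volterra

variable {F : Type*} [NormedAddCommGroup F] [NormedSpace ℂ F] {ℓ : ℝ}

omit [NormedSpace ℂ F] in
theorem exists_integral_norm_le (ℓ : ℝ) : ∃ D : ℝ, 0 ≤ D ∧ ∀ g : L2I ℓ F,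
    ∫ x in Ioo 0 ℓ, ‖g x‖ ≤ D * ‖g‖ := by
  set μ := volume.restrict (Ioo (0 : ℝ) ℓ) with hμ
  refine ⟨(μ univ ^ (1 / (1 : ENNReal).toReal - 1 / (2 : ENNReal).toReal)).toReal,
    ENNReal.toReal_nonneg, fun g => ?_⟩
  have h := eLpNorm_le_eLpNorm_mul_rpow_measure_univ (p := 1) (q := 2) (μ := μ) (f := g)
    (by norm_num) (Lp.aestronglyMeasurable g)
  rw [integral_norm_eq_lintegral_enorm (Lp.aestronglyMeasurable g),
    ← eLpNorm_one_eq_lintegral_enorm, Lp.norm_def, mul_comm, ← ENNReal.toReal_mul]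
  refine ENNReal.toReal_mono (ENNReal.mul_ne_top (Lp.eLpNorm_ne_top g) ?_) h
  exact ENNReal.rpow_ne_top_of_nonneg (by norm_num) (measure_ne_top μ univ)

omit [NormedSpace ℂ F] in
theorem memLp_of_continuousOn {f : ℝ → F} (hf : ContinuousOn f (Icc 0 ℓ)) :
    MemLp f 2 (volume.restrict (Ioo (0 : ℝ) ℓ)) := by
  obtain ⟨C, hC⟩ := isCompact_Icc.exists_bound_of_continuousOn hf
  refine MemLp.of_bound ((hf.mono Ioo_subset_Icc_self).aestronglyMeasurable measurableSet_Ioo) C ?_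
  rw [ae_restrict_iff' measurableSet_Ioo]
  exact Eventually.of_forall fun x hx => hC x (Ioo_subset_Icc_self hx)

/-- The Volterra operator `g ↦ ∫₀ˣ g` on `L²(0,ℓ)`. -/
noncomputable def volterra (hℓ : 0 < ℓ) : L2I ℓ F →ₗ[ℂ] L2I ℓ F where
  toFun g := (memLp_of_continuousOn (L2I.continuousOn_primitive hℓ g)).toLp _
  map_add' g g' := by
    rw [← MemLp.toLp_add]
    refine MemLp.toLp_congr _ _ ?_
    rw [EventuallyEq, ae_restrict_iff' measurableSet_Ioo]
    refine Eventually.of_forall fun x hx => ?_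
    have hs : uIcc 0 x ⊆ uIcc 0 ℓ := by
      rw [uIcc_of_le hx.1.le, uIcc_of_le hℓ.le]; exact Icc_subset_Icc_right hx.2.le
    rw [Pi.add_apply, ← intervalIntegral.integral_add
      ((L2I.intervalIntegrable hℓ g).mono_set hs) ((L2I.intervalIntegrable hℓ g').mono_set hs)]
    rw [intervalIntegral.integral_of_le hx.1.le, intervalIntegral.integral_of_le hx.1.le,
      integral_Ioc_eq_integral_Ioo, integral_Ioc_eq_integral_Ioo]
    exact integral_congr_ae (ae_restrict_of_ae_restrict_of_subset (Ioo_subset_Ioo_right hx.2.le)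
      (Lp.coeFn_add g g'))
  map_smul' c g := by
    rw [RingHom.id_apply, ← MemLp.toLp_const_smul]
    refine MemLp.toLp_congr _ _ ?_
    rw [EventuallyEq, ae_restrict_iff' measurableSet_Ioo]
    refine Eventually.of_forall fun x hx => ?_
    rw [Pi.smul_apply, ← intervalIntegral.integral_smul, intervalIntegral.integral_of_le hx.1.le,
      intervalIntegral.integral_of_le hx.1.le, integral_Ioc_eq_integral_Ioo,
      integral_Ioc_eq_integral_Ioo]
    exact integral_congr_ae (ae_restrict_of_ae_restrict_of_subset (Ioo_subset_Ioo_right hx.2.le)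
      (Lp.coeFn_smul c g))

theorem volterra_coeFn (hℓ : 0 < ℓ) (g : L2I ℓ F) :
    volterra hℓ g =ᵐ[volume.restrict (Ioo (0 : ℝ) ℓ)] fun x => ∫ y in (0 : ℝ)..x, g y :=
  (memLp_of_continuousOn (L2I.continuousOn_primitive hℓ g)).coeFn_toLp

/-- The composition of the Volterra operator with a pointwise bounded operator is quasinilpotent. -/
theorem exists_sub_comp_volterra_eq [CompleteSpace F] (hℓ : 0 < ℓ) (T : L2I ℓ F →ₗ[ℂ] L2I ℓ F)
    {C : ℝ} (hC0 : 0 ≤ C)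
    (hT : ∀ u, ∀ᵐ x ∂volume.restrict (Ioo (0 : ℝ) ℓ), ‖T u x‖ ≤ C * ‖u x‖) (b : L2I ℓ F) :
    ∃ g : L2I ℓ F, g - T (volterra hℓ g) = b := by
  set μ := volume.restrict (Ioo (0 : ℝ) ℓ) with hμ
  obtain ⟨D, hD0, hD⟩ := exists_integral_norm_le (F := F) ℓ
  have hmem : ∀ᵐ x ∂μ, x ∈ Ioo 0 ℓ := ae_restrict_mem measurableSet_Ioo
  have hpt : ∀ g, ∀ᵐ x ∂μ, ‖T (volterra hℓ g) x‖ ≤ C * ∫ y in (0 : ℝ)..x, ‖g y‖ := by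
    intro g
    filter_upwards [hT (volterra hℓ g), volterra_coeFn hℓ g, hmem] with x h1 h2 hx
    refine h1.trans ?_
    rw [h2]
    gcongr
    exact intervalIntegral.norm_integral_le_integral_norm hx.1.le
  -- The constant of the embedding of `L^∞` into `L²` on the interval.
  set m : ℝ := μ.real univ ^ (2 : ENNReal).toReal⁻¹ with hm
  have hm0 : 0 ≤ m := by positivity
  have hnorm : ∀ (f : L2I ℓ F) (c : ℝ), 0 ≤ c → (∀ᵐ x ∂μ, ‖f x‖ ≤ c) → ‖f‖ ≤ m * c := by
    intro f c hc h
    exact Lp.norm_le_of_ae_bound hc h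
  have hle : ∀ g : L2I ℓ F, ∀ x ∈ Ioo 0 ℓ, ∫ y in (0 : ℝ)..x, ‖g y‖ ≤ D * ‖g‖ := by
    intro g x hx
    refine le_trans ?_ (hD g)
    rw [← integral_Ioc_eq_integral_Ioo, ← intervalIntegral.integral_of_le hℓ.le]
    exact intervalIntegral.integral_mono_interval le_rfl hx.1.le hx.2.le
      (Eventually.of_forall fun y => norm_nonneg _) (L2I.intervalIntegrable hℓ g).norm
  let K : L2I ℓ F →L[ℂ] L2I ℓ F := LinearMap.mkContinuous (T ∘ₗ volterra hℓ) (m * (C * D)) (by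
    intro g
    rw [mul_assoc, mul_assoc]
    refine hnorm _ _ (by positivity) ?_
    filter_upwards [hpt g, hmem] with x h1 hx
    exact h1.trans (mul_le_mul_of_nonneg_left (hle g x hx) hC0))
  have hK : ∀ g, K g = T (volterra hℓ g) := fun g => rfl
  -- The exponent starts at `1`: one integration is needed before an `L²` function has a pointwise
  -- bound. Each further one raises the power of `x` and produces the factorial, so the Neumann
  -- series converges with no smallness assumption.
  have hpow : ∀ n : ℕ, ∀ g : L2I ℓ F, ∀ᵐ x ∂μ,
      ‖(K ^ (n + 1)) g x‖ ≤ C * ((C * x) ^ n / n.factorial) * (D * ‖g‖) := by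
    intro n
    induction n with
    | zero =>
      intro g
      filter_upwards [hpt g, hmem] with x h1 hx
      simp only [zero_add, pow_one, pow_zero, Nat.factorial_zero, Nat.cast_one, div_one, mul_one]
      exact h1.trans (mul_le_mul_of_nonneg_left (hle g x hx) hC0)
    | succ n ih =>
      intro g
      have hi := ih g
      filter_upwards [hpt ((K ^ (n + 1)) g), hmem] with x h1 hx
      rw [pow_succ' K (n + 1)]
      refine h1.trans ?_
      rw [mul_assoc]
      refine mul_le_mul_of_nonneg_left ?_ hC0
      have hsub : uIcc 0 x ⊆ uIcc 0 ℓ := by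
        rw [uIcc_of_le hx.1.le, uIcc_of_le hℓ.le]; exact Icc_subset_Icc_right hx.2.le
      calc ∫ y in (0 : ℝ)..x, ‖(K ^ (n + 1)) g y‖
          ≤ ∫ y in (0 : ℝ)..x, C * ((C * y) ^ n / n.factorial) * (D * ‖g‖) := by
            rw [intervalIntegral.integral_of_le hx.1.le, intervalIntegral.integral_of_le hx.1.le,
              integral_Ioc_eq_integral_Ioo, integral_Ioc_eq_integral_Ioo]
            refine integral_mono_ae ?_ ?_
              (ae_restrict_of_ae_restrict_of_subset (Ioo_subset_Ioo_right hx.2.le) hi)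
            · exact (L2I.integrable ((K ^ (n + 1)) g)).norm.mono_measure
                (Measure.restrict_mono (Ioo_subset_Ioo_right hx.2.le) le_rfl)
            · refine (Continuous.integrableOn_Icc ?_).mono_set Ioo_subset_Icc_self
              fun_prop
        _ = (C * x) ^ (n + 1) / (n + 1).factorial * (D * ‖g‖) := by
            have e : ∀ y : ℝ, C * ((C * y) ^ n / n.factorial) * (D * ‖g‖)
                = (C ^ (n + 1) / n.factorial * (D * ‖g‖)) * y ^ n := fun y => by ring
            simp_rw [e]
            rw [intervalIntegral.integral_const_mul, integral_pow, Nat.factorial_succ]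
            have : (n.factorial : ℝ) ≠ 0 := by positivity
            push_cast
            field_simp
            simp
            ring
  have hopn : ∀ n : ℕ, ‖K ^ (n + 1)‖ ≤ m * C * D * ((C * ℓ) ^ n / n.factorial) := by
    intro n
    refine ContinuousLinearMap.opNorm_le_bound _ (by positivity) fun g => ?_
    have e : m * C * D * ((C * ℓ) ^ n / n.factorial) * ‖g‖
        = m * (C * ((C * ℓ) ^ n / n.factorial) * (D * ‖g‖)) := by ring
    rw [e]
    refine hnorm _ _ (by positivity) ?_
    filter_upwards [hpow n g, hmem] with x h1 hx
    refine h1.trans ?_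
    have := hx.1.le
    have := hx.2.le
    gcongr
  have hsum : Summable fun n : ℕ => K ^ n := by
    rw [← summable_nat_add_iff 1]
    exact Summable.of_norm_bounded ((Real.summable_pow_div_factorial (C * ℓ)).mul_left _) hopn
  refine ⟨(∑' n : ℕ, K ^ n) b, ?_⟩
  have := congrArg (fun A : L2I ℓ F →L[ℂ] L2I ℓ F => A b) hsum.one_sub_mul_tsum_pow
  simpa [hK] using this

variable [CompleteSpace F]

theorem H1.exists_of_deriv (hℓ : 0 < ℓ) (c : F) (g : L2I ℓ F) :
    ∃ u : H1 ℓ F, (u : L2I ℓ F) = Lp.const 2 _ c + volterra hℓ g ∧ H1.deriv u = g ∧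
      H1.rep hℓ u 0 = c := by
  have hae : (Lp.const 2 _ c + volterra hℓ g : L2I ℓ F)
      =ᵐ[volume.restrict (Ioo (0 : ℝ) ℓ)] fun x => c + ∫ y in (0 : ℝ)..x, g y := by
    filter_upwards [Lp.coeFn_add (Lp.const 2 (volume.restrict (Ioo (0 : ℝ) ℓ)) c) (volterra hℓ g),
      Lp.coeFn_const 2 (volume.restrict (Ioo (0 : ℝ) ℓ)) c, volterra_coeFn hℓ g] with x h1 h2 h3
    rw [h1, Pi.add_apply, h2, h3]
    rfl
  have hwd : IsWeakDeriv (Lp.const 2 _ c + volterra hℓ g : L2I ℓ F) g := by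
    intro φ hφ
    rw [← integral_deriv_smul_primitive (L2I.integrable g) hφ]
    have e1 : ∫ x in Ioo 0 ℓ, _root_.deriv φ x • (Lp.const 2 _ c + volterra hℓ g : L2I ℓ F) x
        = ∫ x in Ioo 0 ℓ, (_root_.deriv φ x • c + _root_.deriv φ x • ∫ y in (0 : ℝ)..x, g y) := by
      refine integral_congr_ae ?_
      filter_upwards [hae] with x hx
      rw [hx, smul_add]
    have hi : Integrable (_root_.deriv φ) (volume.restrict (Ioo (0 : ℝ) ℓ)) :=
      (hφ.continuous_deriv.integrable_of_hasCompactSupport hφ.2.1.deriv).restrict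
    have hi2 : Integrable (fun x => _root_.deriv φ x • ∫ y in (0 : ℝ)..x, g y)
        (volume.restrict (Ioo (0 : ℝ) ℓ)) :=
      ((hφ.continuous_deriv.continuousOn.smul
        (L2I.continuousOn_primitive hℓ g)).integrableOn_Icc).mono_set Ioo_subset_Icc_self
    have h0 : ∫ x in Ioo 0 ℓ, _root_.deriv φ x = 0 := by
      rw [← integral_Ioc_eq_integral_Ioo, ← intervalIntegral.integral_of_le hℓ.le,
        intervalIntegral.integral_deriv_eq_sub
          (fun x _ => (hφ.1.differentiable (by norm_num)).differentiableAt)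
          (hφ.continuous_deriv.intervalIntegrable _ _),
        image_eq_zero_of_notMem_tsupport (fun h => lt_irrefl _ (hφ.2.2 h).2),
        image_eq_zero_of_notMem_tsupport (fun h => lt_irrefl _ (hφ.2.2 h).1), sub_zero]
    rw [e1, integral_add (hi.smul_const c) hi2, integral_smul_const, h0, zero_smul, zero_add]
  refine ⟨⟨_, g, hwd⟩, rfl, (H1.isWeakDeriv_deriv _).unique hwd, ?_⟩
  rw [H1.rep_unique hℓ _ (continuousOn_const.add (L2I.continuousOn_primitive hℓ g)) hae
    ⟨le_rfl, hℓ.le⟩]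
  simp

/-- Existence for the initial value problem `u' = T u + h`, `u(0) = c` in `H¹(0,ℓ)`. -/
theorem H1.exists_initialValue (hℓ : 0 < ℓ) (T : L2I ℓ F →ₗ[ℂ] L2I ℓ F) {C : ℝ} (hC0 : 0 ≤ C)
    (hT : ∀ u, ∀ᵐ x ∂volume.restrict (Ioo (0 : ℝ) ℓ), ‖T u x‖ ≤ C * ‖u x‖)
    (c : F) (h : L2I ℓ F) :
    ∃ u : H1 ℓ F, H1.deriv u = T u + h ∧ H1.rep hℓ u 0 = c := by
  -- The unknown is `g = u'`: inserting `u = c + ∫₀ˣ g` into the equation gives `g - T (volterra g)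
  -- = T c + h`.
  obtain ⟨g, hg⟩ := exists_sub_comp_volterra_eq hℓ T hC0 hT (T (Lp.const 2 _ c) + h)
  obtain ⟨u, hu, hd, h0⟩ := H1.exists_of_deriv hℓ c g
  refine ⟨u, ?_, h0⟩
  rw [hd, hu, map_add]
  rw [sub_eq_iff_eq_add] at hg
  rw [hg]
  nth_rewrite 2 [← hg]
  abel

end Volterra

/-! ### Inverses of matrix functions. -/

section InverseMatrix

variable {n : Type*} [Fintype n] [DecidableEq n] {ℓ : ℝ}

/-- By Cramer's formula the inverse is continuous where the determinant does not vanish, hence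
bounded on the compact interval. -/
theorem IsLip.isLinfty_inv {A : ℝ → Matrix n n ℂ} (hA : IsLip ℓ A)
    (hu : ∀ x ∈ Icc 0 ℓ, IsUnit (A x)) : IsLinfty ℓ fun x => (A x)⁻¹ := by
  intro i j
  have hc : ContinuousOn (fun x => (A x)⁻¹ i j) (Icc 0 ℓ) := by
    have h1 : ContinuousOn (fun x => (A x).det⁻¹) (Icc 0 ℓ) := by
      refine ContinuousOn.inv₀ (continuous_id.matrix_det.comp_continuousOn hA.continuousOn) ?_
      intro x hx
      exact ((Matrix.isUnit_iff_isUnit_det _).1 (hu x hx)).ne_zero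
    have h2 : ContinuousOn (fun x => (A x).adjugate i j) (Icc 0 ℓ) :=
      ((continuous_apply_apply i j).comp
        (continuous_id.matrix_adjugate (A := fun B : Matrix n n ℂ => B))).comp_continuousOn
        hA.continuousOn
    refine (h1.mul h2).congr fun x _ => ?_
    simp [Matrix.inv_def, Ring.inverse_eq_inv']
  obtain ⟨C, hC⟩ := isCompact_Icc.exists_bound_of_continuousOn hc
  refine memLp_top_of_bound
    ((hc.mono Ioo_subset_Icc_self).aestronglyMeasurable measurableSet_Ioo) C ?_
  rw [ae_restrict_iff' measurableSet_Ioo]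
  exact Eventually.of_forall fun x hx => hC x (Ioo_subset_Icc_self hx)

theorem mulL2_mulL2_inv {A : ℝ → Matrix n n ℂ} (hA : IsLinfty ℓ A)
    (hu : ∀ x ∈ Icc 0 ℓ, IsUnit (A x)) (hi : IsLinfty ℓ fun x => (A x)⁻¹)
    (w : L2I ℓ (EuclideanSpace ℂ n)) : mulL2 A hA (mulL2 _ hi w) = w := by
  apply Lp.ext
  filter_upwards [mulL2_coeFn hA (mulL2 _ hi w), mulL2_coeFn hi w, ae_restrict_mem measurableSet_Ioo]
    with x h1 h2 hx
  rw [h1, h2]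
  have h3 : A x * (A x)⁻¹ = 1 :=
    Matrix.mul_nonsing_inv _ ((Matrix.isUnit_iff_isUnit_det _).1 (hu x (Ioo_subset_Icc_self hx)))
  simp [Matrix.toLpLin_apply, h3]

end InverseMatrix

/-! ### Dimension identities and projections. -/

section Dimension

variable {W₁ W₂ : Type*} [NormedAddCommGroup W₁] [InnerProductSpace ℂ W₁] [FiniteDimensional ℂ W₁]
  [NormedAddCommGroup W₂] [InnerProductSpace ℂ W₂] [FiniteDimensional ℂ W₂]

/-- The kernel of the adjoint is the orthogonal complement of the range. -/
theorem finrank_range_add_finrank_ker_adjoint (B : W₁ →ₗ[ℂ] W₂) :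
    Module.finrank ℂ (LinearMap.range B) + Module.finrank ℂ (LinearMap.ker (LinearMap.adjoint B))
      = Module.finrank ℂ W₂ := by
  have h : LinearMap.ker (LinearMap.adjoint B) = (LinearMap.range B)ᗮ := by
    ext x
    rw [LinearMap.mem_ker, Submodule.mem_orthogonal]
    constructor
    · rintro hx _ ⟨y, rfl⟩
      rw [← LinearMap.adjoint_inner_right, hx, inner_zero_right]
    · intro hx
      refine ext_inner_left ℂ fun y => ?_
      rw [LinearMap.adjoint_inner_right, inner_zero_right]
      exact hx _ ⟨y, rfl⟩
  rw [h]
  exact Submodule.finrank_add_finrank_orthogonal _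

theorem finrank_range_add_finrank_ker_of_eq_adjoint {Y Z : Submodule ℂ W₁} (B : Y →ₗ[ℂ] Z)
    (A : Z →ₗ[ℂ] Y) (hA : A = LinearMap.adjoint (𝕜 := ℂ) (E := Y) (F := Z) B) :
    Module.finrank ℂ (LinearMap.range B) + Module.finrank ℂ (LinearMap.ker A)
      = Module.finrank ℂ Z := by
  rw [hA]
  exact finrank_range_add_finrank_ker_adjoint (W₁ := Y) (W₂ := Z) B

theorem mem_iff_orthogonalProjectionOnto_orthogonal (Y : Submodule ℂ W₁) (x : W₁) :
    Yᗮ.orthogonalProjectionOnto x = 0 ↔ x ∈ Y := by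
  rw [Submodule.orthogonalProjectionOnto_eq_zero_iff, Submodule.orthogonal_orthogonal]

theorem orthogonalProjectionOnto_of_mem {Y : Submodule ℂ W₁} {x : W₁} (hx : x ∈ Y) :
    Y.orthogonalProjectionOnto x = ⟨x, hx⟩ :=
  Submodule.orthogonalProjectionOnto_mem_subspace_eq_self (⟨x, hx⟩ : Y)

end Dimension

/-! ### Solvability of the resolvent equation. -/

namespace HypSystem

variable {V E : Type*} [Fintype E] [DecidableEq V] {G : MetricGraph V E} (S : HypSystem G)

/-- The operator `μ - 𝒜` on the maximal domain. -/
noncomputable def edgeResolventOp (μ : ℂ) : G.Dmax →ₗ[ℂ] ∀ e, L2I (G.ℓ e) (G.EdgeSpace e) :=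
  μ • LinearMap.pi (fun e => (H1 (G.ℓ e) (G.EdgeSpace e)).subtype ∘ₗ LinearMap.proj e) - S.opA

theorem edgeResolventOp_apply (μ : ℂ) (u : G.Dmax) (e : E) :
    S.edgeResolventOp μ u e = μ • (u e : L2I (G.ℓ e) (G.EdgeSpace e)) - S.opA u e := rfl

/-- The initial values of an element of the maximal domain. -/
noncomputable def initialValues : G.Dmax →ₗ[ℂ] ∀ e, G.EdgeSpace e :=
  LinearMap.pi fun e =>
    H1.eval (G.ℓ_pos e) 0 ⟨le_rfl, (G.ℓ_pos e).le⟩ ∘ₗ LinearMap.proj e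

/-- Multiplying by `M⁻¹` gives `u' = M⁻¹ (μ - N) u - M⁻¹ f`, an initial value problem on each edge
separately. -/
theorem exists_edgeResolventOp_eq (μ : ℂ) (f : ∀ e, L2I (G.ℓ e) (G.EdgeSpace e))
    (c : ∀ e, G.EdgeSpace e) :
    ∃ u : G.Dmax, S.edgeResolventOp μ u = f ∧ initialValues u = c := by
  have h : ∀ e, ∃ u : H1 (G.ℓ e) (G.EdgeSpace e),
      mulL2 (S.M e) (S.M_lip e).isLinfty (H1.deriv u)
        = μ • (u : L2I (G.ℓ e) (G.EdgeSpace e)) - mulL2 (S.N e) (S.N_bdd e) u - f e ∧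
      H1.rep (G.ℓ_pos e) u 0 = c e := by
    intro e
    have hi := (S.M_lip e).isLinfty_inv (S.M_invertible e)
    obtain ⟨C, hC0, hC⟩ := hi.exists_norm_mulL2_le
    obtain ⟨D, hD0, hD⟩ := (S.N_bdd e).exists_norm_mulL2_le
    obtain ⟨u, hu, h0⟩ := H1.exists_initialValue (G.ℓ_pos e)
      (mulL2 _ hi ∘ₗ (μ • LinearMap.id - mulL2 (S.N e) (S.N_bdd e)))
      (C := C * (‖μ‖ + D)) (by positivity) (fun w => by
        filter_upwards [hC (μ • w - mulL2 (S.N e) (S.N_bdd e) w), hD w,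
          Lp.coeFn_sub (μ • w) (mulL2 (S.N e) (S.N_bdd e) w), Lp.coeFn_smul μ w] with x h1 h2 h3 h4
        refine h1.trans ?_
        rw [mul_assoc]
        refine mul_le_mul_of_nonneg_left ?_ hC0
        change ‖(μ • w - mulL2 (S.N e) (S.N_bdd e) w : L2I (G.ℓ e) (G.EdgeSpace e)) x‖ ≤ _
        rw [h3, Pi.sub_apply, h4, Pi.smul_apply, add_mul]
        refine (norm_sub_le _ _).trans ?_
        rw [norm_smul]
        gcongr) (c e) (- mulL2 _ hi (f e))
    refine ⟨u, ?_, h0⟩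
    rw [hu, map_add, map_neg, mulL2_mulL2_inv _ (S.M_invertible e), LinearMap.comp_apply,
      mulL2_mulL2_inv _ (S.M_invertible e), ← sub_eq_add_neg]
    rfl
  choose u hu h0 using h
  refine ⟨u, funext fun e => ?_, funext h0⟩
  rw [edgeResolventOp_apply]
  change μ • (u e : L2I (G.ℓ e) (G.EdgeSpace e))
    - (mulL2 (S.M e) (S.M_lip e).isLinfty (H1.deriv (u e)) + mulL2 (S.N e) (S.N_bdd e) (u e)) = f e
  rw [hu]
  abel

/-- The boundary conditions for the resolvent equation, as a linear map on the maximal domain. -/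
noncomputable def boundaryMap (μ : ℂ) : G.Dmax →ₗ[ℂ] ∀ v, (S.Y v)ᗮ × S.Yd v :=
  LinearMap.pi fun v =>
    ((S.Y v)ᗮ.orthogonalProjectionOnto.toLinearMap.prod
      (μ • S.P v - S.B v ∘ₗ (S.Y v).orthogonalProjectionOnto.toLinearMap - S.C v ∘ₗ S.P v))
        ∘ₗ G.trace v

/-- The vanishing first component puts the trace into `Y v`; there the projection that extends `B v`
to the whole space inside `boundaryMap` acts as the identity. -/
theorem boundaryMap_eq_iff (μ : ℂ) (u : G.Dmax) (y : ∀ v, S.Yd v) :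
    (S.boundaryMap μ u = fun v => (0, y v)) ↔ ∃ hv : ∀ v, G.trace v u ∈ S.Y v,
      ∀ v, μ • S.P v (G.trace v u) - S.B v ⟨G.trace v u, hv v⟩
        - S.C v (S.P v (G.trace v u)) = y v := by
  constructor
  · intro h
    have h1 : ∀ v, G.trace v u ∈ S.Y v := fun v =>
      (mem_iff_orthogonalProjectionOnto_orthogonal _ _).1 (congrArg Prod.fst (congrFun h v))
    refine ⟨h1, fun v => ?_⟩
    rw [← orthogonalProjectionOnto_of_mem (h1 v)]
    exact congrArg Prod.snd (congrFun h v)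
  · rintro ⟨h1, h2⟩
    refine funext fun v => Prod.ext ?_ ?_
    · exact (mem_iff_orthogonalProjectionOnto_orthogonal _ _).2 (h1 v)
    · have := h2 v
      rw [← orthogonalProjectionOnto_of_mem (h1 v)] at this
      exact this

variable [Fintype V]

omit [Fintype V] in
/-- An element of the maximal domain that satisfies the boundary conditions solves the resolvent
equation. -/
theorem exists_mem_graph_opAA (μ : ℂ) (f : S.L2d) (u : G.Dmax)
    (hu : S.edgeResolventOp μ u = S.edge f)
    (hb : S.boundaryMap μ u = fun v => (0, S.vert f v)) :
    ∃ p ∈ S.opAA.graph, μ • p.1 - p.2 = f ∧ ∀ e, S.edge p.1 e = u e := by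
  obtain ⟨hv, h2⟩ := (S.boundaryMap_eq_iff μ u _).1 hb
  let z : S.L2d := S.toProd.symm (fun e => u e, fun v => S.P v (G.trace v u))
  refine ⟨(z, μ • z - f), (S.mem_graph_opAA_iff _ _).2
    ⟨u, hv, fun e => rfl, fun v => rfl, fun e => ?_, fun v => ?_⟩, sub_sub_cancel _ _, fun e => rfl⟩
  · change μ • (u e : L2I (G.ℓ e) (G.EdgeSpace e)) - S.edge f e = S.opA u e
    rw [← hu, edgeResolventOp_apply, sub_sub_cancel]
  · change μ • S.P v (G.trace v u) - S.vert f v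
      = S.B v ⟨G.trace v u, hv v⟩ + S.C v (S.P v (G.trace v u))
    rw [← h2 v]
    abel

omit [Fintype V] in
theorem card_index (v : V) : Fintype.card (VertexBases.Index S v)
    = Module.finrank ℂ (S.Y v)ᗮ + Module.finrank ℂ (S.Yd v) := by
  have h : Module.finrank ℂ (LinearMap.range (S.B v)) + Module.finrank ℂ (LinearMap.ker (S.Badj v))
      = Module.finrank ℂ (S.Yd v) :=
    finrank_range_add_finrank_ker_of_eq_adjoint (S.B v) (S.Badj v) rfl
  rw [Fintype.card_sum, Fintype.card_sum, Fintype.card_fin, Fintype.card_fin, Fintype.card_fin, h]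

/-- A basis of `ℂ^k` has `k` members, and the family at `v` has `dim (Y v)ᗮ + dim (Yd v)` of them:
as many vertex conditions as initial values. -/
theorem finrank_boundarySpace [DecidableEq E] (b : S.VertexBases) (hb : b.BasisCondition) :
    Module.finrank ℂ (∀ v, (S.Y v)ᗮ × S.Yd v) = Module.finrank ℂ (∀ e, G.EdgeSpace e) := by
  have h1 : Module.finrank ℂ G.TotalSpace = Fintype.card (Σ v, VertexBases.Index S v) :=
    Module.finrank_eq_card_basis (Module.Basis.mk hb.1 hb.2.ge)
  have h2 : Module.finrank ℂ G.TotalSpace = ∑ e, G.k e := by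
    rw [finrank_euclideanSpace, Fintype.card_sigma]
    simp
  have h3 : Module.finrank ℂ (∀ e, G.EdgeSpace e) = ∑ e, G.k e := by
    rw [Module.finrank_pi_fintype]
    simp
  rw [h3, ← h2, h1, Fintype.card_sigma, Module.finrank_pi_fintype]
  refine Finset.sum_congr rfl fun v _ => ?_
  rw [Module.finrank_prod, S.card_index]

/-- If `μ - 𝔸` is bounded below, then it is onto. -/
theorem resolvent_surjective [DecidableEq E] (b : S.VertexBases) (hb : b.BasisCondition)
    {β : ℝ} (hA : ∀ p ∈ S.opAA.graph, |(⟪p.1, p.2⟫_ℂ).re| ≤ β * ‖p.1‖ ^ 2) {μ : ℝ} (hμ : β < |μ|)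
    (f : S.L2d) : ∃ p ∈ S.opAA.graph, (μ : ℂ) • p.1 - p.2 = f := by
  let Z := LinearMap.ker (S.edgeResolventOp μ)
  let Λ : Z →ₗ[ℂ] ∀ v, (S.Y v)ᗮ × S.Yd v := S.boundaryMap μ ∘ₗ Z.subtype
  let J : Z →ₗ[ℂ] ∀ e, G.EdgeSpace e := initialValues ∘ₗ Z.subtype
  have hJ : Function.Surjective J := by
    intro c
    obtain ⟨u, hu, hc⟩ := S.exists_edgeResolventOp_eq μ 0 c
    exact ⟨⟨u, hu⟩, hc⟩
  have hΛ : Function.Injective Λ := by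
    rw [← LinearMap.ker_eq_bot, LinearMap.ker_eq_bot']
    rintro ⟨u, hu⟩ h0
    obtain ⟨p, hp, hp0, hpu⟩ := S.exists_mem_graph_opAA μ 0 u hu h0
    have h1 := mul_norm_le_of_mem_graph hA μ hp
    rw [hp0, norm_zero] at h1
    have h2 : p.1 = 0 := by
      rw [← norm_le_zero_iff]
      by_contra hcon
      exact absurd h1 (not_le.2 (mul_pos (sub_pos.2 hμ) (not_le.1 hcon)))
    refine Subtype.ext (funext fun e => Subtype.ext ?_)
    exact (hpu e).symm.trans (by rw [h2]; rfl)
  have : FiniteDimensional ℂ Z := FiniteDimensional.of_injective Λ hΛ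
  -- Injectivity of `Λ` bounds `dim Z` from above and surjectivity of `J` from below, so uniqueness
  -- for the initial value problem is not needed.
  have hdim : Module.finrank ℂ Z = Module.finrank ℂ (∀ v, (S.Y v)ᗮ × S.Yd v) :=
    le_antisymm (LinearMap.finrank_le_finrank_of_injective hΛ)
      ((S.finrank_boundarySpace b hb).trans_le (LinearMap.finrank_le_finrank_of_surjective hJ))
  have hsurj := (LinearMap.injective_iff_surjective_of_finrank_eq_finrank hdim).1 hΛ
  -- A particular solution with zero initial values, then corrected by a homogeneous solution to
  -- meet the vertex conditions.
  obtain ⟨u₀, hu₀, -⟩ := S.exists_edgeResolventOp_eq μ (S.edge f) 0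
  obtain ⟨⟨w, hw⟩, hΛw⟩ := hsurj ((fun v => (0, S.vert f v)) - S.boundaryMap μ u₀)
  obtain ⟨p, hp, hpf, -⟩ := S.exists_mem_graph_opAA μ f (u₀ + w)
    (by rw [map_add, hu₀, LinearMap.mem_ker.1 hw, add_zero])
    (by rw [map_add]; exact (congrArg _ hΛw).trans (add_sub_cancel _ _))
  exact ⟨p, hp, hpf⟩

end HypSystem

end DynNet

theorem mainTheorem3 {V E : Type*} [Fintype V] [Fintype E] [DecidableEq V] [DecidableEq E]
    (G : DynNet.MetricGraph V E) (S : DynNet.HypSystem G)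
    (b : S.VertexBases) (hb : b.BasisCondition)
    (hY : ∀ v, S.IsNullIsotropic v) :
    DynNet.GeneratesC0Group S.opAA := by
  obtain ⟨β, hβ, hA⟩ := S.exists_abs_re_inner_opAA_le hY
  refine DynNet.generatesC0Group_of_bound S.opAA hβ hA (r := β + 1) fun μ hμ f => ?_
  exact S.resolvent_surjective b hb hA (by linarith) f
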